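/- Let $E/F$ be an unramified quadratic extension of non-archimedean local fields of odd residue characteristic, with nontrivial automorphism $x\mapsto\bar x$ and norm $\mathrm{Nm}(z)=z\bar z$. Let $\mathrm{val}$ be the valuation on $E$ with $\mathrm{val}(\varpi)=1$ for a uniformizer $\varpi$ of $F$, let $q$ be the cardinality of the residue field of $F$, let $|x|_F=q^{-\mathrm{val}(x)}$, and let $\omega$ be the quadratic character of $F^\times$ that is trivial exactly on $\mathrm{Nm}(E^\times)$. Fix $\zeta\in\mathcal O_E^\times$ with $\bar\zeta=-\zeta$. For a nondegenerate Hermitian space $W$ over $E$ let $U(W)$ be its unitary group and $\mathrm{Herm}(W)=\{X\in\mathrm{End}(W): X^*=X\}$, on which $U(W)$ acts by conjugation. Let $V_2=E^2$ with the split form $J=\begin{pmatrix}0&\zeta\\-\zeta&0\end{pmatrix}$ and self-dual lattice $\Lambda=\mathcal O_E^2$, and let $V_1=E$ with the form $\langle u,v\rangle=\bar u v$ and lattice $\Lambda_1=\mathcal O_E$, so that $\mathrm{Herm}(V_1)=F$. Haar measures on $U(V_2)$ and $U(V_1)$ give $U(\Lambda)$ and $U(\Lambda_1)$ volume one. The stabilizer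 $T_\delta$ of $\delta$ carries the Haar measure giving its maximal compact subgroup volume one, and $\mathrm{Orb}(\delta,f)=\int_{T_\delta\backslash U(W)}f(g^{-1}\delta g)\,d\dot g$. Let $\Phi=r_!\mathbf 1_{\mathrm{End}(\Lambda)}$ be the pushforward along $r(X)=XX^*$, that is, $\Phi(XX^*)=\int_{U(V_2)}\mathbf 1_{\mathrm{End}(\Lambda)}(Xh)\,dh$ for $X\in\mathrm{GL}(V_2)$, and $\Phi=0$ outside $r(\mathrm{GL}(V_2))$. For $x,y\in F^\times$ let $\Phi^\kappa(x,y)=1$ if $\mathrm{val}(x)$ and $\mathrm{val}(y)$ are both even and non-negative, and $\Phi^\kappa(x,y)=0$ otherwise. Let $a,b,\lambda,\mu\in F$ with $b\ne0$, $a+b\neq 0$, $a-b\ne0$, $\lambda\mu\zeta^2=b^2$ and $\omega(\mu)=1$, and put $\delta_+=\begin{pmatrix}a&\lambda\zeta\\ \mu\zeta&a\end{pmatrix}\in\mathrm{Herm}(V_2)$, whose eigenvalues are $a\pm b$. An element $t$ of $T_{\delta_+}(E)$, the centralizer of $\delta_+$ in $\mathrm{GL}(V_2)$, that is a cocycle for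 $\mathrm{Gal}(E/F)$ acts on the eigenlines for $a+b$ and $a-b$ by scalars in $F^\times$, and this gives $H^1(F,T_{\delta_+})\cong (F^\times/\mathrm{Nm}E^\times)^2$. Let $\kappa$ be the character of this group that is trivial on the first factor and is $\omega$ on the second. Suppose that $\delta'\in\mathrm{Herm}(W')$ is conjugate to $\delta_+$ by an $E$-linear isomorphism $g:V_2\to W'$, $\delta'=g\delta_+g^{-1}$. Then $\mathrm{inv}(\delta_+,\delta')$ is the class of the cocycle $\sigma\mapsto g^{-1}\sigma(g)$. For $W'=V_2$ this relation is called stable conjugacy. Put $$\mathrm{Orb}^\kappa(\delta_+,f)=\sum_{\delta'\sim_{st}\delta_+}\kappa(\mathrm{inv}(\delta_+,\delta'))\,\mathrm{Orb}(\delta',f),$$ where the sum is over $U(V_2)$-conjugacy classes, and let $SO$ be the stable orbital integral (the same sum with $\kappa=1$) for $U(V_1)\times U(V_1)$ acting on $\mathrm{Herm}(V_1)\oplus\mathrm{Herm}(V_1)$. The transfer factor is $$\Delta((a+b,a-b),\delta_+)=\kappa(\mathrm{inv}(\delta_+,\delta'))\,\omega(2b)\,|2b|_F,\qquad \delta'=(a+b)\oplus(a-b)\in\mathrm{Herm}(V_1\oplus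 V_1).$$ The matching is called nice if some isometry $V_2\cong V_1\oplus V_1$ carries $\delta_+$ to $\delta'$. Then: 1. On $F^\times\times F^\times$, $\Phi^\kappa$ is the pushforward of $\mathbf 1_{\mathrm{End}(\Lambda_1)}\otimes\mathbf 1_{\mathrm{End}(\Lambda_1)}$ along $r\times r$. 2. $SO((a+b,a-b),\Phi^\kappa)=\Delta((a+b,a-b),\delta_+)\,\mathrm{Orb}^\kappa(\delta_+,\Phi)$. 3. The matching is nice if and only if $\mathrm{val}(b)$ is even. If it is nice, then $\Delta((a+b,a-b),\delta_+)=(-q)^{-\mathrm{val}(b)}$; otherwise $\Delta((a+b,a-b),\delta_+)=-(-q)^{-\mathrm{val}(b)}$. -/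

import Mathlib

open MeasureTheory
open scoped ENNReal Matrix

noncomputable section

namespace RelEndo

/-! ### Orbital integrals for a topological group acting on a set -/

section Orbital

variable {G X : Type*} [Group G] [MulAction G X]

/-- The space `T \ G` of right cosets `T g`. -/
abbrev RightCosets (T : Subgroup G) : Type _ := Quotient (QuotientGroup.rightRel T)

/-- `m` is the invariant measure `dġ` on `T \ G` with `dt dġ = dg`. Here `dg = ν`, and `dt` is the
Haar measure on `T` that gives volume one to the largest compact subgroup of `T`. The inner
integral depends only on the coset and not on its representative. -/
def IsQuotientMeasure [TopologicalSpace G] [MeasurableSpace G] (ν : Measure G) (T : Subgroup G)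
    (m : Measure (RightCosets T)) : Prop :=
  ∃ τ : Measure T, τ.IsHaarMeasure ∧
    (∃ K : Subgroup T, IsGreatest {K : Subgroup T | IsCompact (K : Set T)} K ∧
      τ (K : Set T) = 1) ∧
    ∀ φ : G → ℝ≥0∞, Measurable φ →
      ∫⁻ g, φ g ∂ν = ∫⁻ y : RightCosets T, ∫⁻ t : T, φ ((t : G) * y.out) ∂τ ∂m

/-- The quotient measure on `T \ G`. -/
def quotientMeasure [TopologicalSpace G] [MeasurableSpace G] (ν : Measure G) (T : Subgroup G) :
    Measure (RightCosets T) :=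
  Classical.epsilon (IsQuotientMeasure ν T)

/-- The function `T g ↦ f (g⁻¹ • x)` on `T \ G`, where `T` is the stabilizer of `x`. -/
def orbitFun (x : X) (f : X → ℂ) : RightCosets (MulAction.stabilizer G x) → ℂ :=
  Quotient.lift (fun g : G => f (g⁻¹ • x)) (by
    intro g h hgh
    have h1 : h * g⁻¹ ∈ MulAction.stabilizer G x := QuotientGroup.rightRel_apply.mp hgh
    rw [MulAction.mem_stabilizer_iff, mul_smul] at h1
    show f (g⁻¹ • x) = f (h⁻¹ • x)
    rw [eq_inv_smul_iff.mpr h1])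

/-- The orbital integral `Orb(x, f) = ∫_{T \ G} f (g⁻¹ • x) dġ`, `T` the stabilizer of `x`. -/
def Orb [TopologicalSpace G] [MeasurableSpace G] (ν : Measure G) (x : X) (f : X → ℂ) : ℂ :=
  ∫ y, orbitFun x f y ∂(quotientMeasure ν (MulAction.stabilizer G x))

end Orbital

/-- The componentwise action of a product group on a product. -/
instance prodMulAction {G₁ G₂ X₁ X₂ : Type*} [Group G₁] [Group G₂] [MulAction G₁ X₁]
    [MulAction G₂ X₂] : MulAction (G₁ × G₂) (X₁ × X₂) where
  smul g x := (g.1 • x.1, g.2 • x.2)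
  one_smul x := Prod.ext (one_smul G₁ x.1) (one_smul G₂ x.2)
  mul_smul g h x := Prod.ext (mul_smul g.1 h.1 x.1) (mul_smul g.2 h.2 x.2)

/-! ### Hermitian spaces, unitary groups and twisted Lie algebras

`E` is a field with an involution `star`. -/

section Hermitian

variable {E : Type*} [Field E] [StarRing E] {ι : Type*} [Fintype ι] [DecidableEq ι]

variable (E ι) in
/-- A nondegenerate Hermitian form `⟨u, v⟩ = uᴴ * gram * v` on `E^ι`. -/
structure HermForm where
  gram : GL ι E
  herm : star gram = gram

/-- The adjoint `X* = H⁻¹ Xᴴ H` with respect to the form. -/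
def HermForm.adj (H : HermForm E ι) (X : Matrix ι ι E) : Matrix ι ι E :=
  ((H.gram⁻¹ : GL ι E) : Matrix ι ι E) * Xᴴ * (H.gram : Matrix ι ι E)

/-- The unitary group `U(W)`: all `g` with `⟨g u, g v⟩ = ⟨u, v⟩`. -/
def HermForm.U (H : HermForm E ι) : Subgroup (GL ι E) where
  carrier := {g | star g * H.gram * g = H.gram}
  mul_mem' := by
    intro a b ha hb
    simp only [Set.mem_ofPred_eq, star_mul] at *
    calc star b * star a * H.gram * (a * b) = star b * (star a * H.gram * a) * b := by
          simp only [mul_assoc]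
      _ = H.gram := by rw [ha, hb]
  one_mem' := by simp
  inv_mem' := by
    intro a ha
    simp only [Set.mem_ofPred_eq] at *
    rw [star_inv, mul_inv_eq_iff_eq_mul, inv_mul_eq_iff_eq_mul, ← mul_assoc, ha]

/-- The twisted Lie algebra `Herm(W)`: all `X` with `X* = X`. -/
def HermForm.Herm (H : HermForm E ι) : Type _ := {X : Matrix ι ι E // H.adj X = X}

lemma HermForm.adj_conj (H : HermForm E ι) (g : H.U) (X : Matrix ι ι E) (hX : H.adj X = X) :
    H.adj (((g : GL ι E) : Matrix ι ι E) * X * (((g : GL ι E)⁻¹ : GL ι E) : Matrix ι ι E)) =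
      ((g : GL ι E) : Matrix ι ι E) * X * (((g : GL ι E)⁻¹ : GL ι E) : Matrix ι ι E) := by
  obtain ⟨g, hg⟩ := g
  have hg' : star g * H.gram * g = H.gram := hg
  have e1 : star g * H.gram = H.gram * g⁻¹ := eq_mul_inv_of_mul_eq hg'
  have e2 : H.gram⁻¹ * star (g⁻¹) = g * H.gram⁻¹ := by
    rw [star_inv, ← mul_inv_rev, e1, mul_inv_rev, inv_inv]
  have e1m := congrArg (Units.val) e1
  have e2m := congrArg (Units.val) e2
  simp only [Units.val_mul, Units.coe_star, Matrix.star_eq_conjTranspose] at e1m e2m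
  unfold HermForm.adj at *
  simp only [Matrix.conjTranspose_mul]
  calc _ = (((H.gram⁻¹ : GL ι E) : Matrix ι ι E) * ((g⁻¹ : GL ι E) : Matrix ι ι E)ᴴ) * Xᴴ *
        ((g : Matrix ι ι E)ᴴ * (H.gram : Matrix ι ι E)) := by simp only [mul_assoc]
    _ = (g : Matrix ι ι E) * (((H.gram⁻¹ : GL ι E) : Matrix ι ι E) * Xᴴ *
        (H.gram : Matrix ι ι E)) * ((g⁻¹ : GL ι E) : Matrix ι ι E) := by
          rw [e1m, e2m]; simp only [mul_assoc]
    _ = _ := by rw [hX]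

/-- `U(W)` acts on `Herm(W)` by conjugation. -/
instance HermForm.instMulActionHerm (H : HermForm E ι) : MulAction H.U H.Herm where
  smul g X := ⟨((g : GL ι E) : Matrix ι ι E) * X.1 * (((g : GL ι E)⁻¹ : GL ι E) : Matrix ι ι E),
    H.adj_conj g X.1 X.2⟩
  one_smul X := Subtype.ext (by
    show ((1 : GL ι E) : Matrix ι ι E) * X.1 * (((1 : GL ι E)⁻¹ : GL ι E) : Matrix ι ι E) = X.1
    simp)
  mul_smul g h X := Subtype.ext (by
    show (((g : GL ι E) * (h : GL ι E) : GL ι E) : Matrix ι ι E) * X.1 *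
        ((((g : GL ι E) * (h : GL ι E))⁻¹ : GL ι E) : Matrix ι ι E) =
      ((g : GL ι E) : Matrix ι ι E) * (((h : GL ι E) : Matrix ι ι E) * X.1 *
        (((h : GL ι E)⁻¹ : GL ι E) : Matrix ι ι E)) * (((g : GL ι E)⁻¹ : GL ι E) : Matrix ι ι E)
    rw [mul_inv_rev, Units.val_mul, Units.val_mul]
    simp only [mul_assoc])

/-! ### Matching, the Galois action, and the invariant -/

/-- `g : W → W'` intertwines `δ` and `δ'`, that is, `δ' = Ad(g)(δ)`. -/
def Intertwines {H H' : HermForm E ι} (δ : H.Herm) (δ' : H'.Herm) (g : GL ι E) : Prop :=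
  (g : Matrix ι ι E) * δ.1 = δ'.1 * (g : Matrix ι ι E)

/-- `δ` and `δ'` are Jacquet--Langlands transfers of each other: they are conjugate under
`GL(E^ι)`. For `H' = H` this is stable conjugacy in `Herm(W)`. -/
def IsTransfer {H H' : HermForm E ι} (δ : H.Herm) (δ' : H'.Herm) : Prop :=
  ∃ g : GL ι E, Intertwines δ δ' g

/-- The action of the nontrivial element of `Gal(E/F)` on the `E`-points `GL(E^ι)` of the variety
of isometries `W → W'`: it sends `g` to `(g*)⁻¹`, where `g* = H⁻¹ gᴴ H'` is the adjoint
`W' → W`. For `W = W'` its fixed points are exactly `U(W)`. -/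
def gal (H H' : HermForm E ι) (g : GL ι E) : GL ι E :=
  (H.gram⁻¹ * star g * H'.gram)⁻¹

/-- The `1`-cocycles of `Gal(E/F)` with values in the `E`-points `{t ∈ GL(E^ι) | t δ = δ t}` of
`T_δ`. As the Galois group has two elements, a cocycle is determined by its value `t` at the
nontrivial one, and the condition on `t` is that `t * gal t = 1`. -/
def Cocycle {H : HermForm E ι} (δ : H.Herm) : Type _ :=
  {t : GL ι E // Intertwines δ δ t ∧ t * gal H H t = 1}

/-- `H¹(F, T_δ) = H¹(Gal(E/F), T_δ(E))`. This is all of the cohomology of `T_δ` because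
`T_δ(E) = E[δ]ˣ` has trivial first cohomology over `E`. -/
def H1 {H : HermForm E ι} (δ : H.Herm) : Type _ :=
  Quot (fun t t' : Cocycle δ => ∃ s : GL ι E, Intertwines δ δ s ∧ t'.1 = s⁻¹ * t.1 * gal H H s)

lemma Intertwines.inv {H H' : HermForm E ι} {δ : H.Herm} {δ' : H'.Herm} {g : GL ι E}
    (hg : Intertwines δ δ' g) : Intertwines δ' δ g⁻¹ := by
  unfold Intertwines at *
  calc ((g⁻¹ : GL ι E) : Matrix ι ι E) * δ'.1
      = ((g⁻¹ : GL ι E) : Matrix ι ι E) * (δ'.1 * (g : Matrix ι ι E)) *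
          ((g⁻¹ : GL ι E) : Matrix ι ι E) := by simp [mul_assoc]
    _ = δ.1 * ((g⁻¹ : GL ι E) : Matrix ι ι E) := by
        rw [← hg, ← mul_assoc, Units.inv_mul, one_mul]

lemma Intertwines.mul {H H' H'' : HermForm E ι} {δ : H.Herm} {δ' : H'.Herm} {δ'' : H''.Herm}
    {g h : GL ι E} (hh : Intertwines δ' δ'' h) (hg : Intertwines δ δ' g) :
    Intertwines δ δ'' (h * g) := by
  unfold Intertwines at *
  rw [Units.val_mul, mul_assoc, hg, ← mul_assoc, hh, mul_assoc]

lemma Intertwines.gal {H H' : HermForm E ι} {δ : H.Herm} {δ' : H'.Herm} {g : GL ι E}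
    (hg : Intertwines δ δ' g) : Intertwines δ δ' (gal H H' g) := by
  suffices h : Intertwines δ' δ (H.gram⁻¹ * star g * H'.gram) from h.inv
  have h1 := congrArg star hg
  have h2 : δ.1ᴴ * (H.gram : Matrix ι ι E) = (H.gram : Matrix ι ι E) * δ.1 := by
    conv_rhs => rw [← δ.2]
    simp [HermForm.adj, ← mul_assoc]
  have h3 : δ'.1ᴴ * (H'.gram : Matrix ι ι E) = (H'.gram : Matrix ι ι E) * δ'.1 := by
    conv_rhs => rw [← δ'.2]
    simp [HermForm.adj, ← mul_assoc]
  simp only [star_mul, Matrix.star_eq_conjTranspose] at h1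
  have h4 : ((H.gram⁻¹ : GL ι E) : Matrix ι ι E) * δ.1ᴴ =
      δ.1 * ((H.gram⁻¹ : GL ι E) : Matrix ι ι E) := by
    conv_rhs => rw [← δ.2]
    simp [HermForm.adj, mul_assoc]
  unfold Intertwines
  simp only [Units.val_mul, Units.coe_star, Matrix.star_eq_conjTranspose]
  rw [mul_assoc, ← h3, mul_assoc, ← mul_assoc (gᴴ : Matrix ι ι E), ← h1, mul_assoc, ← mul_assoc,
    h4]
  simp only [mul_assoc]

/-- The cocycle `g⁻¹ σ(g)` attached to `g` with `δ' = Ad(g)(δ)`. -/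
def invCocycle {H H' : HermForm E ι} (δ : H.Herm) (δ' : H'.Herm) (g : GL ι E)
    (hg : Intertwines δ δ' g) : Cocycle δ :=
  ⟨g⁻¹ * gal H H' g, hg.inv.mul hg.gal, by
    have e := H.herm
    have e' := H'.herm
    simp only [gal, star_mul, star_inv, mul_inv_rev, inv_inv, star_star, e, e']
    group⟩

/-- The invariant `inv(δ, δ') = [σ ↦ g⁻¹ σ(g)] ∈ H¹(F, T_δ)`, for any `g` with
`δ' = Ad(g)(δ)`. -/
def inv {H H' : HermForm E ι} (δ : H.Herm) (δ' : H'.Herm) (h : IsTransfer δ δ') : H1 δ :=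
  Quot.mk _ (invCocycle δ δ' h.choose h.choose_spec)

open Classical in
/-- The quadratic character `ω_{E/F}` of local class field theory: it is `1` on the norms from
`Eˣ` and `-1` on the other elements of `Fˣ`. The element of `F` is viewed in `E`. -/
def omega (x : E) : ℂ := if ∃ z : E, z * star z = x then 1 else -1

open Classical in
/-- The endoscopic character `κ` on `H¹(F, T_δ)`, when `δ` has rank two with eigenvalues
`x_a ≠ x_b` in `F`. A cocycle `t` acts on the eigenlines of `δ` by scalars `t_a, t_b ∈ Fˣ`, and
`t ↦ (t_a, t_b)` identifies `H¹(F, T_δ)` with `(Fˣ / Nm Eˣ) × (Fˣ / Nm Eˣ)`. The character `κ` is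
trivial on the first factor and nontrivial on the second, so it is `ω_{E/F}(t_b)`. -/
def kappa {H : HermForm E ι} (δ : H.Herm) (xb : E) (c : H1 δ) : ℂ :=
  if ∃ t : Cocycle δ, Quot.mk _ t = c ∧ ∃ z : E, ∀ v : ι → E,
      δ.1 *ᵥ v = xb • v → (t.1 : Matrix ι ι E) *ᵥ v = (z * star z) • v
  then 1 else -1

/-- The `κ`-orbital integral: the sum over the rational classes `δ'` in the stable class of `δ` of
`κ(inv(δ, δ')) Orb(δ', f)`. -/
def OrbKappa {H : HermForm E ι} [TopologicalSpace H.U] [MeasurableSpace H.U] (ν : Measure H.U)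
    (xb : E) (δ : H.Herm) (f : H.Herm → ℂ) : ℂ :=
  ∑ᶠ (c : MulAction.orbitRel.Quotient H.U H.Herm) (h : IsTransfer δ (Quotient.out c)),
    kappa δ xb (inv δ (Quotient.out c) h) * Orb ν (Quotient.out c) f

/-- The stable orbital integral of `f` on `Herm(V_a) ⊕ Herm(V_b)` under `U(V_a) × U(V_b)`. -/
def SO {Ha Hb : HermForm E ι} [TopologicalSpace Ha.U] [MeasurableSpace Ha.U]
    [TopologicalSpace Hb.U] [MeasurableSpace Hb.U] (ν : Measure (Ha.U × Hb.U))
    (p : Ha.Herm × Hb.Herm) (f : Ha.Herm × Hb.Herm → ℂ) : ℂ :=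
  ∑ᶠ (c : MulAction.orbitRel.Quotient (Ha.U × Hb.U) (Ha.Herm × Hb.Herm))
    (_ : IsTransfer p.1 (Quotient.out c).1 ∧ IsTransfer p.2 (Quotient.out c).2),
    Orb ν (Quotient.out c) f

open Classical in
/-- The pushforward `r_! f` along the contraction map `r(X) = X X*` from the non-singular locus of
`End(V)`, which is a `U(V)`-torsor over its image:
`r_! f (X X*) = ∫_{U(V)} f(X h) dh`, and `r_! f` vanishes outside the image of `r`. -/
def pushforward {H : HermForm E ι} [TopologicalSpace H.U] [MeasurableSpace H.U] (ν : Measure H.U)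
    (f : Matrix ι ι E → ℂ) (δ : H.Herm) : ℂ :=
  if h : ∃ X : GL ι E, (X : Matrix ι ι E) * H.adj X = δ.1 then
    ∫ g : H.U, f ((h.choose : Matrix ι ι E) * ((g : GL ι E) : Matrix ι ι E)) ∂ν
  else 0

open Classical in
/-- The pushforward along the contraction map of a product `End(V_a) ⊕ End(V_b)`. -/
def pushforwardProd {Ha Hb : HermForm E ι} [TopologicalSpace Ha.U] [MeasurableSpace Ha.U]
    [TopologicalSpace Hb.U] [MeasurableSpace Hb.U] (ν : Measure (Ha.U × Hb.U))
    (f : Matrix ι ι E × Matrix ι ι E → ℂ) (p : Ha.Herm × Hb.Herm) : ℂ :=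
  if h : ∃ X : GL ι E × GL ι E, (X.1 : Matrix ι ι E) * Ha.adj X.1 = p.1.1 ∧
      (X.2 : Matrix ι ι E) * Hb.adj X.2 = p.2.1 then
    ∫ g : Ha.U × Hb.U, f ((h.choose.1 : Matrix ι ι E) * ((g.1 : GL ι E) : Matrix ι ι E),
      (h.choose.2 : Matrix ι ι E) * ((g.2 : GL ι E) : Matrix ι ι E)) ∂ν
  else 0

/-! ### The spaces `V₁`, `V₁ ⊕ V₁` and `V₂` -/

/-- The Hermitian form with Gram matrix `1`. -/
def unitForm (E : Type*) [Field E] [StarRing E] (ι : Type*) [Fintype ι] [DecidableEq ι] :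
    HermForm E ι := ⟨1, star_one _⟩

/-- The split line `V₁ = E v` with `⟨v, v⟩ = 1`. -/
abbrev V1 (E : Type*) [Field E] [StarRing E] : HermForm E (Fin 1) := unitForm E (Fin 1)

/-- The orthogonal sum `V₁ ⊕ V₁`. -/
abbrev V11 (E : Type*) [Field E] [StarRing E] : HermForm E (Fin 2) := unitForm E (Fin 2)

/-- The matrix `J = (0, ζ; -ζ, 0)`. -/
def gramJ (ζ : Eˣ) : GL (Fin 2) E where
  val := !![0, (ζ : E); -(ζ : E), 0]
  inv := !![0, -((ζ⁻¹ : Eˣ) : E); ((ζ⁻¹ : Eˣ) : E), 0]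
  val_inv := by ext i j; fin_cases i <;> fin_cases j <;> simp
  inv_val := by ext i j; fin_cases i <;> fin_cases j <;> simp

/-- The split Hermitian plane `V₂ = E²` with form `J`. -/
def V2 (ζ : Eˣ) (hζ : star (ζ : E) = -(ζ : E)) : HermForm E (Fin 2) where
  gram := gramJ ζ
  herm := by
    apply Units.ext
    ext i j
    fin_cases i <;> fin_cases j <;> simp [gramJ, hζ]

/-- The element of `Herm(V₁) ≅ F` given by a scalar of `E` fixed by the involution. -/
def herm1 (x : E) (hx : star x = x) : (V1 E).Herm :=
  ⟨!![x], by ext i j; fin_cases i; fin_cases j; simp [HermForm.adj, unitForm, hx]⟩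

/-- The embedding `Herm(V₁) ⊕ Herm(V₁) → Herm(V₁ ⊕ V₁)`. -/
def directSum (p : (V1 E).Herm × (V1 E).Herm) : (V11 E).Herm :=
  ⟨Matrix.diagonal ![p.1.1 0 0, p.2.1 0 0], by
    have h1 := congrFun (congrFun p.1.2 0) 0
    have h2 := congrFun (congrFun p.2.2 0) 0
    simp only [HermForm.adj, unitForm, inv_one, Units.val_one, one_mul, mul_one,
      Matrix.conjTranspose_apply] at h1 h2
    ext i j
    fin_cases i <;> fin_cases j <;> simp [HermForm.adj, unitForm, h1, h2]⟩

/-- The element `(a, lam ζ; mu ζ, a)` of `Herm(V₂)`. -/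
def hermMat (ζ : Eˣ) (hζ : star (ζ : E) = -(ζ : E)) (a lam mu : E) (ha : star a = a)
    (hl : star lam = lam) (hm : star mu = mu) : (V2 ζ hζ).Herm :=
  ⟨!![a, lam * ζ; mu * ζ, a], by
    have e : (!![a, lam * (ζ : E); mu * (ζ : E), a])ᴴ =
        !![a, -(mu * (ζ : E)); -(lam * (ζ : E)), a] := by
      ext i j
      fin_cases i <;> fin_cases j <;> simp [ha, hl, hm, hζ]
    have e1 : (((V2 ζ hζ).gram⁻¹ : GL (Fin 2) E) : Matrix (Fin 2) (Fin 2) E) =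
        !![0, -(ζ : E)⁻¹; (ζ : E)⁻¹, 0] := by
      rw [← Units.val_inv_eq_inv_val]; rfl
    have e2 : ((V2 ζ hζ).gram : Matrix (Fin 2) (Fin 2) E) = !![0, (ζ : E); -(ζ : E), 0] := rfl
    have h0 : (ζ : E) ≠ 0 := ζ.ne_zero
    rw [HermForm.adj, e, e1, e2]
    ext i j
    fin_cases i <;> fin_cases j <;> simp <;> field_simp⟩

/-- `δ` and `p = (δ_a, δ_b)` are a nice matching pair: an isometry `V₂ ≅ V₁ ⊕ V₁` carries `δ` to
`δ_a ⊕ δ_b`. -/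
def IsNiceMatch {H : HermForm E (Fin 2)} (p : (V1 E).Herm × (V1 E).Herm) (δ : H.Herm) : Prop :=
  ∃ g : GL (Fin 2) E, star g * (V11 E).gram * g = H.gram ∧ Intertwines δ (directSum p) g

end Hermitian

/-! ### Local fields -/

section Local

variable {F E : Type*} [NontriviallyNormedField F] [IsUltrametricDist F]
  [NormedField E] [NormedAlgebra F E]

/-- `ϖ` is a uniformizer of `F`. -/
def IsUniformizer (ϖ : F) : Prop :=
  ϖ ≠ 0 ∧ ‖ϖ‖ < 1 ∧ ∀ x : F, ‖x‖ < 1 → ‖x‖ ≤ ‖ϖ‖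

variable (F) in
/-- The cardinality of the residue field of `F`. -/
def resCard : ℕ :=
  Nat.card (IsLocalRing.ResidueField (NormedField.valuation (K := F)).valuationSubring)

/-- The valuation of a nonzero element `x` of `E`, normalized by `val ϖ = 1`: the integer `n` with
`‖x‖ = ‖ϖ‖ ^ n`. For `E/F` unramified the logarithm below is an integer. -/
def val (ϖ : F) (x : E) : ℤ := ⌊Real.logb ‖ϖ‖ ‖x‖⌋

/-- The normalized absolute value `|x|_F = q ^ (-val x)` of a nonzero element `x` of `F`, which is
viewed in `E`. -/
def absF (ϖ : F) (x : E) : ℂ := (resCard F : ℂ) ^ (-val ϖ x)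

/-- The matrix has entries in the ring of integers of `E`. -/
def IsIntegral {ι : Type*} (X : Matrix ι ι E) : Prop := ∀ i j, ‖X i j‖ ≤ 1

open Classical in
/-- The indicator function of `End(Λ)`, where `Λ` is the standard lattice. -/
def charEnd {ι : Type*} (X : Matrix ι ι E) : ℂ := if IsIntegral X then 1 else 0

variable [StarRing E] {ι : Type*} [Fintype ι] [DecidableEq ι]

/-- The unitary group carries its Borel sigma-algebra. -/
instance instMeasurableSpaceU (H : HermForm E ι) : MeasurableSpace H.U := borel _

instance instBorelSpaceU (H : HermForm E ι) : BorelSpace H.U := ⟨rfl⟩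

/-- The stabilizer `U(Λ)` in `U(W)` of the standard lattice. -/
def ULattice (H : HermForm E ι) : Set H.U :=
  {g | IsIntegral ((g : GL ι E) : Matrix ι ι E) ∧
    IsIntegral (((g : GL ι E)⁻¹ : GL ι E) : Matrix ι ι E)}

open Classical in
/-- The transfer factor `Δ((δ_a, δ_b), δ)`. It is zero if `δ` does not match `(δ_a, δ_b)`, and
otherwise `κ(inv(δ, δ')) ω_{E/F}(D(δ)) |D(δ)|_F` with `δ' = δ_a ⊕ δ_b ∈ Herm(V₁ ⊕ V₁)` and
`D(δ) = x_a - x_b`, where `x_a`, `x_b` are the eigenvalues of `δ_a`, `δ_b`. -/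
def transferFactor (ϖ : F) {H : HermForm E (Fin 2)} (p : (V1 E).Herm × (V1 E).Herm)
    (δ : H.Herm) : ℂ :=
  if h : IsTransfer δ (directSum p) then
    kappa δ (p.2.1 0 0) (inv δ (directSum p) h) * omega (p.1.1 0 0 - p.2.1 0 0) *
      absF ϖ (p.1.1 0 0 - p.2.1 0 0)
  else 0

/-- The function `Φ = r_! 1_{End(Λ)}` on `Herm(V₂)`. -/
def Phi {H : HermForm E ι} (ν : Measure H.U) : H.Herm → ℂ := pushforward ν charEnd

/-- The basic function `1_{End(Λ₁)} ⊗ 1_{End(Λ₁)}` of the endoscopic space. -/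
def basicFun (X : Matrix (Fin 1) (Fin 1) E × Matrix (Fin 1) (Fin 1) E) : ℂ :=
  charEnd X.1 * charEnd X.2

open Classical in
/-- The function `Φ^κ` on `Herm(V₁) × Herm(V₁)`. -/
def PhiKappa (ϖ : F) (p : (V1 E).Herm × (V1 E).Herm) : ℂ :=
  if (0 ≤ val ϖ (p.1.1 0 0) ∧ Even (val ϖ (p.1.1 0 0))) ∧
      (0 ≤ val ϖ (p.2.1 0 0) ∧ Even (val ϖ (p.2.1 0 0)))
  then 1 else 0

end Local

end RelEndo

end

set_option linter.unusedSectionVars false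

namespace RelEndo

/-! ### Unramified quadratic extensions -/

/-! Write K = U(Λ), e = val μ (even, because ω(μ) = 1), B = val b, u = val(a + b), v = val(a − b).

Endoscopic side. U(V₁) is compact and acts trivially on Herm(V₁), so the stable orbital integral is
the single value Φ^κ(a+b, a−b) (`SO_eq`). The work lies in Orb^κ, which is computed by counting
cosets of K.

Value of Φ. For δ nonscalar of nonzero determinant, Φ(δ) is the sum of q^k over the k ≥ 0 with ϖ^k
dividing δ if det δ is a norm, and zero otherwise (`Phi_herm`). Conjugation by K kills the
trace-free diagonal part and makes the lower left entry dominate the upper right one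
(`exists_smul_eq_herm`). There an explicit X with XX* = δ exists (`mul_adj_herm`), and the volume of
{g : Xg integral} follows from the Iwasawa decomposition (`measure_eq_sum`).

Orbital integrals. The stabilizer is compact, so Orb is an integral over all of U(V₂)
(`Orb_eq_integral`), and it is the sum over k of q^k vol{g : ϖ^k divides g⁻¹δg}. If k ≤ val a, this
volume is a geometric sum 1 + q + ... with B−k+1 terms when e and k have equal parity and B−k terms
otherwise (`measure_divisibleSet`); if k > val a it is 0.

Cancellation. The stable class of δ₊ consists of two rational classes, told apart by the parity of
the valuation of the lower left entry; the second is represented by (λ/ϖ, μϖ), and κ is 1 and −1 on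
them (`OrbKappa_eq`). In the difference only the top term q^(B−k) survives, with sign (−1)^k, and
the weight q^k turns it into (−1)^k q^B. Here k runs from 0 to min(val a, B) = min(u, v), so the
alternating sum is 1 if min(u, v) is even and non-negative, and 0 otherwise. The norm condition on
det δ makes u + v even. Hence Orb^κ = q^B Φ^κ(a+b, a−b) (`Orb_Phi_sub_Orb_Phi`).

Transfer factor. The eigenvector for a−b has length 2bμ up to a norm, so κ(inv) = ω(2bμ) = ω(2b).
The two signs in Δ cancel and Δ = q^(−B) (`transferFactor_eq`). The same lengths show that the
matching is nice exactly when B is even (`isNiceMatch_iff`). -/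

/-- An unramified quadratic extension with its involution, a uniformizer `ϖ` of `F`, and a unit `ζ`
of `E` with `star ζ = -ζ`. -/
structure UnramifiedPair {F E : Type*} [NontriviallyNormedField F] [IsUltrametricDist F]
    [NormedField E] [NormedAlgebra F E] [StarRing E] (ϖ : F) (ζ : Eˣ) : Prop where
  finite : FiniteDimensional F E
  star_eq_iff : ∀ x : E, star x = x ↔ x ∈ Set.range (algebraMap F E)
  norm_two : ‖(2 : F)‖ = 1
  unif : IsUniformizer ϖ
  star_zeta : star (ζ : E) = -(ζ : E)
  norm_zeta : ‖(ζ : E)‖ = 1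

namespace UnramifiedPair

variable {F E : Type*} [NontriviallyNormedField F] [IsUltrametricDist F] [LocallyCompactSpace F]
    [NormedField E] [NormedAlgebra F E] [StarRing E] {ϖ : F} {ζ : Eˣ}

section
variable (S : UnramifiedPair (E := E) ϖ ζ)
include S

lemma unif_pos : 0 < ‖ϖ‖ := norm_pos_iff.2 S.unif.1

lemma unif_lt : ‖ϖ‖ < 1 := S.unif.2.1

lemma star_coe (x : F) : star (algebraMap F E x) = algebraMap F E x :=
  (S.star_eq_iff _).2 ⟨x, rfl⟩

/-- An F-linear map of a finite-dimensional space is bounded by some constant C. Applied to the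
powers of y, the bound forces (‖star y‖ / ‖y‖)^n ≤ C for all n, so the ratio is at most 1. Equality
follows because the map is an involution. -/
lemma norm_star (x : E) : ‖star x‖ = ‖x‖ := by
  have := S.finite
  have : ProperSpace F := .of_locallyCompactSpace F
  let f : E →ₗ[F] E :=
    { toFun := star
      map_add' := star_add
      map_smul' := fun c y => by
        simp only [Algebra.smul_def, star_mul', S.star_coe, RingHom.id_apply] }
  obtain ⟨C, hC⟩ : ∃ C : ℝ, ∀ y : E, ‖star y‖ ≤ C * ‖y‖ :=
    ⟨_, fun y => (LinearMap.toContinuousLinearMap f).le_opNorm y⟩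
  have key : ∀ y : E, ‖star y‖ ≤ ‖y‖ := by
    intro y
    by_contra! h
    have hy : 0 < ‖y‖ := by
      rw [norm_pos_iff]
      rintro rfl
      simp at h
    have h1 : 1 < ‖star y‖ / ‖y‖ := (one_lt_div hy).2 h
    obtain ⟨n, hn⟩ := pow_unbounded_of_one_lt C h1
    have h2 := hC (y ^ n)
    rw [star_pow, norm_pow, norm_pow, ← div_le_iff₀ (pow_pos hy n), ← div_pow] at h2
    linarith
  refine le_antisymm (key x) ?_
  simpa using key (star x)

lemma isUltrametricDist : IsUltrametricDist E := by
  refine IsUltrametricDist.isUltrametricDist_of_forall_norm_natCast_le_one fun n => ?_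
  rw [← map_natCast (algebraMap F E) n, norm_algebraMap']
  exact IsUltrametricDist.norm_natCast_le_one F n

lemma two_ne_zero : (2 : F) ≠ 0 := by
  intro h
  have := S.norm_two
  simp [h] at this

lemma two_ne_zero' : (2 : E) ≠ 0 := by
  have := S.two_ne_zero
  rw [← map_ofNat (algebraMap F E) 2]
  simpa using this

lemma norm_two' : ‖(2 : E)‖ = 1 := by
  rw [← map_ofNat (algebraMap F E) 2, norm_algebraMap', S.norm_two]

lemma exists_eq_add (x : E) : ∃ u v : F, x = algebraMap F E u + ζ * algebraMap F E v := by
  have h2 := S.two_ne_zero'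
  have hz : (ζ : E) ≠ 0 := ζ.ne_zero
  have hs2 : star (2 : E) = 2 := by simp
  obtain ⟨u, hu⟩ := (S.star_eq_iff ((x + star x) / 2)).1 (by
    rw [star_div₀, star_add, star_star, hs2, add_comm])
  obtain ⟨v, hv⟩ := (S.star_eq_iff ((x - star x) / (2 * ζ))).1 (by
    rw [star_div₀, star_sub, star_star, star_mul', hs2, S.star_zeta]
    field_simp
    ring)
  refine ⟨u, v, ?_⟩
  rw [hu, hv]
  field_simp
  ring

lemma star_add_zeta (u v : F) : star (algebraMap F E u + ζ * algebraMap F E v) =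
    algebraMap F E u - ζ * algebraMap F E v := by
  rw [star_add, star_mul', S.star_coe, S.star_coe, S.star_zeta]
  ring

/-- The basis 1, ζ is orthonormal: x + star x and x − star x recover u and v up to the units 2 and
ζ. It follows that E has the same value group as F, and that b + ζy with b ≠ 0 never vanishes. -/
lemma norm_add_zeta (u v : F) :
    ‖algebraMap F E u + ζ * algebraMap F E v‖ = max ‖u‖ ‖v‖ := by
  have := S.isUltrametricDist
  set x := algebraMap F E u + ζ * algebraMap F E v with hx
  have hs := S.star_add_zeta u v
  rw [← hx] at hs
  have hu : ‖u‖ ≤ ‖x‖ := by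
    have h : 2 * algebraMap F E u = x + star x := by rw [hs, hx]; ring
    have h1 : ‖2 * algebraMap F E u‖ ≤ max ‖x‖ ‖star x‖ := by
      rw [h]; exact IsUltrametricDist.norm_add_le_max _ _
    rwa [norm_mul, S.norm_two', one_mul, S.norm_star, max_self, norm_algebraMap'] at h1
  have hv : ‖v‖ ≤ ‖x‖ := by
    have h : 2 * (ζ * algebraMap F E v) = x - star x := by rw [hs, hx]; ring
    have h1 : ‖2 * (ζ * algebraMap F E v)‖ ≤ max ‖x‖ ‖star x‖ := by
      rw [h, sub_eq_add_neg, ← norm_neg (star x)]; exact IsUltrametricDist.norm_add_le_max _ _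
    rwa [norm_mul, norm_mul, S.norm_two', S.norm_zeta, one_mul, one_mul, S.norm_star, max_self,
      norm_algebraMap'] at h1
  refine le_antisymm ?_ (max_le hu hv)
  refine (IsUltrametricDist.norm_add_le_max _ _).trans_eq ?_
  rw [norm_mul, S.norm_zeta, one_mul, norm_algebraMap', norm_algebraMap']

/-- Trap ‖x‖ between consecutive powers of ‖ϖ‖. If it missed the upper one, a power of ϖ would scale
x to an element of norm strictly between ‖ϖ‖ and 1, against the choice of ϖ. -/
lemma exists_zpow {x : F} (hx : x ≠ 0) : ∃ n : ℤ, ‖x‖ = ‖ϖ‖ ^ n := by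
  obtain ⟨n, h1, h2⟩ := exists_mem_Ioc_zpow (norm_pos_iff.2 hx)
    ((one_lt_inv₀ S.unif_pos).2 S.unif_lt)
  have hp := S.unif_pos
  simp only [inv_zpow'] at h1 h2
  refine ⟨-(n + 1), le_antisymm h2 ?_⟩
  by_contra! h3
  have h4 := S.unif.2.2 (x * ϖ ^ (n + 1)) (by
    rw [norm_mul, norm_zpow]
    calc ‖x‖ * ‖ϖ‖ ^ (n + 1) < ‖ϖ‖ ^ (-(n + 1)) * ‖ϖ‖ ^ (n + 1) := by gcongr
      _ = 1 := by rw [← zpow_add₀ hp.ne']; simp)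
  rw [norm_mul, norm_zpow] at h4
  have h5 : ‖ϖ‖ < ‖x‖ * ‖ϖ‖ ^ (n + 1) := by
    calc ‖ϖ‖ = ‖ϖ‖ ^ (-n) * ‖ϖ‖ ^ (n + 1) := by rw [← zpow_add₀ hp.ne']; simp
      _ < _ := by gcongr
  linarith

lemma exists_zpow' {x : E} (hx : x ≠ 0) : ∃ n : ℤ, ‖x‖ = ‖ϖ‖ ^ n := by
  obtain ⟨u, v, rfl⟩ := S.exists_eq_add x
  rw [S.norm_add_zeta]
  rcases le_total ‖u‖ ‖v‖ with h | h
  · rw [max_eq_right h]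
    refine S.exists_zpow fun hv => hx ?_
    simp [hv] at h
    simp [h, hv]
  · rw [max_eq_left h]
    refine S.exists_zpow fun hv => hx ?_
    simp [hv] at h
    simp [h, hv]

lemma zpow_le_zpow {m n : ℤ} : ‖ϖ‖ ^ m ≤ ‖ϖ‖ ^ n ↔ n ≤ m :=
  zpow_le_zpow_iff_right_of_lt_one₀ S.unif_pos S.unif_lt

lemma zpow_inj {m n : ℤ} : ‖ϖ‖ ^ m = ‖ϖ‖ ^ n ↔ m = n :=
  ⟨fun h => le_antisymm (S.zpow_le_zpow.1 h.ge) (S.zpow_le_zpow.1 h.le), fun h => by rw [h]⟩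

lemma val_eq {x : E} {n : ℤ} (hx : ‖x‖ = ‖ϖ‖ ^ n) : val ϖ x = n := by
  rw [val, hx, Real.logb, Real.log_zpow, mul_div_assoc, div_self, mul_one, Int.floor_intCast]
  exact (Real.log_neg S.unif_pos S.unif_lt).ne

lemma norm_eq_val {x : E} (hx : x ≠ 0) : ‖x‖ = ‖ϖ‖ ^ (val ϖ x) := by
  obtain ⟨n, hn⟩ := S.exists_zpow' hx
  rw [hn, S.val_eq hn]

/-- Hensel's lemma by compactness: minimize ‖s² − t‖ over the ball of radius ‖ϖ‖ about 1. A Newton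
step stays in the ball and squares the error, so the minimum is 0. -/
lemma exists_sq {t : F} (ht : ‖t - 1‖ < 1) : ∃ s : F, s ^ 2 = t ∧ ‖s - 1‖ < 1 := by
  have : ProperSpace F := .of_locallyCompactSpace F
  have hcl : IsCompact {s : F | ‖s - 1‖ ≤ ‖ϖ‖} := by
    have : {s : F | ‖s - 1‖ ≤ ‖ϖ‖} = Metric.closedBall 1 ‖ϖ‖ := by
      ext s; simp [dist_eq_norm]
    rw [this]
    exact isCompact_closedBall _ _
  obtain ⟨s, hs, hmin⟩ := hcl.exists_isMinOn ⟨1, by simp⟩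
    (f := fun s : F => ‖s ^ 2 - t‖) (by fun_prop)
  have hs1 : ‖s - 1‖ ≤ ‖ϖ‖ := hs
  refine ⟨s, ?_, hs1.trans_lt S.unif_lt⟩
  have hu := S.unif_lt
  have hsn : ‖s‖ = 1 := by
    have : ‖(s - 1) + 1‖ = max ‖s - 1‖ ‖(1 : F)‖ := by
      refine IsUltrametricDist.norm_add_eq_max_of_norm_ne_norm ?_
      rw [norm_one]
      exact (hs1.trans_lt hu).ne
    rw [sub_add_cancel, norm_one, max_eq_right (hs1.trans hu.le)] at this
    exact this
  have hr : ‖s ^ 2 - t‖ ≤ ‖ϖ‖ := by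
    have e : s ^ 2 - t = (s - 1) * (s + 1) + -(t - 1) := by ring
    rw [e]
    refine (IsUltrametricDist.norm_add_le_max _ _).trans (max_le ?_ ?_)
    · rw [norm_mul]
      have : ‖s + 1‖ ≤ 1 := (IsUltrametricDist.norm_add_le_max _ _).trans (by simp [hsn])
      calc ‖s - 1‖ * ‖s + 1‖ ≤ ‖ϖ‖ * 1 := by gcongr
        _ = _ := mul_one _
    · rw [norm_neg]
      exact S.unif.2.2 _ ht
  have hs0 : s ≠ 0 := norm_ne_zero_iff.1 (by rw [hsn]; norm_num)
  have h2 := S.two_ne_zero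
  set r := s ^ 2 - t with hrdef
  have hdn : ‖r / (2 * s)‖ = ‖r‖ := by rw [norm_div, norm_mul, S.norm_two, hsn]; simp
  have hmem : ‖(s - r / (2 * s)) - 1‖ ≤ ‖ϖ‖ := by
    have e : (s - r / (2 * s)) - 1 = (s - 1) + -(r / (2 * s)) := by ring
    rw [e]
    refine (IsUltrametricDist.norm_add_le_max _ _).trans (max_le hs1 ?_)
    rw [norm_neg, hdn]
    exact hr
  have h3 : ‖r‖ ≤ ‖(s - r / (2 * s)) ^ 2 - t‖ := hmin hmem
  have e : (s - r / (2 * s)) ^ 2 - t = (r / (2 * s)) ^ 2 := by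
    have : t = s ^ 2 - r := by rw [hrdef]; ring
    rw [this]
    field_simp
    ring
  rw [e, norm_pow, hdn] at h3
  have h4 : ‖r‖ = 0 := by
    have := norm_nonneg r
    nlinarith
  exact sub_eq_zero.1 (norm_eq_zero.1 h4)

end

end UnramifiedPair

end RelEndo

/-! ### Residue field, powers of the maximal ideal, and norms from E -/

namespace RelEndo

/-- The additive subgroup `ϖ ^ n 𝒪` of `F`. -/
def fracBall {F : Type*} [NontriviallyNormedField F] [IsUltrametricDist F] (ϖ : F) (n : ℤ) :
    AddSubgroup F where
  carrier := {x | ‖x‖ ≤ ‖ϖ‖ ^ n}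
  zero_mem' := by simp only [Set.mem_ofPred_eq, norm_zero]; positivity
  add_mem' := fun {x y} hx hy => (IsUltrametricDist.norm_add_le_max x y).trans (max_le hx hy)
  neg_mem' := fun {x} hx => by simpa using hx

namespace UnramifiedPair

variable {F E : Type*} [NontriviallyNormedField F] [IsUltrametricDist F] [LocallyCompactSpace F]
    [NormedField E] [NormedAlgebra F E] [StarRing E] {ϖ : F} {ζ : Eˣ}

section
variable (S : UnramifiedPair (E := E) ϖ ζ)
include S

lemma mem_fracBall {n : ℤ} {x : F} : x ∈ fracBall ϖ n ↔ ‖x‖ ≤ ‖ϖ‖ ^ n := Iff.rfl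

lemma fracBall_anti {m n : ℤ} (h : m ≤ n) : fracBall ϖ n ≤ fracBall ϖ m :=
  fun _ hx => le_trans hx (S.zpow_le_zpow.2 h)

lemma finite_residueField :
    Finite (IsLocalRing.ResidueField (NormedField.valuation (K := F)).valuationSubring) := by
  have : ProperSpace F := .of_locallyCompactSpace F
  have hc : CompactSpace (NormedField.valuation (K := F)).valuationSubring := by
    rw [← isCompact_univ_iff, Subtype.isCompact_iff]
    convert isCompact_closedBall (0 : F) 1
    ext x
    simp [Valuation.mem_valuationSubring_iff, NormedField.valuation_apply, ← NNReal.coe_le_coe]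
  refine AddSubgroup.quotient_finite_of_isOpen
    (IsLocalRing.maximalIdeal (NormedField.valuation (K := F)).valuationSubring).toAddSubgroup ?_
  have : ((IsLocalRing.maximalIdeal
      (NormedField.valuation (K := F)).valuationSubring).toAddSubgroup : Set _) =
      (fun x : (NormedField.valuation (K := F)).valuationSubring => ‖(x : F)‖) ⁻¹' Set.Iio 1 := by
    ext x
    exact Valuation.mem_maximalIdeal_iff F _
  rw [this]
  exact isOpen_Iio.preimage (by fun_prop)

lemma resCard_pos : 0 < resCard F := by
  have := S.finite_residueField
  exact Nat.card_pos

lemma relIndex_fracBall_zero : (fracBall ϖ 1).relIndex (fracBall ϖ 0) = resCard F := by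
  set O := (NormedField.valuation (K := F)).valuationSubring with hO
  set f : O →+ F := O.subtype.toAddMonoidHom with hf
  have hfx : ∀ x : O, f x = (x : F) := fun _ => rfl
  have h0 : fracBall ϖ 0 = AddSubgroup.map f ⊤ := by
    ext x
    simp only [AddSubgroup.mem_map, S.mem_fracBall, zpow_zero, AddSubgroup.mem_top, true_and, hfx]
    constructor
    · intro h
      exact ⟨⟨x, h⟩, rfl⟩
    · rintro ⟨⟨y, hy⟩, rfl⟩
      exact hy
  have h1 : fracBall ϖ 1 = AddSubgroup.map f (IsLocalRing.maximalIdeal O).toAddSubgroup := by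
    ext x
    simp only [AddSubgroup.mem_map, S.mem_fracBall, zpow_one, hfx]
    constructor
    · intro h
      have hx : ‖x‖ < 1 := h.trans_lt S.unif_lt
      refine ⟨⟨x, hx.le⟩, ?_, rfl⟩
      rw [Submodule.mem_toAddSubgroup, Valuation.mem_maximalIdeal_iff]
      exact hx
    · rintro ⟨y, hy, rfl⟩
      rw [Submodule.mem_toAddSubgroup, Valuation.mem_maximalIdeal_iff] at hy
      exact S.unif.2.2 _ hy
  rw [h0, h1, AddSubgroup.relIndex_map_map_of_injective _ _ Subtype.val_injective,
    AddSubgroup.relIndex_top_right]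
  rfl

lemma relIndex_fracBall_succ (n : ℤ) :
    (fracBall ϖ (n + 1)).relIndex (fracBall ϖ n) = resCard F := by
  rw [← S.relIndex_fracBall_zero]
  have hp := S.unif_pos
  have key : ∀ k : ℤ, fracBall ϖ (n + k) =
      AddSubgroup.map (AddMonoidHom.mulLeft (ϖ ^ n)) (fracBall ϖ k) := by
    intro k
    ext x
    simp only [AddSubgroup.mem_map, S.mem_fracBall, AddMonoidHom.coe_mulLeft]
    have hn : (ϖ ^ n) ≠ 0 := zpow_ne_zero _ S.unif.1
    constructor
    · intro h
      refine ⟨(ϖ ^ n)⁻¹ * x, ?_, by field_simp⟩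
      rw [norm_mul, norm_inv, norm_zpow, inv_mul_le_iff₀ (by positivity), ← zpow_add₀ hp.ne']
      exact h
    · rintro ⟨y, hy, rfl⟩
      rw [norm_mul, norm_zpow, zpow_add₀ hp.ne']
      gcongr
  conv_lhs => rw [key 1, ← add_zero n, key 0]
  simp only [add_zero]
  exact AddSubgroup.relIndex_map_map_of_injective _ _
    (mul_right_injective₀ (zpow_ne_zero _ S.unif.1))

lemma relIndex_fracBall (r : ℤ) (n : ℕ) :
    (fracBall ϖ (r + n)).relIndex (fracBall ϖ r) = resCard F ^ n := by
  induction n with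
  | zero => simp [AddSubgroup.relIndex_self]
  | succ n ih =>
    rw [← AddSubgroup.relIndex_mul_relIndex _ (fracBall ϖ (r + n)) _
      (S.fracBall_anti (by push_cast; lia)) (S.fracBall_anti (by lia)), ih]
    have := S.relIndex_fracBall_succ (r + n)
    rw [add_assoc] at this
    push_cast
    rw [this, pow_succ']

/-- Representatives of `ϖ ^ r 𝒪 / ϖ ^ (r + n) 𝒪`. -/
lemma exists_representatives (r : ℤ) (n : ℕ) : ∃ R : Finset F, R.card = resCard F ^ n ∧
    (∀ x ∈ R, ‖x‖ ≤ ‖ϖ‖ ^ r) ∧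
    (∀ y : F, ‖y‖ ≤ ‖ϖ‖ ^ r → ∃ x ∈ R, ‖x - y‖ ≤ ‖ϖ‖ ^ (r + n)) ∧
    ∀ x ∈ R, ∀ y ∈ R, ‖x - y‖ ≤ ‖ϖ‖ ^ (r + n) → x = y := by
  classical
  set A := (fracBall ϖ (r + n)).addSubgroupOf (fracBall ϖ r) with hA
  have hcard : Nat.card (fracBall ϖ r ⧸ A) = resCard F ^ n := S.relIndex_fracBall r n
  have : Finite (fracBall ϖ r ⧸ A) := Nat.finite_of_card_ne_zero (by
    rw [hcard]; exact (pow_pos S.resCard_pos n).ne')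
  have := Fintype.ofFinite (fracBall ϖ r ⧸ A)
  have hmk : ∀ x y : fracBall ϖ r, (x : fracBall ϖ r ⧸ A) = y ↔
      ‖(x : F) - y‖ ≤ ‖ϖ‖ ^ (r + n) := by
    intro x y
    rw [eq_comm, QuotientAddGroup.eq, hA, AddSubgroup.mem_addSubgroupOf, S.mem_fracBall]
    simp [neg_add_eq_sub]
  refine ⟨Finset.univ.image (fun c : fracBall ϖ r ⧸ A => ((c.out : fracBall ϖ r) : F)),
    ?_, ?_, ?_, ?_⟩
  · rw [Finset.card_image_of_injective, Finset.card_univ, ← Nat.card_eq_fintype_card, hcard]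
    intro c d h
    rw [← c.out_eq', ← d.out_eq', Subtype.ext h]
  · intro x hx
    obtain ⟨c, -, rfl⟩ := Finset.mem_image.1 hx
    exact c.out.2
  · intro y hy
    refine ⟨_, Finset.mem_image_of_mem _ (Finset.mem_univ
      ((⟨y, hy⟩ : fracBall ϖ r) : fracBall ϖ r ⧸ A)), ?_⟩
    exact (hmk _ ⟨y, hy⟩).1 (Quotient.out_eq' _)
  · intro x hx y hy h
    obtain ⟨c, -, rfl⟩ := Finset.mem_image.1 hx
    obtain ⟨d, -, rfl⟩ := Finset.mem_image.1 hy
    have := (hmk c.out d.out).2 h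
    rw [QuotientAddGroup.out_eq', QuotientAddGroup.out_eq'] at this
    rw [this]

lemma exists_zeta_sq : ∃ d : F, algebraMap F E d = (ζ : E) ^ 2 :=
  (S.star_eq_iff _).1 (by rw [star_pow, S.star_zeta]; ring)

/-- Over the finite residue field of odd order, x² − d y² with d = ζ² represents every element.
Lifting x, y gives a norm N congruent to u; then u/N is congruent to 1, hence a square s² in F, and
s² is the norm of s. -/
lemma exists_norm_eq_of_norm_eq_one {u : F} (hu : ‖u‖ = 1) :
    ∃ z : E, z * star z = algebraMap F E u := by
  have hfin := S.finite_residueField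
  set O := (NormedField.valuation (K := F)).valuationSubring with hO
  have := Fintype.ofFinite (IsLocalRing.ResidueField O)
  obtain ⟨d, hd⟩ := S.exists_zeta_sq
  have hdn : ‖d‖ = 1 := by
    rw [← norm_algebraMap' E d, hd, norm_pow, S.norm_zeta, one_pow]
  have hres : ∀ x : O, IsLocalRing.residue O x = 0 ↔ ‖(x : F)‖ < 1 := by
    intro x
    rw [IsLocalRing.residue_eq_zero_iff, Valuation.mem_maximalIdeal_iff]
    exact Iff.rfl
  let d' : O := ⟨d, hdn.le⟩
  let u' : O := ⟨u, hu.le⟩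
  have hd0 : IsLocalRing.residue O d' ≠ 0 := by
    rw [Ne, hres]
    exact fun h => h.ne hdn
  have hodd : Fintype.card (IsLocalRing.ResidueField O) % 2 = 1 := by
    refine FiniteField.odd_card_of_char_ne_two fun h => ?_
    have h2 : ((2 : ℕ) : IsLocalRing.ResidueField O) = 0 := by
      rw [← h]; exact ringChar.Nat.cast_ringChar
    have h3 : IsLocalRing.residue O 2 = 0 := by rw [map_ofNat]; exact_mod_cast h2
    rw [hres] at h3
    exact h3.ne S.norm_two
  obtain ⟨x, y, hxy⟩ := FiniteField.exists_root_sum_quadratic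
    (f := (Polynomial.X ^ 2 : Polynomial (IsLocalRing.ResidueField O)))
    (g := Polynomial.C (-IsLocalRing.residue O d') * Polynomial.X ^ 2 +
      Polynomial.C 0 * Polynomial.X + Polynomial.C (-IsLocalRing.residue O u'))
    (by simp) (Polynomial.degree_quadratic (neg_ne_zero.2 hd0)) hodd
  obtain ⟨x, rfl⟩ := IsLocalRing.residue_surjective x
  obtain ⟨y, rfl⟩ := IsLocalRing.residue_surjective y
  have hxy' : IsLocalRing.residue O (x ^ 2 - d' * y ^ 2 - u') = 0 := by
    rw [← hxy]
    simp
    ring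
  rw [hres] at hxy'
  set N : F := (x : F) ^ 2 - d * (y : F) ^ 2 with hN
  have h1 : ‖N - u‖ < 1 := hxy'
  have hNn : ‖N‖ = 1 := by
    have := IsUltrametricDist.norm_add_eq_max_of_norm_ne_norm (x := N - u) (y := u)
      (by rw [hu]; exact h1.ne)
    rwa [sub_add_cancel, hu, max_eq_right h1.le] at this
  have hN0 : N ≠ 0 := norm_ne_zero_iff.1 (by rw [hNn]; norm_num)
  obtain ⟨s, hs, -⟩ := S.exists_sq (t := u / N) (by
    rw [div_sub_one hN0, norm_div, hNn, div_one, norm_sub_rev]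
    exact h1)
  refine ⟨algebraMap F E s * (algebraMap F E x + ζ * algebraMap F E y), ?_⟩
  rw [star_mul', S.star_coe, S.star_add_zeta]
  have : u = s ^ 2 * N := by rw [hs]; field_simp
  rw [this, hN]
  simp only [map_mul, map_pow, map_sub, hd]
  ring

/-- Since `star` preserves the norm and E has the value group of F, norms have even valuation.
Conversely ϖ^(2k) is the norm of ϖ^k, and every unit of F is a norm. -/
lemma exists_norm_eq_iff {x : F} {n : ℤ} (hx : ‖x‖ = ‖ϖ‖ ^ n) :
    (∃ z : E, z * star z = algebraMap F E x) ↔ Even n := by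
  have hp := S.unif_pos
  constructor
  · rintro ⟨z, hz⟩
    have h1 : ‖z‖ * ‖z‖ = ‖ϖ‖ ^ n := by
      rw [← hx, ← norm_algebraMap' E x, ← hz, norm_mul, S.norm_star]
    have hz0 : z ≠ 0 := by
      rintro rfl
      simp only [norm_zero, mul_zero] at h1
      exact (zpow_pos hp n).ne h1
    obtain ⟨k, hk⟩ := S.exists_zpow' hz0
    rw [hk, ← zpow_add₀ hp.ne', S.zpow_inj] at h1
    exact ⟨k, h1.symm⟩
  · rintro ⟨k, rfl⟩
    have hk : ϖ ^ k ≠ 0 := zpow_ne_zero _ S.unif.1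
    obtain ⟨z, hz⟩ := S.exists_norm_eq_of_norm_eq_one (u := x / (ϖ ^ k * ϖ ^ k)) (by
      rw [norm_div, hx, norm_mul, norm_zpow, zpow_add₀ hp.ne', div_self]
      positivity)
    refine ⟨algebraMap F E (ϖ ^ k) * z, ?_⟩
    rw [star_mul', S.star_coe]
    calc _ = algebraMap F E (ϖ ^ k) * algebraMap F E (ϖ ^ k) * (z * star z) := by ring
      _ = _ := by
        rw [hz, ← map_mul, ← map_mul]
        congr 1
        field_simp

lemma omega_coe {x : F} {n : ℤ} (hx : ‖x‖ = ‖ϖ‖ ^ n) :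
    omega (algebraMap F E x) = (-1) ^ n := by
  classical
  rw [omega]
  by_cases h : Even n
  · rw [if_pos ((S.exists_norm_eq_iff hx).2 h), h.neg_one_zpow]
  · rw [if_neg (mt (S.exists_norm_eq_iff hx).1 h), (Int.not_even_iff_odd.1 h).neg_one_zpow]

end

end UnramifiedPair

end RelEndo

namespace RelEndo

/-! ### Orbital integrals over orbits with compact stabilizer -/

section CompactStabilizer

variable {G : Type*} [Group G] [TopologicalSpace G] [IsTopologicalGroup G]
  [SecondCountableTopology G] [MeasurableSpace G] [BorelSpace G]

/-- A right translate of τ is again a left Haar probability measure, so uniqueness applies. -/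
lemma isMulRightInvariant_of_compactSpace {T : Type*} [Group T] [TopologicalSpace T]
    [IsTopologicalGroup T] [CompactSpace T] [MeasurableSpace T] [BorelSpace T] (τ : Measure T)
    [τ.IsHaarMeasure] [IsProbabilityMeasure τ] : τ.IsMulRightInvariant := by
  refine ⟨fun g => ?_⟩
  have h1 : IsProbabilityMeasure (τ.map (· * g)) :=
    Measure.isProbabilityMeasure_map (measurable_mul_const g).aemeasurable
  have h2 : (τ.map (· * g)).IsHaarMeasure :=
    Measure.isHaarMeasure_of_isCompact_nonempty_interior _ Set.univ isCompact_univ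
      (by simp) (by simp) (by simp)
  exact Measure.isHaarMeasure_eq_of_isProbabilityMeasure _ _

lemma measurable_mk_rightCosets (T : Subgroup G) :
    Measurable (Quotient.mk _ : G → RightCosets T) := measurable_quotient_mk''

lemma lintegral_rightCosets_out {T : Subgroup G} (τ : Measure T) [τ.IsMulRightInvariant]
    (φ : G → ℝ≥0∞) (g : G) :
    ∫⁻ t : T, φ ((t : G) * (Quotient.mk _ g : RightCosets T).out) ∂τ =
      ∫⁻ t : T, φ ((t : G) * g) ∂τ := by
  have h : QuotientGroup.rightRel T (Quotient.mk _ g : RightCosets T).out g :=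
    Quotient.exact (Quotient.out_eq _)
  rw [QuotientGroup.rightRel_apply] at h
  have h' := T.inv_mem h
  set o := (Quotient.mk _ g : RightCosets T).out
  rw [← lintegral_mul_right_eq_self (fun t : T => φ ((t : G) * g)) ⟨_, h'⟩]
  congr 1
  ext t
  congr 1
  simp [mul_assoc]

/-- For compact T the largest compact subgroup is T itself, so the total mass of τ is 1. The
quotient measure is then the image of ν: swap the integrals and use left invariance of ν under each
t. -/
lemma isQuotientMeasure_map (ν : Measure G) [ν.IsMulLeftInvariant] [SFinite ν] (T : Subgroup G)
    (hT : IsCompact (T : Set G)) :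
    IsQuotientMeasure ν T (ν.map (Quotient.mk _ : G → RightCosets T)) := by
  have : CompactSpace T := isCompact_iff_compactSpace.1 hT
  let τ : Measure T := Measure.haarMeasure ⊤
  have hτ : τ Set.univ = 1 := Measure.haarMeasure_self (K₀ := (⊤ : TopologicalSpace.PositiveCompacts T))
  have hτ' : IsProbabilityMeasure τ := ⟨hτ⟩
  have hinv : τ.IsMulRightInvariant := isMulRightInvariant_of_compactSpace τ
  refine ⟨τ, inferInstance, ⟨⊤, ⟨?_, fun _ _ => le_top⟩, ?_⟩, fun φ hφ => ?_⟩
  · exact isCompact_univ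
  · exact hτ
  have hm : Measurable (fun p : G × T => φ ((p.2 : G) * p.1)) := by fun_prop
  rw [lintegral_map _ (measurable_mk_rightCosets T)]
  · simp only [lintegral_rightCosets_out]
    rw [lintegral_lintegral_swap hm.aemeasurable]
    simp [lintegral_mul_left_eq_self, hτ]
  · refine measurable_from_quotient.2 ?_
    have : (fun y : RightCosets T => ∫⁻ t : T, φ ((t : G) * y.out) ∂τ) ∘ Quotient.mk'' =
        fun g => ∫⁻ t : T, φ ((t : G) * g) ∂τ :=
      funext fun g => lintegral_rightCosets_out τ φ g
    rw [this]
    exact hm.lintegral_prod_right'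

/-- Uniqueness is what makes the choice in `quotientMeasure` harmless. It is tested on the
indicators of preimages of sets of cosets, which are constant along T. -/
lemma IsQuotientMeasure.eq_map {ν : Measure G} {T : Subgroup G} (hT : IsCompact (T : Set G))
    {m : Measure (RightCosets T)} (hm : IsQuotientMeasure ν T m) :
    m = ν.map (Quotient.mk _ : G → RightCosets T) := by
  obtain ⟨τ, -, ⟨K, ⟨-, hK⟩, hτ⟩, h⟩ := hm
  have hKtop : K = ⊤ := top_le_iff.1 (hK (by
    have : CompactSpace T := isCompact_iff_compactSpace.1 hT
    simpa using isCompact_univ (X := T)))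
  subst hKtop
  have hτ' : τ Set.univ = 1 := by simpa using hτ
  ext s hs
  have hmk := measurable_mk_rightCosets T
  rw [Measure.map_apply hmk hs]
  have h1 := h (((Quotient.mk _ : G → RightCosets T) ⁻¹' s).indicator 1)
    (measurable_one.indicator (hmk hs))
  rw [lintegral_indicator_one (hmk hs)] at h1
  rw [h1, ← lintegral_indicator_one hs]
  congr 1
  ext y
  have h2 : ∀ t : T, (Quotient.mk _ ((t : G) * y.out) : RightCosets T) = y := by
    intro t
    conv_rhs => rw [← Quotient.out_eq y]
    refine Quotient.sound ?_
    show QuotientGroup.rightRel T _ _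
    rw [QuotientGroup.rightRel_apply]
    simp
  by_cases hy : y ∈ s
  · simp [Set.indicator, h2, hy, hτ']
  · simp [Set.indicator, h2, hy]

lemma quotientMeasure_eq_map (ν : Measure G) [ν.IsMulLeftInvariant] [SFinite ν] (T : Subgroup G)
    (hT : IsCompact (T : Set G)) :
    quotientMeasure ν T = ν.map (Quotient.mk _ : G → RightCosets T) :=
  (Classical.epsilon_spec (p := IsQuotientMeasure ν T)
    ⟨_, isQuotientMeasure_map ν T hT⟩ : IsQuotientMeasure ν T (quotientMeasure ν T)).eq_map hT

variable {X : Type*} [MulAction G X]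

lemma Orb_eq_integral (ν : Measure G) [ν.IsMulLeftInvariant] [SFinite ν] {x : X}
    (hx : IsCompact (MulAction.stabilizer G x : Set G)) {f : X → ℂ}
    (hf : Measurable fun g : G => f (g⁻¹ • x)) :
    Orb ν x f = ∫ g, f (g⁻¹ • x) ∂ν := by
  have hm : Measurable (orbitFun (G := G) x f) := measurable_from_quotient.2 hf
  rw [Orb, quotientMeasure_eq_map ν _ hx,
    integral_map (measurable_mk_rightCosets _).aemeasurable hm.aestronglyMeasurable]
  rfl

lemma isCompact_stabilizer_smul {x : X} (hx : IsCompact (MulAction.stabilizer G x : Set G))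
    (h : G) : IsCompact (MulAction.stabilizer G (h • x) : Set G) := by
  have : (MulAction.stabilizer G (h • x) : Set G) =
      (fun g => h * g * h⁻¹) '' (MulAction.stabilizer G x : Set G) := by
    ext g
    simp only [Set.mem_image, SetLike.mem_coe, MulAction.mem_stabilizer_iff]
    constructor
    · intro hg
      refine ⟨h⁻¹ * g * h, ?_, by group⟩
      rw [mul_smul, mul_smul, hg, inv_smul_smul]
    · rintro ⟨k, hk, rfl⟩
      rw [mul_smul, mul_smul, inv_smul_smul, hk]
  rw [this]
  exact hx.image (by fun_prop)

lemma Orb_smul (ν : Measure G) [ν.IsMulLeftInvariant] [SFinite ν] {x : X}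
    (hx : IsCompact (MulAction.stabilizer G x : Set G)) {f : X → ℂ}
    (hf : Measurable fun g : G => f (g⁻¹ • x)) (h : G) :
    Orb ν (h • x) f = Orb ν x f := by
  have e : ∀ g : G, g⁻¹ • h • x = (h⁻¹ * g)⁻¹ • x := by
    intro g
    rw [mul_inv_rev, inv_inv, mul_smul]
  rw [Orb_eq_integral ν hx hf, Orb_eq_integral ν (isCompact_stabilizer_smul hx h)]
  · simp only [e]
    exact integral_mul_left_eq_self (fun g => f (g⁻¹ • x)) h⁻¹
  · simp only [e]
    exact hf.comp (measurable_const_mul h⁻¹)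

end CompactStabilizer

end RelEndo

namespace RelEndo

/-! ### The topology of unitary groups -/

namespace UnramifiedPair

variable {F E : Type*} [NontriviallyNormedField F] [IsUltrametricDist F] [LocallyCompactSpace F]
    [NormedField E] [NormedAlgebra F E] [StarRing E] {ϖ : F} {ζ : Eˣ}
    {ι : Type*} [Fintype ι] [DecidableEq ι]

section
variable (S : UnramifiedPair (E := E) ϖ ζ)
include S

lemma properSpace : ProperSpace E := by
  have := S.finite
  have : ProperSpace F := .of_locallyCompactSpace F
  exact FiniteDimensional.proper F E

lemma continuousStar : ContinuousStar E := by
  refine ⟨(AddMonoidHomClass.isometry_of_norm (starAddEquiv : E ≃+ E) S.norm_star).continuous⟩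

lemma isClosed_U (H : HermForm E ι) : IsClosed (H.U : Set (GL ι E)) := by
  have := S.continuousStar
  have : (H.U : Set (GL ι E)) = {g : GL ι E | (g : Matrix ι ι E)ᴴ * (H.gram : Matrix ι ι E) * (g : Matrix ι ι E) =
      (H.gram : Matrix ι ι E)} := by
    ext g
    exact Units.ext_iff
  rw [this]
  refine isClosed_eq ?_ continuous_const
  have h : Continuous fun g : GL ι E => (g : Matrix ι ι E) := Units.continuous_val
  exact (h.matrix_conjTranspose.mul continuous_const).mul h

lemma locallyCompactSpace_U (H : HermForm E ι) : LocallyCompactSpace H.U := by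
  have := S.properSpace
  have : LocallyCompactSpace (Matrix ι ι E) := inferInstanceAs (LocallyCompactSpace (ι → ι → E))
  exact (S.isClosed_U H).isClosedEmbedding_subtypeVal.locallyCompactSpace

lemma secondCountableTopology_U (H : HermForm E ι) : SecondCountableTopology H.U := by
  have := S.properSpace
  have : SecondCountableTopology (Matrix ι ι E) :=
    inferInstanceAs (SecondCountableTopology (ι → ι → E))
  have : SecondCountableTopology (Matrix ι ι E)ᵐᵒᵖ :=
    MulOpposite.opHomeomorph.symm.isInducing.secondCountableTopology
  have : SecondCountableTopology (GL ι E) :=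
    Units.isEmbedding_embedProduct.isInducing.secondCountableTopology
  exact TopologicalSpace.Subtype.secondCountableTopology _

lemma sigmaFinite_haar (H : HermForm E ι) (ν : Measure H.U) [ν.IsHaarMeasure] :
    SigmaFinite ν := by
  have := S.locallyCompactSpace_U H
  have := S.secondCountableTopology_U H
  infer_instance

/-- The units of the matrix ring form a closed subset of pairs (g, g⁻¹), so bounding both g and its
inverse gives a compact set. Bounds on g alone would not suffice in GL. -/
lemma isCompact_bounded_U (H : HermForm E ι) (C : ℝ) :
    IsCompact {g : H.U | (∀ i j, ‖((g : GL ι E) : Matrix ι ι E) i j‖ ≤ C) ∧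
      ∀ i j, ‖(((g : GL ι E)⁻¹ : GL ι E) : Matrix ι ι E) i j‖ ≤ C} := by
  have := S.properSpace
  have hbox : IsCompact {A : Matrix ι ι E | ∀ i j, ‖A i j‖ ≤ C} := by
    have : {A : Matrix ι ι E | ∀ i j, ‖A i j‖ ≤ C} =
        Set.pi Set.univ fun _ => Set.pi Set.univ fun _ => Metric.closedBall (0 : E) C := by
      ext A
      exact ⟨fun h i _ j _ => mem_closedBall_zero_iff.2 (h i j),
        fun h i j => mem_closedBall_zero_iff.1 (h i trivial j trivial)⟩
    rw [this]
    exact isCompact_univ_pi fun _ => isCompact_univ_pi fun _ => isCompact_closedBall _ _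
  have hbox' : IsCompact
      (MulOpposite.opHomeomorph '' {A : Matrix ι ι E | ∀ i j, ‖A i j‖ ≤ C}) :=
    hbox.image MulOpposite.opHomeomorph.continuous
  have h1 := (Units.isClosedEmbedding_embedProduct (α := Matrix ι ι E)).isCompact_preimage
    (hbox.prod hbox')
  have h2 := (S.isClosed_U H).isClosedEmbedding_subtypeVal.isCompact_preimage h1
  refine (congrArg IsCompact (Set.ext fun g => ?_)).mp h2
  constructor
  · rintro ⟨hg, B, hB, e⟩
    have e' : B = (((g : GL ι E)⁻¹ : GL ι E) : Matrix ι ι E) := MulOpposite.op_injective e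
    exact ⟨hg, e' ▸ hB⟩
  · rintro ⟨hg, hg'⟩
    exact ⟨hg, _, hg', rfl⟩

lemma continuous_U_apply (H : HermForm E ι) (i j : ι) :
    Continuous fun g : H.U => ((g : GL ι E) : Matrix ι ι E) i j := by
  have h : Continuous fun g : H.U => ((g : GL ι E) : Matrix ι ι E) :=
    Units.continuous_val.comp continuous_subtype_val
  exact h.matrix_elem i j

end

end UnramifiedPair

section Lattice

variable {F E : Type*} [NontriviallyNormedField F] [IsUltrametricDist F] [LocallyCompactSpace F]
    [NormedField E] [NormedAlgebra F E] [StarRing E] {ϖ : F} {ζ : Eˣ}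
    {ι : Type*} [Fintype ι] [DecidableEq ι]

lemma IsIntegral.mul [IsUltrametricDist E] {A B : Matrix ι ι E} (hA : IsIntegral A)
    (hB : IsIntegral B) : IsIntegral (A * B) := by
  intro i j
  rw [Matrix.mul_apply]
  refine IsUltrametricDist.norm_sum_le_of_forall_le_of_nonneg zero_le_one fun k _ => ?_
  rw [norm_mul]
  exact mul_le_one₀ (hA i k) (norm_nonneg _) (hB k j)

lemma isIntegral_one : IsIntegral (1 : Matrix ι ι E) := by
  intro i j
  rw [Matrix.one_apply]
  split_ifs <;> simp

/-- The stabilizer of the standard lattice as a subgroup. -/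
def latticeStabilizer [IsUltrametricDist E] (H : HermForm E ι) : Subgroup H.U where
  carrier := ULattice H
  one_mem' := ⟨by simpa using isIntegral_one, by simpa using isIntegral_one⟩
  mul_mem' := fun {g h} hg hh => ⟨by simpa using hg.1.mul hh.1, by simpa using hh.2.mul hg.2⟩
  inv_mem' := fun {g} hg => ⟨by simpa using hg.2, by simpa using hg.1⟩

lemma UnramifiedPair.isOpen_ULattice (S : UnramifiedPair (E := E) ϖ ζ) (H : HermForm E ι) :
    IsOpen (ULattice H) := by
  have := S.isUltrametricDist
  have hb : IsOpen {x : E | ‖x‖ ≤ 1} := by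
    have : {x : E | ‖x‖ ≤ 1} = Metric.closedBall 0 1 := by ext; simp
    rw [this]
    exact IsUltrametricDist.isOpen_closedBall _ one_ne_zero
  have : ULattice H = ⋂ i, ⋂ j, ((fun g : H.U => ((g : GL ι E) : Matrix ι ι E) i j) ⁻¹'
      {x : E | ‖x‖ ≤ 1} ∩ (fun g : H.U => ((g⁻¹ : H.U) : GL ι E).1 i j) ⁻¹'
      {x : E | ‖x‖ ≤ 1}) := by
    ext g
    simp only [ULattice, IsIntegral, Set.mem_ofPred_eq, Set.mem_iInter, Set.mem_inter_iff,
      Set.mem_preimage, InvMemClass.coe_inv]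
    exact ⟨fun h i j => ⟨h.1 i j, h.2 i j⟩, fun h => ⟨fun i j => (h i j).1, fun i j => (h i j).2⟩⟩
  rw [this]
  refine isOpen_iInter_of_finite fun i => isOpen_iInter_of_finite fun j => ?_
  exact (hb.preimage (S.continuous_U_apply H i j)).inter
    (hb.preimage ((S.continuous_U_apply H i j).comp continuous_inv))

end Lattice

end RelEndo

namespace RelEndo

/-! ### The quasi-split unitary group in two variables -/

section V2

variable {E : Type*} [Field E] [StarRing E] {ζ : Eˣ} {hζ : star (ζ : E) = -(ζ : E)}

lemma V2_gram : ((V2 ζ hζ).gram : Matrix (Fin 2) (Fin 2) E) = !![0, (ζ : E); -(ζ : E), 0] := rfl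

lemma V2_gram_inv : (((V2 ζ hζ).gram⁻¹ : GL (Fin 2) E) : Matrix (Fin 2) (Fin 2) E) =
    !![0, -(ζ : E)⁻¹; (ζ : E)⁻¹, 0] := by
  rw [← Units.val_inv_eq_inv_val]; rfl

lemma V2_adj (X : Matrix (Fin 2) (Fin 2) E) : (V2 ζ hζ).adj X =
    !![star (X 1 1), -star (X 0 1); -star (X 1 0), star (X 0 0)] := by
  have h0 : (ζ : E) ≠ 0 := ζ.ne_zero
  rw [HermForm.adj, V2_gram, V2_gram_inv, Matrix.eta_fin_two Xᴴ]
  ext i j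
  fin_cases i <;> fin_cases j <;> simp <;> field_simp

lemma HermForm.mem_U_iff {ι : Type*} [Fintype ι] [DecidableEq ι] {H : HermForm E ι}
    {g : GL ι E} : g ∈ H.U ↔ H.adj (g : Matrix ι ι E) * (g : Matrix ι ι E) = 1 := by
  have e : g ∈ H.U ↔ H.gram⁻¹ * star g * H.gram * g = 1 := by
    show star g * H.gram * g = H.gram ↔ _
    rw [mul_assoc, mul_assoc, mul_assoc, inv_mul_eq_one, eq_comm]
  rw [e, Units.ext_iff]
  rfl

lemma HermForm.coe_inv {ι : Type*} [Fintype ι] [DecidableEq ι] {H : HermForm E ι} (g : H.U) :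
    (((g : GL ι E)⁻¹ : GL ι E) : Matrix ι ι E) = H.adj ((g : GL ι E) : Matrix ι ι E) := by
  have h := HermForm.mem_U_iff.1 g.2
  rw [← Units.mul_left_inj (g : GL ι E), h, Units.inv_mul]

lemma V2_mem_U_iff {g : GL (Fin 2) E} : g ∈ (V2 ζ hζ).U ↔
    star (g 0 0) * g 1 0 = star (g 1 0) * g 0 0 ∧
    star (g 0 0) * g 1 1 - star (g 1 0) * g 0 1 = 1 ∧
    star (g 0 1) * g 1 1 = star (g 1 1) * g 0 1 := by
  rw [HermForm.mem_U_iff, V2_adj, ← Matrix.ext_iff]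
  simp only [Fin.forall_fin_two, Matrix.mul_apply, Fin.sum_univ_two, Matrix.one_apply]
  simp
  constructor
  · rintro ⟨⟨h1, h2⟩, h3, h4⟩
    exact ⟨by linear_combination h3, by linear_combination h4, by linear_combination -h2⟩
  · rintro ⟨h1, h2, h3⟩
    refine ⟨⟨?_, by linear_combination -h3⟩, by linear_combination h1, by linear_combination h2⟩
    have h4 := congrArg star h2
    simp only [star_sub, star_mul', star_star, star_one] at h4
    linear_combination h4

variable (ζ hζ) in
/-- The element `(p, q; r, s)` of `U(V₂)`. -/
def mkU (p q r s : E) (h1 : star p * r = star r * p) (h2 : star p * s - star r * q = 1)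
    (h3 : star q * s = star s * q) : (V2 ζ hζ).U :=
  have h4 : star s * p - star q * r = 1 := by
    have h4 := congrArg star h2
    simp only [star_sub, star_mul', star_star, star_one] at h4
    linear_combination h4
  have h : !![star s, -star q; -star r, star p] * !![p, q; r, s] = 1 := by
    ext i j
    fin_cases i <;> fin_cases j <;> simp [Matrix.mul_apply, Fin.sum_univ_two]
    · linear_combination h4
    · linear_combination -h3
    · linear_combination h1
    · linear_combination h2
  ⟨⟨!![p, q; r, s], !![star s, -star q; -star r, star p], mul_eq_one_comm.1 h, h⟩,
    V2_mem_U_iff.2 ⟨h1, h2, h3⟩⟩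

lemma coe_mkU (p q r s : E) (h1 h2 h3) :
    ((mkU ζ hζ p q r s h1 h2 h3 : GL (Fin 2) E) : Matrix (Fin 2) (Fin 2) E) = !![p, q; r, s] :=
  rfl

lemma coe_mkU_inv (p q r s : E) (h1 h2 h3) :
    (((mkU ζ hζ p q r s h1 h2 h3 : GL (Fin 2) E)⁻¹ : GL (Fin 2) E) : Matrix (Fin 2) (Fin 2) E) =
      !![star s, -star q; -star r, star p] := rfl

end V2

/-! ### Iwasawa decomposition and volumes in U(V₂) -/

namespace UnramifiedPair

variable {F E : Type*} [NontriviallyNormedField F] [IsUltrametricDist F] [LocallyCompactSpace F]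
    [NormedField E] [NormedAlgebra F E] [StarRing E] {ϖ : F} {ζ : Eˣ}

section
variable (S : UnramifiedPair (E := E) ϖ ζ)

/-- `U(V₂)`. -/
abbrev U2 : Subgroup (GL (Fin 2) E) := (V2 ζ S.star_zeta).U

/-- `SL₂(F)` inside `U(V₂)`. -/
def sl2 (p q r s : F) (h : p * s - q * r = 1) : S.U2 :=
  mkU ζ S.star_zeta (algebraMap F E p) (algebraMap F E q) (algebraMap F E r) (algebraMap F E s)
    (by rw [S.star_coe, S.star_coe, mul_comm])
    (by rw [S.star_coe, S.star_coe, ← map_mul, ← map_mul, ← map_sub, mul_comm r, h, map_one])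
    (by rw [S.star_coe, S.star_coe, mul_comm])

lemma coe_sl2 (p q r s : F) (h) : ((S.sl2 p q r s h : GL (Fin 2) E) : Matrix (Fin 2) (Fin 2) E) =
    !![algebraMap F E p, algebraMap F E q; algebraMap F E r, algebraMap F E s] := rfl

lemma coe_sl2_inv (p q r s : F) (h) :
    (((S.sl2 p q r s h : GL (Fin 2) E)⁻¹ : GL (Fin 2) E) : Matrix (Fin 2) (Fin 2) E) =
    !![algebraMap F E s, -algebraMap F E q; -algebraMap F E r, algebraMap F E p] := by
  rw [sl2, coe_mkU_inv]
  simp only [S.star_coe]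

/-- The upper triangular element `(ϖ ^ m, x ϖ ^ (-m); 0, ϖ ^ (-m))`. -/
def upper (x : F) (m : ℤ) : S.U2 :=
  S.sl2 (ϖ ^ m) (x * ϖ ^ (-m)) 0 (ϖ ^ (-m)) (by
    rw [← zpow_add₀ S.unif.1]; simp)

lemma mem_ULattice_iff {g : S.U2} : g ∈ ULattice (V2 ζ S.star_zeta) ↔
    IsIntegral ((g : GL (Fin 2) E) : Matrix (Fin 2) (Fin 2) E) := by
  refine ⟨fun h => h.1, fun h => ⟨h, ?_⟩⟩
  rw [HermForm.coe_inv, V2_adj]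
  intro i j
  fin_cases i <;> fin_cases j <;> simp [S.norm_star] <;> exact h _ _

lemma sl2_mem_ULattice {p q r s : F} {h} (hp : ‖p‖ ≤ 1) (hq : ‖q‖ ≤ 1) (hr : ‖r‖ ≤ 1)
    (hs : ‖s‖ ≤ 1) : S.sl2 p q r s h ∈ ULattice (V2 ζ S.star_zeta) := by
  rw [S.mem_ULattice_iff, S.coe_sl2]
  intro i j
  fin_cases i <;> fin_cases j <;> simpa [norm_algebraMap']

lemma coe_upper_inv_mul (x : F) (m : ℤ) (g : S.U2) :
    (((S.upper x m)⁻¹ * g : S.U2) : GL (Fin 2) E).1 =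
      !![algebraMap F E (ϖ ^ (-m)) * (g.1 0 0 - algebraMap F E x * g.1 1 0),
          algebraMap F E (ϖ ^ (-m)) * (g.1 0 1 - algebraMap F E x * g.1 1 1);
        algebraMap F E (ϖ ^ m) * g.1 1 0, algebraMap F E (ϖ ^ m) * g.1 1 1] := by
  have : (((S.upper x m)⁻¹ * g : S.U2) : GL (Fin 2) E).1 =
      (((S.upper x m : GL (Fin 2) E)⁻¹ : GL (Fin 2) E) : Matrix (Fin 2) (Fin 2) E) * g.1.1 := rfl
  rw [this, upper, coe_sl2_inv]
  ext i j
  fin_cases i <;> fin_cases j <;> simp [Matrix.mul_apply, Fin.sum_univ_two] <;> ring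

/-- Iwasawa decomposition with representatives in SL₂(F). The unitary relations put the ratio of
either column with nonzero lower entry in F. Taking x to be this ratio for the column with the
larger lower entry clears its upper entry, and m rescales the rows to be integral; the relation of
determinant type controls the remaining upper entry. -/
lemma exists_upper_inv_mul_mem (g : S.U2) :
    ∃ (x : F) (m : ℤ), (S.upper x m)⁻¹ * g ∈ ULattice (V2 ζ S.star_zeta) := by
  obtain ⟨h1, h2, h3⟩ := V2_mem_U_iff.1 g.2
  have hp := S.unif_pos
  rcases le_total ‖g.1 1 0‖ ‖g.1 1 1‖ with h | h
  · have hs : g.1 1 1 ≠ 0 := by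
      intro h0
      rw [h0, norm_zero, norm_le_zero_iff] at h
      simp [h, h0] at h2
    have hs' : star (g.1 1 1) ≠ 0 := star_ne_zero.2 hs
    obtain ⟨x, hx⟩ := (S.star_eq_iff (g.1 0 1 / g.1 1 1)).1 (by
      rw [star_div₀]
      field_simp
      linear_combination h3)
    obtain ⟨m, hm⟩ := S.exists_zpow' hs
    have hq : g.1 0 1 - algebraMap F E x * g.1 1 1 = 0 := by rw [hx]; field_simp; ring
    have hpn : ‖g.1 0 0 - algebraMap F E x * g.1 1 0‖ = ‖ϖ‖ ^ (-m) := by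
      have e : star (g.1 0 0 - algebraMap F E x * g.1 1 0) * g.1 1 1 = 1 := by
        rw [star_sub, star_mul', S.star_coe, ← h2, hx]
        field_simp
      have := congrArg norm e
      rw [norm_mul, S.norm_star, hm, norm_one] at this
      rw [zpow_neg]
      exact eq_inv_of_mul_eq_one_left this
    refine ⟨x, -m, ?_⟩
    rw [S.mem_ULattice_iff, S.coe_upper_inv_mul]
    intro i j
    have e1 : ‖ϖ‖ ^ m * ‖ϖ‖ ^ (-m) = 1 := by rw [← zpow_add₀ hp.ne']; simp
    fin_cases i <;> fin_cases j <;>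
      simp only [Fin.zero_eta, Fin.mk_one, Matrix.of_apply, Matrix.cons_val', Matrix.cons_val_zero,
        Matrix.cons_val_one, Matrix.cons_val_fin_one, norm_mul, norm_algebraMap', norm_zpow, neg_neg, hpn, hq, hm,
        norm_zero, mul_zero, zero_le_one]
    · exact e1.le
    · calc _ ≤ ‖ϖ‖ ^ (-m) * ‖g.1 1 1‖ := by gcongr
        _ = 1 := by rw [hm, mul_comm, e1]
    · rw [mul_comm]; exact e1.le
  · have hr : g.1 1 0 ≠ 0 := by
      intro h0
      rw [h0, norm_zero, norm_le_zero_iff] at h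
      simp [h, h0] at h2
    have hr' : star (g.1 1 0) ≠ 0 := star_ne_zero.2 hr
    obtain ⟨x, hx⟩ := (S.star_eq_iff (g.1 0 0 / g.1 1 0)).1 (by
      rw [star_div₀]
      field_simp
      linear_combination h1)
    obtain ⟨m, hm⟩ := S.exists_zpow' hr
    have hq : g.1 0 0 - algebraMap F E x * g.1 1 0 = 0 := by rw [hx]; field_simp; ring
    have hx' : algebraMap F E x = star (g.1 0 0) / star (g.1 1 0) := by
      rw [← S.star_coe, hx, star_div₀]
    have hpn : ‖g.1 0 1 - algebraMap F E x * g.1 1 1‖ = ‖ϖ‖ ^ (-m) := by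
      have e : star (g.1 1 0) * (g.1 0 1 - algebraMap F E x * g.1 1 1) = -1 := by
        rw [← h2, hx']
        field_simp
        ring
      have := congrArg norm e
      rw [norm_mul, S.norm_star, hm, norm_neg, norm_one] at this
      rw [zpow_neg]
      exact eq_inv_of_mul_eq_one_right this
    refine ⟨x, -m, ?_⟩
    rw [S.mem_ULattice_iff, S.coe_upper_inv_mul]
    intro i j
    have e1 : ‖ϖ‖ ^ m * ‖ϖ‖ ^ (-m) = 1 := by rw [← zpow_add₀ hp.ne']; simp
    fin_cases i <;> fin_cases j <;>
      simp only [Fin.zero_eta, Fin.mk_one, Matrix.of_apply, Matrix.cons_val', Matrix.cons_val_zero,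
        Matrix.cons_val_one, Matrix.cons_val_fin_one, norm_mul, norm_algebraMap', norm_zpow, neg_neg, hpn, hq, hm,
        norm_zero, mul_zero, zero_le_one]
    · exact e1.le
    · rw [mul_comm]; exact e1.le
    · calc _ ≤ ‖ϖ‖ ^ (-m) * ‖g.1 1 0‖ := by gcongr
        _ = 1 := by rw [hm, mul_comm, e1]

/-- This identifies the cosets of U(Λ): they are indexed by m and by x modulo ϖ^(2m). -/
lemma upper_inv_mul_upper_mem_iff {x y : F} {m n : ℤ} :
    (S.upper x m)⁻¹ * S.upper y n ∈ ULattice (V2 ζ S.star_zeta) ↔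
      m = n ∧ ‖x - y‖ ≤ ‖ϖ‖ ^ (2 * m) := by
  have hp := S.unif_pos
  have e00 : (S.upper y n).1 0 0 = algebraMap F E (ϖ ^ n) := rfl
  have e01 : (S.upper y n).1 0 1 = algebraMap F E (y * ϖ ^ (-n)) := rfl
  have e10 : (S.upper y n).1 1 0 = algebraMap F E 0 := rfl
  have e11 : (S.upper y n).1 1 1 = algebraMap F E (ϖ ^ (-n)) := rfl
  rw [S.mem_ULattice_iff, S.coe_upper_inv_mul, e00, e01, e10, e11]
  simp only [← map_mul, ← map_sub]
  simp only [IsIntegral, Fin.forall_fin_two, Matrix.of_apply, Matrix.cons_val', Matrix.cons_val_zero,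
    Matrix.cons_val_one, Matrix.cons_val_fin_one, norm_algebraMap', mul_zero, sub_zero, norm_zero,
    zero_le_one, true_and]
  rw [← sub_mul, norm_mul, norm_mul, norm_mul, norm_mul, norm_zpow, norm_zpow, norm_zpow, norm_zpow,
    ← zpow_add₀ hp.ne', ← zpow_add₀ hp.ne', ← zpow_zero ‖ϖ‖, S.zpow_le_zpow, S.zpow_le_zpow,
    norm_sub_rev x y]
  have key : ∀ k : ℤ, k = m → (‖ϖ‖ ^ (-m) * (‖y - x‖ * ‖ϖ‖ ^ (-k)) ≤ ‖ϖ‖ ^ (0 : ℤ) ↔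
      ‖y - x‖ ≤ ‖ϖ‖ ^ (2 * m)) := by
    rintro k rfl
    rw [zpow_zero, mul_left_comm, ← zpow_add₀ hp.ne', ← le_div_iff₀ (by positivity), one_div,
      ← zpow_neg]
    ring_nf
  constructor
  · rintro ⟨⟨h1, h2⟩, h3⟩
    have : n = m := by lia
    exact ⟨this.symm, (key n this).1 h2⟩
  · rintro ⟨h1, h2⟩
    exact ⟨⟨by lia, (key n h1.symm).2 h2⟩, by lia⟩

/-- The volume of a set that is invariant under `U(Λ)` on the right, by the Iwasawa
decomposition. -/
lemma measure_eq_sum (ν : Measure S.U2) [ν.IsHaarMeasure]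
    (hν : ν (ULattice (V2 ζ S.star_zeta)) = 1) {A : Set S.U2}
    (hA : ∀ g ∈ A, ∀ k ∈ ULattice (V2 ζ S.star_zeta), g * k ∈ A) (I : Finset ℤ) (n : ℤ → ℕ)
    (hI : ∀ x m, S.upper x m ∈ A ↔ m ∈ I ∧ ‖x‖ ≤ ‖ϖ‖ ^ (2 * m - n m)) :
    ν A = ∑ m ∈ I, (resCard F : ℝ≥0∞) ^ n m := by
  classical
  have := S.isUltrametricDist
  -- For fixed m the admissible cosets are ϖ^(2m − n m)𝒪 modulo ϖ^(2m)𝒪, which gives q^(n m) of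
  -- them, each of volume one.
  choose R hRc hRb hRs hRi using fun m : ℤ => S.exists_representatives (2 * m - n m) (n m)
  simp only [sub_add_cancel] at hRs hRi
  let C : (Σ _ : ℤ, F) → Set S.U2 := fun p =>
    (fun g => (S.upper p.2 p.1)⁻¹ * g) ⁻¹' ULattice (V2 ζ S.star_zeta)
  have hU : A = ⋃ p ∈ I.sigma R, C p := by
    ext g
    simp only [Set.mem_iUnion, Finset.mem_sigma, exists_prop]
    constructor
    · intro hg
      obtain ⟨x, m, hx⟩ := S.exists_upper_inv_mul_mem g
      have h1 : S.upper x m ∈ A := by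
        have h2 : S.upper x m = g * ((S.upper x m)⁻¹ * g)⁻¹ := by group
        rw [h2]
        have h3 : ((S.upper x m)⁻¹ * g)⁻¹ ∈ latticeStabilizer (V2 ζ S.star_zeta) :=
          Subgroup.inv_mem _ hx
        exact hA g hg _ h3
      obtain ⟨hm, hxm⟩ := (hI x m).1 h1
      obtain ⟨y, hy, hyx⟩ := hRs m x hxm
      refine ⟨⟨m, y⟩, ⟨hm, hy⟩, ?_⟩
      have h3 : (S.upper y m)⁻¹ * S.upper x m ∈ ULattice (V2 ζ S.star_zeta) :=
        S.upper_inv_mul_upper_mem_iff.2 ⟨rfl, hyx⟩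
      have h4 : (S.upper y m)⁻¹ * S.upper x m * ((S.upper x m)⁻¹ * g) ∈
          latticeStabilizer (V2 ζ S.star_zeta) := Subgroup.mul_mem _ h3 hx
      have h5 : (S.upper y m)⁻¹ * g = (S.upper y m)⁻¹ * S.upper x m * ((S.upper x m)⁻¹ * g) := by
        group
      show (S.upper y m)⁻¹ * g ∈ ULattice (V2 ζ S.star_zeta)
      rw [h5]
      exact h4
    · rintro ⟨⟨m, x⟩, ⟨hm, hx⟩, hg⟩
      have h1 := hA _ ((hI x m).2 ⟨hm, hRb m x hx⟩) ((S.upper x m)⁻¹ * g) hg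
      simpa using h1
  have hdisj : (↑(I.sigma R) : Set (Σ _ : ℤ, F)).PairwiseDisjoint C := by
    rintro ⟨m, x⟩ hx ⟨k, y⟩ hy hne
    refine Set.disjoint_left.2 fun g h1 h2 => hne ?_
    have h3 : (S.upper x m)⁻¹ * g * ((S.upper y k)⁻¹ * g)⁻¹ ∈
        latticeStabilizer (V2 ζ S.star_zeta) := Subgroup.mul_mem _ h1 (Subgroup.inv_mem _ h2)
    have h5 : (S.upper x m)⁻¹ * g * ((S.upper y k)⁻¹ * g)⁻¹ = (S.upper x m)⁻¹ * S.upper y k := by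
      group
    rw [h5] at h3
    obtain ⟨rfl, h6⟩ := S.upper_inv_mul_upper_mem_iff.1 h3
    simp only [Finset.coe_sigma, Set.mem_sigma_iff, Finset.mem_coe] at hx hy
    rw [hRi m x hx.2 y hy.2 h6]
  have hmeas : ∀ p, MeasurableSet (C p) := fun p =>
    ((S.isOpen_ULattice _).preimage (continuous_const_mul _)).measurableSet
  rw [hU, measure_biUnion_finset hdisj fun p _ => hmeas p]
  have h1 : ∀ p, ν (C p) = 1 := fun p => (measure_preimage_mul ν _ _).trans hν
  simp only [h1, Finset.sum_const, Finset.card_sigma, hRc]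
  simp

end

end UnramifiedPair

end RelEndo

namespace RelEndo

/-! ### The pushforward along the contraction map -/

section Adjoint

variable {E : Type*} [Field E] [StarRing E] {ι : Type*} [Fintype ι] [DecidableEq ι]

lemma HermForm.adj_mul (H : HermForm E ι) (X Y : Matrix ι ι E) :
    H.adj (X * Y) = H.adj Y * H.adj X := by
  simp [HermForm.adj, Matrix.conjTranspose_mul, ← mul_assoc]

lemma HermForm.adj_one (H : HermForm E ι) : H.adj 1 = 1 := by
  simp [HermForm.adj]

lemma HermForm.coe_smul {H : HermForm E ι} (g : H.U) (δ : H.Herm) :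
    (g • δ).1 = ((g : GL ι E) : Matrix ι ι E) * δ.1 *
      (((g : GL ι E)⁻¹ : GL ι E) : Matrix ι ι E) := rfl

lemma HermForm.mul_adj_smul {H : HermForm E ι} (k : H.U) (X : GL ι E) {δ : H.Herm}
    (hX : (X : Matrix ι ι E) * H.adj X = δ.1) :
    (((k : GL ι E) * X : GL ι E) : Matrix ι ι E) * H.adj ((k : GL ι E) * X : GL ι E) =
      (k • δ).1 := by
  rw [HermForm.coe_smul, ← hX, HermForm.coe_inv, Units.val_mul, H.adj_mul]
  simp only [mul_assoc]

/-- The fibres of the contraction map on GL are single orbits under right multiplication by U(V).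
This makes the choice of X in `pushforward` irrelevant, as used in `Phi_eq`. -/
lemma HermForm.inv_mul_mem_U {H : HermForm E ι} {X Y : GL ι E}
    (h : (X : Matrix ι ι E) * H.adj X = (Y : Matrix ι ι E) * H.adj Y) : X⁻¹ * Y ∈ H.U := by
  rw [HermForm.mem_U_iff, mul_eq_one_comm, Units.val_mul, H.adj_mul]
  have h1 : (X : Matrix ι ι E) * ((X⁻¹ : GL ι E) : Matrix ι ι E) = 1 := X.mul_inv
  have h2 : H.adj X * H.adj ((X⁻¹ : GL ι E) : Matrix ι ι E) = 1 := by
    rw [← H.adj_mul, Units.inv_mul, H.adj_one]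
  have h3 : ((X⁻¹ : GL ι E) : Matrix ι ι E) * (X : Matrix ι ι E) = 1 := X.inv_mul
  calc _ = ((X⁻¹ : GL ι E) : Matrix ι ι E) * ((Y : Matrix ι ι E) * H.adj Y) *
        H.adj ((X⁻¹ : GL ι E) : Matrix ι ι E) := by simp only [mul_assoc]
    _ = (((X⁻¹ : GL ι E) : Matrix ι ι E) * (X : Matrix ι ι E)) * (H.adj X *
        H.adj ((X⁻¹ : GL ι E) : Matrix ι ι E)) := by rw [← h]; simp only [mul_assoc]
    _ = 1 := by rw [h2, h3, mul_one]

end Adjoint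

namespace UnramifiedPair

variable {F E : Type*} [NontriviallyNormedField F] [IsUltrametricDist F] [LocallyCompactSpace F]
    [NormedField E] [NormedAlgebra F E] [StarRing E] {ϖ : F} {ζ : Eˣ}

section
variable (S : UnramifiedPair (E := E) ϖ ζ)

section General

variable {ι : Type*} [Fintype ι] [DecidableEq ι] {H : HermForm E ι}

include S in
lemma measurableSet_isIntegral_mul (X : Matrix ι ι E) :
    MeasurableSet {g : H.U | IsIntegral (X * ((g : GL ι E) : Matrix ι ι E))} := by
  have : {g : H.U | IsIntegral (X * ((g : GL ι E) : Matrix ι ι E))} =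
      ⋂ i, ⋂ j, {g : H.U | ‖(X * ((g : GL ι E) : Matrix ι ι E)) i j‖ ≤ 1} := by
    ext g
    simp [IsIntegral]
  rw [this]
  refine (isClosed_iInter fun i => isClosed_iInter fun j => ?_).measurableSet
  refine isClosed_le (continuous_norm.comp ?_) continuous_const
  simp only [Matrix.mul_apply]
  exact continuous_finsetSum _ fun k _ => continuous_const.mul (S.continuous_U_apply H k j)

include S in
lemma Phi_eq (ν : Measure H.U) [ν.IsHaarMeasure] {δ : H.Herm} (X : GL ι E)
    (hX : (X : Matrix ι ι E) * H.adj X = δ.1) :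
    Phi ν δ = ((ν {g : H.U | IsIntegral ((X : Matrix ι ι E) *
      ((g : GL ι E) : Matrix ι ι E))}).toReal : ℂ) := by
  classical
  have hex : ∃ X : GL ι E, (X : Matrix ι ι E) * H.adj X = δ.1 := ⟨X, hX⟩
  rw [Phi, pushforward, dif_pos hex]
  set Y := hex.choose
  have hY : (Y : Matrix ι ι E) * H.adj Y = δ.1 := hex.choose_spec
  -- The chosen preimage Y is X u with u unitary, and left invariance of ν absorbs u.
  let u : H.U := ⟨X⁻¹ * Y, HermForm.inv_mul_mem_U (hX.trans hY.symm)⟩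
  have e : ∀ g : H.U, (Y : Matrix ι ι E) * ((g : GL ι E) : Matrix ι ι E) =
      (X : Matrix ι ι E) * (((u * g : H.U) : GL ι E) : Matrix ι ι E) := by
    intro g
    have : (((u * g : H.U) : GL ι E) : Matrix ι ι E) = ((X⁻¹ * Y * (g : GL ι E) : GL ι E)) := rfl
    rw [this, ← Units.val_mul, ← Units.val_mul]
    congr 1
    group
  simp only [e]
  rw [integral_mul_left_eq_self (fun g : H.U => charEnd ((X : Matrix ι ι E) *
    ((g : GL ι E) : Matrix ι ι E))) u]
  have : (fun g : H.U => (charEnd ((X : Matrix ι ι E) * ((g : GL ι E) : Matrix ι ι E)) : ℂ)) =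
      Set.indicator {g : H.U | IsIntegral ((X : Matrix ι ι E) *
        ((g : GL ι E) : Matrix ι ι E))} (fun _ => (1 : ℂ)) := by
    ext g
    simp [charEnd, Set.indicator]
  rw [this, integral_indicator_const _ (S.measurableSet_isIntegral_mul _)]
  simp [Measure.real]

lemma Phi_eq_zero (ν : Measure H.U) {δ : H.Herm}
    (h : ¬ ∃ X : GL ι E, (X : Matrix ι ι E) * H.adj X = δ.1) : Phi ν δ = 0 := by
  classical
  rw [Phi, pushforward, dif_neg h]

lemma isIntegral_mul_iff [IsUltrametricDist E] {k : H.U} (hk : k ∈ ULattice H)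
    (X : Matrix ι ι E) : IsIntegral (((k : GL ι E) : Matrix ι ι E) * X) ↔ IsIntegral X := by
  refine ⟨fun h => ?_, fun h => hk.1.mul h⟩
  have := hk.2.mul h
  rwa [← mul_assoc, Units.inv_mul, one_mul] at this

include S in
lemma Phi_smul (ν : Measure H.U) [ν.IsHaarMeasure] (δ : H.Herm) {k : H.U}
    (hk : k ∈ ULattice H) : Phi ν (k • δ) = Phi ν δ := by
  have := S.isUltrametricDist
  by_cases h : ∃ X : GL ι E, (X : Matrix ι ι E) * H.adj X = δ.1
  · obtain ⟨X, hX⟩ := h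
    rw [S.Phi_eq ν X hX, S.Phi_eq ν _ (HermForm.mul_adj_smul k X hX)]
    simp only [Units.val_mul, mul_assoc, isIntegral_mul_iff hk]
  · rw [Phi_eq_zero ν h, Phi_eq_zero ν]
    rintro ⟨X, hX⟩
    refine h ⟨((k⁻¹ : H.U) : GL ι E) * X, ?_⟩
    rw [HermForm.mul_adj_smul k⁻¹ X hX, inv_smul_smul]

lemma forall_norm_smul_le [IsUltrametricDist E] {k : H.U} (hk : k ∈ ULattice H) (δ : H.Herm)
    {c : ℝ} (hc : 0 ≤ c) (h : ∀ i j, ‖δ.1 i j‖ ≤ c) : ∀ i j, ‖(k • δ).1 i j‖ ≤ c := by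
  intro i j
  rw [HermForm.coe_smul, Matrix.mul_apply]
  refine IsUltrametricDist.norm_sum_le_of_forall_le_of_nonneg hc fun l _ => ?_
  rw [norm_mul, Matrix.mul_apply]
  refine (mul_le_of_le_one_right (norm_nonneg _) (hk.2 l j)).trans ?_
  refine IsUltrametricDist.norm_sum_le_of_forall_le_of_nonneg hc fun m _ => ?_
  rw [norm_mul]
  exact (mul_le_of_le_one_left (norm_nonneg _) (hk.1 i m)).trans (h m l)

lemma forall_norm_smul_le_iff [IsUltrametricDist E] {k : H.U} (hk : k ∈ ULattice H) (δ : H.Herm)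
    {c : ℝ} (hc : 0 ≤ c) : (∀ i j, ‖(k • δ).1 i j‖ ≤ c) ↔ ∀ i j, ‖δ.1 i j‖ ≤ c := by
  refine ⟨fun h => ?_, forall_norm_smul_le hk δ hc⟩
  have := forall_norm_smul_le ((latticeStabilizer H).inv_mem hk) (k • δ) hc h
  rwa [inv_smul_smul] at this

lemma det_smul (g : H.U) (δ : H.Herm) : (g • δ).1.det = δ.1.det := by
  rw [HermForm.coe_smul, mul_assoc, Matrix.det_mul_comm, mul_assoc, Units.inv_mul, mul_one]

end General

/-- The element `a + ζ (y, l; m, -y)` of `Herm(V₂)`. -/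
def herm (a y l m : F) : (V2 ζ S.star_zeta).Herm :=
  ⟨!![algebraMap F E a + ζ * algebraMap F E y, ζ * algebraMap F E l;
      ζ * algebraMap F E m, algebraMap F E a - ζ * algebraMap F E y], by
    rw [V2_adj]
    ext i j
    fin_cases i <;> fin_cases j <;> simp [S.star_coe, S.star_zeta, sub_eq_add_neg]⟩

lemma coe_herm (a y l m : F) : (S.herm a y l m).1 =
    !![algebraMap F E a + ζ * algebraMap F E y, ζ * algebraMap F E l;
      ζ * algebraMap F E m, algebraMap F E a - ζ * algebraMap F E y] := rfl

lemma exists_eq_herm (δ : (V2 ζ S.star_zeta).Herm) : ∃ a y l m, δ = S.herm a y l m := by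
  have h := δ.2
  rw [V2_adj, ← Matrix.ext_iff] at h
  simp [Fin.forall_fin_two] at h
  obtain ⟨⟨h1, h2⟩, h3, h4⟩ := h
  have hz : (ζ : E) ≠ 0 := ζ.ne_zero
  obtain ⟨a, y, hay⟩ := S.exists_eq_add (δ.1 0 0)
  obtain ⟨l, hl⟩ := (S.star_eq_iff (δ.1 0 1 / ζ)).1 (by
    rw [star_div₀, S.star_zeta, div_neg, ← neg_div, h2])
  obtain ⟨m, hm⟩ := (S.star_eq_iff (δ.1 1 0 / ζ)).1 (by
    rw [star_div₀, S.star_zeta, div_neg, ← neg_div, h3])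
  refine ⟨a, y, l, m, Subtype.ext ?_⟩
  rw [coe_herm, hl, hm, ← hay]
  ext i j
  fin_cases i <;> fin_cases j <;> simp
  · field_simp
  · field_simp
  · rw [← h4, hay, S.star_add_zeta]

/-- Conjugation fixes the scalar part a and acts on (y, l, m) by the adjoint representation of
SL₂(F), preserving y² + lm. -/
lemma sl2_smul_herm (p q r s : F) (h : p * s - q * r = 1) (a y l m : F) :
    S.sl2 p q r s h • S.herm a y l m = S.herm a ((p * s + q * r) * y + q * s * m - p * r * l)
      (p ^ 2 * l - 2 * p * q * y - q ^ 2 * m) (2 * r * s * y + s ^ 2 * m - r ^ 2 * l) := by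
  apply Subtype.ext
  have h' : algebraMap F E p * algebraMap F E s - algebraMap F E q * algebraMap F E r = 1 := by
    rw [← map_mul, ← map_mul, ← map_sub, h, map_one]
  rw [HermForm.coe_smul, coe_sl2, coe_sl2_inv, coe_herm, coe_herm, Matrix.mul_fin_two,
    Matrix.mul_fin_two]
  ext i j
  fin_cases i <;> fin_cases j <;> simp [map_ofNat]
  · linear_combination (algebraMap F E a) * h'
  · ring
  · ring
  · linear_combination (algebraMap F E a) * h'

/-- Completing the square: when m dominates, the unipotent element with integral entry −y/m kills y
and changes l to l + y²/m, still dominated by m. -/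
lemma exists_smul_eq_herm_aux (a y l m : F) (hm : m ≠ 0) (hy : ‖y‖ ≤ ‖m‖) (hl : ‖l‖ ≤ ‖m‖) :
    ∃ k ∈ ULattice (V2 ζ S.star_zeta), ∃ l' m', m' ≠ 0 ∧ ‖l'‖ ≤ ‖m'‖ ∧
      k • S.herm a y l m = S.herm a 0 l' m' := by
  have hx : ‖-y / m‖ ≤ 1 := by
    rw [norm_div, norm_neg]
    exact div_le_one_of_le₀ hy (norm_nonneg _)
  refine ⟨S.sl2 1 (-y / m) 0 1 (by ring), S.sl2_mem_ULattice (by simp) hx (by simp) (by simp),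
    l + y ^ 2 / m, m, hm, ?_, ?_⟩
  · refine (IsUltrametricDist.norm_add_le_max _ _).trans (max_le hl ?_)
    rw [norm_div, norm_pow, div_le_iff₀ (norm_pos_iff.2 hm), sq]
    gcongr
  · rw [S.sl2_smul_herm]
    congr 1 <;> field_simp <;> ring

/-- It suffices to move an entry of maximal norm to the lower left corner. If l is maximal, the Weyl
element swaps it there. If y is strictly larger than both others, a lower unipotent element produces
2y + m − l, of norm ‖y‖ because 2 is a unit. -/
lemma exists_smul_eq_herm (a y l m : F) (h : y ≠ 0 ∨ l ≠ 0 ∨ m ≠ 0) :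
    ∃ k ∈ ULattice (V2 ζ S.star_zeta), ∃ l' m', m' ≠ 0 ∧ ‖l'‖ ≤ ‖m'‖ ∧
      k • S.herm a y l m = S.herm a 0 l' m' := by
  have := S.isUltrametricDist
  have red : ∀ (k₀ : S.U2) (_ : k₀ ∈ ULattice (V2 ζ S.star_zeta)) (y₁ l₁ m₁ : F),
      k₀ • S.herm a y l m = S.herm a y₁ l₁ m₁ → m₁ ≠ 0 → ‖y₁‖ ≤ ‖m₁‖ → ‖l₁‖ ≤ ‖m₁‖ →
      ∃ k ∈ ULattice (V2 ζ S.star_zeta), ∃ l' m', m' ≠ 0 ∧ ‖l'‖ ≤ ‖m'‖ ∧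
        k • S.herm a y l m = S.herm a 0 l' m' := by
    intro k₀ hk₀ y₁ l₁ m₁ e hm hy hl
    obtain ⟨k, hk, l', m', h1, h2, h3⟩ := S.exists_smul_eq_herm_aux a y₁ l₁ m₁ hm hy hl
    have hkk : k * k₀ ∈ latticeStabilizer (V2 ζ S.star_zeta) := Subgroup.mul_mem _ hk hk₀
    exact ⟨k * k₀, hkk, l', m', h1, h2, by rw [mul_smul, e, h3]⟩
  rcases le_or_gt ‖y‖ (max ‖l‖ ‖m‖) with hy | hy
  · rcases le_total ‖l‖ ‖m‖ with hl | hl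
    · rw [max_eq_right hl] at hy
      refine S.exists_smul_eq_herm_aux a y l m ?_ hy hl
      rintro rfl
      simp only [norm_zero, norm_le_zero_iff] at hy hl
      simp [hy, hl] at h
    · rw [max_eq_left hl] at hy
      refine red (S.sl2 0 1 (-1) 0 (by ring))
        (S.sl2_mem_ULattice (by simp) (by simp) (by simp) (by simp)) _ _ _
        (S.sl2_smul_herm _ _ _ _ _ _ _ _ _) ?_ ?_ ?_
      · have : l ≠ 0 := by
          rintro rfl
          simp only [norm_zero, norm_le_zero_iff] at hy hl
          simp [hy, hl] at h
        simpa
      · simpa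
      · simpa
  · obtain ⟨hly, hmy⟩ := max_lt_iff.1 hy
    have hy0 : y ≠ 0 := by
      rintro rfl
      rw [norm_zero] at hly
      exact absurd hly (norm_nonneg _).not_gt
    have e : ‖2 * 1 * 1 * y + 1 ^ 2 * m - 1 ^ 2 * l‖ = ‖y‖ := by
      have h1 : ‖m - l‖ < ‖2 * y‖ := by
        rw [norm_mul, S.norm_two, one_mul, sub_eq_add_neg]
        exact (IsUltrametricDist.norm_add_le_max _ _).trans_lt (max_lt hmy (by rwa [norm_neg]))
      have h2 : 2 * 1 * 1 * y + 1 ^ 2 * m - 1 ^ 2 * l = 2 * y + (m - l) := by ring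
      rw [h2, IsUltrametricDist.norm_add_eq_max_of_norm_ne_norm h1.ne', max_eq_left h1.le,
        norm_mul, S.norm_two, one_mul]
    refine red (S.sl2 1 0 1 1 (by ring))
      (S.sl2_mem_ULattice (by simp) (by simp) (by simp) (by simp)) _ _ _
      (S.sl2_smul_herm _ _ _ _ _ _ _ _ _) ?_ ?_ ?_
    · rw [← norm_ne_zero_iff, e]
      exact norm_ne_zero_iff.2 hy0
    · rw [e]
      have h2 : (1 * 1 + 0 * 1) * y + 0 * 1 * m - 1 * 1 * l = y + -l := by ring
      rw [h2]
      refine (IsUltrametricDist.norm_add_le_max _ _).trans (max_le le_rfl ?_)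
      rw [norm_neg]
      exact hly.le
    · rw [e]
      have h2 : 1 ^ 2 * l - 2 * 1 * 0 * y - 0 ^ 2 * m = l := by ring
      rw [h2]
      exact hly.le

lemma det_herm (a y l m : F) : (S.herm a y l m).1.det =
    algebraMap F E a ^ 2 - (ζ : E) ^ 2 * algebraMap F E (y ^ 2 + l * m) := by
  rw [coe_herm, Matrix.det_fin_two_of]
  simp only [map_add, map_mul, map_pow]
  ring

end

end UnramifiedPair

end RelEndo

/-! ### The explicit value of the pushforward Φ -/

namespace RelEndo

lemma sum_Icc_toNat_add {M : Type*} [AddCommMonoid M] (f : ℕ → M) (i : ℤ) :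
    ∑ t ∈ Finset.Icc (-i) 0, f (t + i).toNat = ∑ k ∈ Finset.range (i + 1).toNat, f k := by
  refine Finset.sum_bij' (fun t _ => (t + i).toNat) (fun k _ => (k : ℤ) - i) ?_ ?_ ?_ ?_ ?_
  · intro t ht
    rw [Finset.mem_Icc] at ht
    rw [Finset.mem_range]
    lia
  · intro k hk
    rw [Finset.mem_range] at hk
    rw [Finset.mem_Icc]
    lia
  · intro t ht
    rw [Finset.mem_Icc] at ht
    lia
  · intro k hk
    simp
  · intro t _
    rfl

namespace UnramifiedPair

variable {F E : Type*} [NontriviallyNormedField F] [IsUltrametricDist F] [LocallyCompactSpace F]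
    [NormedField E] [NormedAlgebra F E] [StarRing E] {ϖ : F} {ζ : Eˣ}

section
variable (S : UnramifiedPair (E := E) ϖ ζ)

lemma coe_upper (x : F) (t : ℤ) : ((S.upper x t : GL (Fin 2) E) : Matrix (Fin 2) (Fin 2) E) =
    !![algebraMap F E (ϖ ^ t), algebraMap F E (x * ϖ ^ (-t)); algebraMap F E 0,
      algebraMap F E (ϖ ^ (-t))] := rfl

include S in
lemma norm_le_mul_zpow_neg_iff {r s : ℝ} {t : ℤ} :
    r * ‖ϖ‖ ^ (-t) ≤ s ↔ r ≤ s * ‖ϖ‖ ^ t := by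
  rw [zpow_neg, ← div_eq_mul_inv, div_le_iff₀ (zpow_pos S.unif_pos t)]

include S in
lemma norm_mul_zpow_le_one_iff {r : ℝ} {t : ℤ} : r * ‖ϖ‖ ^ t ≤ 1 ↔ r ≤ ‖ϖ‖ ^ (-t) := by
  rw [zpow_neg, ← one_div, le_div_iff₀ (zpow_pos S.unif_pos t)]

/-- As Q and 1 are integral and t ≤ 0, their contributions are already within the bounds, so only P
and m constrain x. The orthonormality of 1, ζ separates the terms 1 and ζ(m/2)x in the lower right
entry, and this is what forces t ≤ 0. -/
lemma isIntegral_mul_upper_iff {P Q : E} {m : F} {i : ℤ} (hQ : ‖Q‖ ≤ 1)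
    (hi : max ‖P‖ ‖m‖ = ‖ϖ‖ ^ i) (x : F) (t : ℤ) :
    IsIntegral (!![P, Q; ζ * algebraMap F E (m / 2), 1] *
      ((S.upper x t : GL (Fin 2) E) : Matrix (Fin 2) (Fin 2) E)) ↔
      t ∈ Finset.Icc (-i) 0 ∧ ‖x‖ ≤ ‖ϖ‖ ^ (t - i) := by
  have := S.isUltrametricDist
  have hp := S.unif_pos
  have hm2 : ‖m / 2‖ = ‖m‖ := by rw [norm_div, S.norm_two, div_one]
  rw [coe_upper, Matrix.mul_fin_two]
  have e1 : Q * algebraMap F E (ϖ ^ (-t)) + P * algebraMap F E (x * ϖ ^ (-t)) =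
      (Q + P * algebraMap F E x) * algebraMap F E (ϖ ^ (-t)) := by rw [map_mul]; ring
  have e2 : ζ * algebraMap F E (m / 2) * algebraMap F E (x * ϖ ^ (-t)) +
      1 * algebraMap F E (ϖ ^ (-t)) =
      (algebraMap F E 1 + ζ * algebraMap F E (m / 2 * x)) * algebraMap F E (ϖ ^ (-t)) := by
    simp only [map_mul, map_one]; ring
  rw [e2, add_comm (P * algebraMap F E (x * _)), e1]
  simp only [IsIntegral, Fin.forall_fin_two, Matrix.of_apply, Matrix.cons_val', Matrix.cons_val_zero,
    Matrix.cons_val_one, Matrix.cons_val_fin_one, map_zero, mul_zero, add_zero]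
  rw [norm_mul, norm_mul, norm_mul, norm_mul, norm_mul, S.norm_zeta, S.norm_add_zeta]
  simp only [norm_algebraMap', norm_zpow, one_mul, norm_one]
  rw [S.norm_le_mul_zpow_neg_iff, S.norm_le_mul_zpow_neg_iff, one_mul, S.norm_mul_zpow_le_one_iff,
    S.norm_mul_zpow_le_one_iff, max_le_iff, norm_mul, hm2, Finset.mem_Icc]
  have h1 : (1 : ℝ) ≤ ‖ϖ‖ ^ t ↔ t ≤ 0 := by
    rw [← zpow_zero ‖ϖ‖, S.zpow_le_zpow]
  have h2 : ‖x‖ ≤ ‖ϖ‖ ^ (t - i) ↔ ‖P‖ * ‖x‖ ≤ ‖ϖ‖ ^ t ∧ ‖m‖ * ‖x‖ ≤ ‖ϖ‖ ^ t := by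
    rw [← max_le_iff, ← max_mul_of_nonneg _ _ (norm_nonneg x), hi, zpow_sub₀ hp.ne',
      le_div_iff₀ (zpow_pos hp i), mul_comm]
  have h3 : -i ≤ t ↔ ‖P‖ ≤ ‖ϖ‖ ^ (-t) ∧ ‖m‖ ≤ ‖ϖ‖ ^ (-t) := by
    rw [← max_le_iff, hi, S.zpow_le_zpow]
    lia
  have h4 : t ≤ 0 → (‖Q + P * algebraMap F E x‖ ≤ ‖ϖ‖ ^ t ↔ ‖P‖ * ‖x‖ ≤ ‖ϖ‖ ^ t) := by
    intro ht
    have hQt : ‖Q‖ ≤ ‖ϖ‖ ^ t := hQ.trans (h1.2 ht)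
    rw [← norm_algebraMap' E x, ← norm_mul]
    constructor
    · intro h
      have : P * algebraMap F E x = (Q + P * algebraMap F E x) + -Q := by ring
      rw [this]
      exact (IsUltrametricDist.norm_add_le_max _ _).trans (max_le h (by rwa [norm_neg]))
    · intro h
      exact (IsUltrametricDist.norm_add_le_max _ _).trans (max_le hQt h)
  rw [h1, h2, h3]
  constructor
  · rintro ⟨⟨h5, h6⟩, h7, h8, h9⟩
    exact ⟨⟨⟨h5, h7⟩, h8⟩, (h4 h8).1 h6, h9⟩
  · rintro ⟨⟨⟨h5, h7⟩, h8⟩, h6, h9⟩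
    exact ⟨⟨h5, (h4 h8).2 h6⟩, h7, h8, h9⟩

lemma measure_isIntegral_mul (ν : Measure S.U2) [ν.IsHaarMeasure]
    (hν : ν (ULattice (V2 ζ S.star_zeta)) = 1) {P Q : E} {m : F} {i : ℤ} (hQ : ‖Q‖ ≤ 1)
    (hi : max ‖P‖ ‖m‖ = ‖ϖ‖ ^ i) :
    ν {g | IsIntegral (!![P, Q; ζ * algebraMap F E (m / 2), 1] *
      ((g : GL (Fin 2) E) : Matrix (Fin 2) (Fin 2) E))} =
      ∑ k ∈ Finset.range (i + 1).toNat, (resCard F : ℝ≥0∞) ^ k := by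
  have := S.isUltrametricDist
  rw [S.measure_eq_sum ν hν ?_ (Finset.Icc (-i) 0) (fun t => (t + i).toNat) ?_]
  · exact sum_Icc_toNat_add (fun k => (resCard F : ℝ≥0∞) ^ k) i
  · intro g hg k hk
    have : (((g * k : S.U2) : GL (Fin 2) E) : Matrix (Fin 2) (Fin 2) E) = g.1.1 * k.1.1 := rfl
    rw [Set.mem_ofPred_eq, this, ← mul_assoc]
    exact IsIntegral.mul hg hk.1
  · intro x t
    rw [Set.mem_ofPred_eq, S.isIntegral_mul_upper_iff hQ hi]
    refine and_congr_right fun ht => ?_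
    rw [Finset.mem_Icc] at ht
    have : 2 * t - ((t + i).toNat : ℤ) = t - i := by lia
    rw [this]

open Classical in
/-- The value of `r_! 1_{End(Λ)}` at a regular element, with the parameter `N` large. -/
noncomputable def phiValue (ϖ : F) (N : ℕ) (A : Matrix (Fin 2) (Fin 2) E) : ℂ :=
  if ∃ z : E, z * star z = A.det then
    ∑ k ∈ Finset.range N, if ∀ i j, ‖A i j‖ ≤ ‖ϖ‖ ^ k then (resCard F : ℂ) ^ k else 0
  else 0

/-- An explicit preimage under the contraction map; its determinant is −D, which explains the norm
condition on det δ. -/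
lemma mul_adj_herm {a l m : F} (hm : m ≠ 0) {D : E}
    (hD : D * star D = algebraMap F E a ^ 2 - (ζ : E) ^ 2 * algebraMap F E (l * m)) :
    !![(algebraMap F E a - D) / 2, (algebraMap F E a + D) / (ζ * algebraMap F E m);
        ζ * algebraMap F E (m / 2), 1] *
      (V2 ζ S.star_zeta).adj
        !![(algebraMap F E a - D) / 2, (algebraMap F E a + D) / (ζ * algebraMap F E m);
        ζ * algebraMap F E (m / 2), 1] = (S.herm a 0 l m).1 := by
  have h2 := S.two_ne_zero'
  have hz : (ζ : E) ≠ 0 := ζ.ne_zero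
  have hm' : algebraMap F E m ≠ 0 := by simpa
  rw [V2_adj, coe_herm]
  simp only [Matrix.of_apply, Matrix.cons_val', Matrix.cons_val_zero,
    Matrix.cons_val_one, Matrix.cons_val_fin_one, star_div₀, star_sub, star_add, star_mul',
    S.star_coe, S.star_zeta, star_one, star_ofNat, Matrix.mul_fin_two, map_div₀, map_ofNat, map_zero]
  rw [map_mul] at hD
  ext i j
  fin_cases i <;> fin_cases j <;> simp <;> field_simp
  · ring
  · linear_combination (-2) * hD
  · ring
  · ring

include S in
lemma sum_range_ite_norm_le {c : ℝ} {i : ℤ} (hc : c = ‖ϖ‖ ^ i) {N : ℕ} (hN : i < N)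
    (f : ℕ → ℂ) : ∑ k ∈ Finset.range N, (if c ≤ ‖ϖ‖ ^ k then f k else 0) =
      ∑ k ∈ Finset.range (i + 1).toNat, f k := by
  rw [← Finset.sum_filter]
  congr 1
  ext k
  rw [Finset.mem_filter, Finset.mem_range, Finset.mem_range, hc, ← zpow_natCast, S.zpow_le_zpow]
  lia

lemma forall_norm_herm_le_iff {a y l m : F} {c : ℝ} :
    (∀ i j, ‖(S.herm a y l m).1 i j‖ ≤ c) ↔ ‖a‖ ≤ c ∧ ‖y‖ ≤ c ∧ ‖l‖ ≤ c ∧ ‖m‖ ≤ c := by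
  have e : algebraMap F E a - ζ * algebraMap F E y =
      algebraMap F E a + ζ * algebraMap F E (-y) := by rw [map_neg]; ring
  simp only [coe_herm, e, Fin.forall_fin_two, Matrix.of_apply, Matrix.cons_val',
    Matrix.cons_val_zero, Matrix.cons_val_one, Matrix.cons_val_fin_one, S.norm_add_zeta, norm_mul,
    S.norm_zeta, one_mul, norm_algebraMap', norm_neg, max_le_iff]
  tauto

/-- With ϖ^i generating the ideal of the entries of δ, the preimage X is arranged so that the volume
formula of `measure_isIntegral_mul` applies with this i. It yields 1 + q + ... + q^i, and the
exponents are exactly the k with ϖ^k dividing δ. -/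
lemma Phi_herm_zero (ν : Measure S.U2) [ν.IsHaarMeasure]
    (hν : ν (ULattice (V2 ζ S.star_zeta)) = 1) {a l m : F} (hm : m ≠ 0) (hlm : ‖l‖ ≤ ‖m‖)
    {N : ℕ} (hN : ‖ϖ‖ ^ (2 * N) < ‖(S.herm a 0 l m).1.det‖) :
    Phi ν (S.herm a 0 l m) = phiValue ϖ N (S.herm a 0 l m).1 := by
  have := S.isUltrametricDist
  have hp := S.unif_pos
  set δ := S.herm a 0 l m with hδ
  have hdet : δ.1.det = algebraMap F E a ^ 2 - (ζ : E) ^ 2 * algebraMap F E (l * m) := by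
    rw [hδ, det_herm]; simp
  have hdet0 : δ.1.det ≠ 0 := by
    rw [← norm_ne_zero_iff]
    exact ((pow_pos hp _).trans hN).ne'
  have h2 := S.two_ne_zero'
  have hz : (ζ : E) ≠ 0 := ζ.ne_zero
  have hm' : algebraMap F E m ≠ 0 := by simpa
  have hm0 := norm_pos_iff.2 hm
  have hmax0 : (max ‖a‖ ‖m‖) ≠ 0 := (hm0.trans_le (le_max_right _ _)).ne'
  obtain ⟨i, hi⟩ : ∃ i : ℤ, max ‖a‖ ‖m‖ = ‖ϖ‖ ^ i := by
    rcases le_total ‖a‖ ‖m‖ with h | h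
    · rw [max_eq_right h]; exact S.exists_zpow hm
    · rw [max_eq_left h]
      exact S.exists_zpow (norm_pos_iff.1 (hm0.trans_le h))
  -- Since ϖ^(2i) divides det δ, the hypothesis on N ensures that truncating the sum at N loses no
  -- term.
  have hiN : i < N := by
    have h1 : ‖δ.1.det‖ ≤ ‖ϖ‖ ^ (2 * i) := by
      have h3 : ‖a‖ ≤ ‖ϖ‖ ^ i := hi ▸ le_max_left _ _
      have h4 : ‖m‖ ≤ ‖ϖ‖ ^ i := hi ▸ le_max_right _ _
      rw [hdet, sub_eq_add_neg, two_mul, zpow_add₀ hp.ne']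
      refine (IsUltrametricDist.norm_add_le_max _ _).trans (max_le ?_ ?_)
      · rw [norm_pow, norm_algebraMap', sq]
        gcongr
      · rw [norm_neg, norm_mul, norm_pow, S.norm_zeta, norm_algebraMap', one_pow, one_mul, norm_mul]
        have := hlm.trans h4
        gcongr
    have h5 := hN.trans_le h1
    rw [← zpow_natCast, ← not_le, S.zpow_le_zpow] at h5
    push_cast at h5
    lia
  have hforall : ∀ k : ℕ, (∀ i j, ‖δ.1 i j‖ ≤ ‖ϖ‖ ^ k) ↔ max ‖a‖ ‖m‖ ≤ ‖ϖ‖ ^ k := by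
    intro k
    rw [hδ, S.forall_norm_herm_le_iff, max_le_iff, norm_zero]
    exact ⟨fun h => ⟨h.1, h.2.2.2⟩, fun h => ⟨h.1, by positivity, hlm.trans h.2, h.2⟩⟩
  rw [phiValue]
  split_ifs with hnorm
  · have hD : ∃ D : E, D * star D = δ.1.det ∧
        ‖(algebraMap F E a + D) / (ζ * algebraMap F E m)‖ ≤ 1 ∧
        max ‖(algebraMap F E a - D) / 2‖ ‖m‖ = ‖ϖ‖ ^ i := by
      -- If ‖a‖ ≤ ‖m‖, every D of norm det δ satisfies ‖D‖ ≤ ‖m‖ and works. Otherwise D must nearly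
      -- cancel a, and it is taken to be −as, where s is the square root close to 1 of 1 − ζ²lm/a².
      rcases le_or_gt ‖a‖ ‖m‖ with ham | ham
      · obtain ⟨D, hD⟩ := hnorm
        have hDm : ‖D‖ ≤ ‖m‖ := by
          have h3 : ‖D‖ * ‖D‖ ≤ ‖m‖ * ‖m‖ := by
            have : ‖D‖ * ‖D‖ = ‖δ.1.det‖ := by rw [← hD, norm_mul, S.norm_star]
            rw [this, hdet, sub_eq_add_neg]
            refine (IsUltrametricDist.norm_add_le_max _ _).trans (max_le ?_ ?_)
            · rw [norm_pow, norm_algebraMap', sq]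
              gcongr
            · rw [norm_neg, norm_mul, norm_pow, S.norm_zeta, norm_algebraMap', one_pow, one_mul,
                norm_mul]
              gcongr
          exact abs_le_of_sq_le_sq' (by nlinarith) (norm_nonneg _) |>.2
        refine ⟨D, hD, ?_, ?_⟩
        · rw [norm_div, norm_mul, S.norm_zeta, one_mul, norm_algebraMap']
          refine div_le_one_of_le₀ ?_ (norm_nonneg _)
          exact (IsUltrametricDist.norm_add_le_max _ _).trans
            (max_le (by rwa [norm_algebraMap']) hDm)
        · rw [← hi, max_eq_right ham, max_eq_right]
          rw [norm_div, S.norm_two', div_one, sub_eq_add_neg]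
          exact (IsUltrametricDist.norm_add_le_max _ _).trans
            (max_le (by rwa [norm_algebraMap']) (by rwa [norm_neg]))
      · have ha0 : a ≠ 0 := norm_pos_iff.1 (hm0.trans ham)
        have ha0' : algebraMap F E a ≠ 0 := by simpa
        obtain ⟨d, hd⟩ := S.exists_zeta_sq
        have hdn : ‖d‖ = 1 := by
          rw [← norm_algebraMap' E d, hd, norm_pow, S.norm_zeta, one_pow]
        have hlma : ‖l * m‖ < ‖a‖ * ‖a‖ := by
          rw [norm_mul]
          exact mul_lt_mul'' (hlm.trans_lt ham) ham (norm_nonneg _) (norm_nonneg _)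
        obtain ⟨s, hs, hs1⟩ := S.exists_sq (t := 1 - d * (l * m) / (a * a)) (by
          rw [sub_sub_cancel_left, norm_neg, norm_div, norm_mul d, hdn, one_mul, norm_mul a,
            div_lt_one (by positivity)]
          exact hlma)
        have hs2 : ‖1 + s‖ = 1 := by
          have h3 : 1 + s = 2 + (s - 1) := by ring
          have h4 : ‖s - 1‖ < ‖(2 : F)‖ := by rwa [S.norm_two]
          rw [h3, IsUltrametricDist.norm_add_eq_max_of_norm_ne_norm h4.ne', max_eq_left h4.le,
            S.norm_two]
        have hs' : (a * s) ^ 2 = a ^ 2 - d * (l * m) := by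
          rw [mul_pow, hs]
          field_simp
        have hs0 : 1 + s ≠ 0 := norm_ne_zero_iff.1 (by rw [hs2]; norm_num)
        refine ⟨-algebraMap F E (a * s), ?_, ?_, ?_⟩
        · rw [star_neg, S.star_coe, hdet, ← hd, neg_mul_neg, ← map_mul, ← sq, hs']
          simp
        · have h5 : algebraMap F E a + -algebraMap F E (a * s) =
              algebraMap F E (d * (l * m) / (a * (1 + s))) := by
            rw [← map_neg, ← map_add]
            congr 1
            field_simp
            linear_combination -hs'
          rw [h5, norm_div, norm_algebraMap', norm_mul (ζ : E), S.norm_zeta, norm_algebraMap',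
            one_mul, norm_div, norm_mul d, hdn, one_mul, norm_mul, norm_mul, hs2, mul_one]
          refine div_le_one_of_le₀ ?_ (norm_nonneg _)
          rw [div_le_iff₀ (norm_pos_iff.2 ha0), mul_comm]
          exact mul_le_mul_of_nonneg_left (hlm.trans ham.le) (norm_nonneg _)
        · have h5 : algebraMap F E a - -algebraMap F E (a * s) = algebraMap F E (a * (1 + s)) := by
            rw [← map_neg, ← map_sub]
            congr 1
            ring
          rw [h5, norm_div, S.norm_two', div_one, norm_algebraMap', norm_mul, hs2, mul_one, hi]
    obtain ⟨D, hD, hQ, hP⟩ := hD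
    rw [hdet] at hD
    have hX := S.mul_adj_herm hm hD
    have hXdet : (!![(algebraMap F E a - D) / 2, (algebraMap F E a + D) / (ζ * algebraMap F E m);
        ζ * algebraMap F E (m / 2), 1]).det ≠ 0 := by
      intro h0
      have := congrArg Matrix.det hX
      rw [Matrix.det_mul, h0, zero_mul] at this
      exact hdet0 this.symm
    rw [S.Phi_eq ν (Matrix.GeneralLinearGroup.mkOfDetNeZero _ hXdet) hX]
    change ((ν {g | IsIntegral (!![(algebraMap F E a - D) / 2,
      (algebraMap F E a + D) / (ζ * algebraMap F E m); ζ * algebraMap F E (m / 2), 1] *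
      ((g : GL (Fin 2) E) : Matrix (Fin 2) (Fin 2) E))}).toReal : ℂ) = _
    rw [S.measure_isIntegral_mul ν hν hQ hP]
    simp only [hforall]
    rw [S.sum_range_ite_norm_le hi hiN, ENNReal.toReal_sum (by simp)]
    simp
  · refine Phi_eq_zero ν ?_
    rintro ⟨X, hX⟩
    refine hnorm ⟨(X : Matrix (Fin 2) (Fin 2) E).det, ?_⟩
    rw [← hX, Matrix.det_mul, V2_adj, Matrix.det_fin_two_of, Matrix.det_fin_two]
    simp only [star_sub, star_mul']
    ring

lemma Phi_herm (ν : Measure S.U2) [ν.IsHaarMeasure]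
    (hν : ν (ULattice (V2 ζ S.star_zeta)) = 1) {a y l m : F} (h : y ≠ 0 ∨ l ≠ 0 ∨ m ≠ 0)
    {N : ℕ} (hN : ‖ϖ‖ ^ (2 * N) < ‖(S.herm a y l m).1.det‖) :
    Phi ν (S.herm a y l m) = phiValue ϖ N (S.herm a y l m).1 := by
  have := S.isUltrametricDist
  obtain ⟨k, hk, l', m', hm', hlm, e⟩ := S.exists_smul_eq_herm a y l m h
  have hd := det_smul k (S.herm a y l m)
  rw [← S.Phi_smul ν _ hk, e, S.Phi_herm_zero ν hν hm' hlm (by rwa [← e, hd]), ← e, phiValue,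
    phiValue, hd]
  congr 1
  refine Finset.sum_congr rfl fun n _ => ?_
  simp only [forall_norm_smul_le_iff hk _ (pow_nonneg (norm_nonneg ϖ) n)]

end

end UnramifiedPair

end RelEndo

namespace RelEndo

/-! ### Orbital integrals of the pushforward -/

namespace UnramifiedPair

variable {F E : Type*} [NontriviallyNormedField F] [IsUltrametricDist F] [LocallyCompactSpace F]
    [NormedField E] [NormedAlgebra F E] [StarRing E] {ϖ : F} {ζ : Eˣ}

section
variable (S : UnramifiedPair (E := E) ϖ ζ)

include S in
lemma continuous_smul_apply {ι : Type*} [Fintype ι] [DecidableEq ι] {H : HermForm E ι}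
    (δ : H.Herm) (i j : ι) : Continuous fun g : H.U => (g • δ).1 i j := by
  simp only [HermForm.coe_smul, Matrix.mul_apply]
  refine continuous_finsetSum _ fun k _ => Continuous.mul ?_ ?_
  · exact continuous_finsetSum _ fun n _ => (S.continuous_U_apply H i n).mul continuous_const
  · exact (S.continuous_U_apply H k j).comp continuous_inv

include S in
lemma isClosed_stabilizer {ι : Type*} [Fintype ι] [DecidableEq ι] {H : HermForm E ι}
    (δ : H.Herm) : IsClosed (MulAction.stabilizer H.U δ : Set H.U) := by
  have : (MulAction.stabilizer H.U δ : Set H.U) = ⋂ i, ⋂ j, {g | (g • δ).1 i j = δ.1 i j} := by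
    ext g
    simp only [SetLike.mem_coe, MulAction.mem_stabilizer_iff, Set.mem_iInter, Set.mem_ofPred_eq]
    exact ⟨fun h i j => by rw [h], fun h => Subtype.ext (Matrix.ext h)⟩
  rw [this]
  exact isClosed_iInter fun i => isClosed_iInter fun j =>
    isClosed_eq (S.continuous_smul_apply δ i j) continuous_const

include S in
lemma norm_eq_one_of_mul_star {z : E} (h : z * star z = 1) : ‖z‖ = 1 := by
  have := congrArg norm h
  rw [norm_mul, S.norm_star, norm_one] at this
  nlinarith [norm_nonneg z]

/-- The stabilizer is the torus of pairs of norm-one elements. An element commuting with δ is p +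
(r/(ζm))(δ − a), with eigenvalues p ± w; unitarity makes both of norm 1, which bounds p and w and
hence all entries. The inverse is the adjoint, so it is bounded as well. -/
lemma isCompact_stabilizer_herm {a l m b : F} (hb : b ≠ 0)
    (hlm : algebraMap F E (l * m) * (ζ : E) ^ 2 = algebraMap F E (b ^ 2)) :
    IsCompact (MulAction.stabilizer S.U2 (S.herm a 0 l m) : Set S.U2) := by
  have := S.isUltrametricDist
  have hb' : algebraMap F E b ≠ 0 := by simpa
  have hz : (ζ : E) ≠ 0 := ζ.ne_zero
  have hlm0 : algebraMap F E (l * m) ≠ 0 := by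
    intro h
    rw [h, zero_mul, map_pow] at hlm
    exact pow_ne_zero 2 hb' hlm.symm
  rw [map_mul] at hlm0 hlm
  rw [map_pow] at hlm
  have hl' := left_ne_zero_of_mul hlm0
  have hm' := right_ne_zero_of_mul hlm0
  set C : ℝ := max 1 (max ‖m / b‖ ‖l / b‖) with hC
  refine (S.isCompact_bounded_U _ C).of_isClosed_subset (S.isClosed_stabilizer _) ?_
  intro g hg
  rw [SetLike.mem_coe, MulAction.mem_stabilizer_iff] at hg
  obtain ⟨h1, h2, h3⟩ := V2_mem_U_iff.1 g.2
  set A : Matrix (Fin 2) (Fin 2) E := g.1.1 with hA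
  have hcomm : A * (S.herm a 0 l m).1 = (S.herm a 0 l m).1 * A := by
    have h4 := congrArg Subtype.val hg
    rw [HermForm.coe_smul] at h4
    calc _ = A * (S.herm a 0 l m).1 * ((g.1⁻¹ : GL (Fin 2) E) : Matrix (Fin 2) (Fin 2) E) * A := by
          rw [mul_assoc _ _ A, hA, Units.inv_mul, mul_one]
      _ = _ := by rw [h4]
  rw [coe_herm, Matrix.eta_fin_two A, Matrix.mul_fin_two, Matrix.mul_fin_two,
    ← Matrix.ext_iff] at hcomm
  simp [Fin.forall_fin_two] at hcomm
  change star (A 0 0) * A 1 0 = star (A 1 0) * A 0 0 at h1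
  change star (A 0 0) * A 1 1 - star (A 1 0) * A 0 1 = 1 at h2
  have hps : A 1 1 = A 0 0 := by
    have h4 := hcomm.1.2
    have h5 : ζ * algebraMap F E l ≠ 0 := mul_ne_zero hz hl'
    refine mul_left_cancel₀ h5 ?_
    linear_combination -h4
  have hq : A 0 1 = algebraMap F E l * A 1 0 / algebraMap F E m := by
    rw [eq_div_iff hm']
    refine mul_left_cancel₀ hz ?_
    linear_combination hcomm.1.1
  set w : E := A 1 0 * algebraMap F E b / (ζ * algebraMap F E m) with hw
  have hws : star w = -(star (A 1 0) * algebraMap F E b / (ζ * algebraMap F E m)) := by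
    rw [hw, star_div₀, star_mul', star_mul', S.star_coe, S.star_coe, S.star_zeta, neg_mul, div_neg]
  have e1 : star (A 0 0) * w + A 0 0 * star w = 0 := by
    rw [hws, hw]
    field_simp
    linear_combination (algebraMap F E b) * h1
  have e2 : A 0 0 * star (A 0 0) + w * star w = 1 := by
    rw [← h2, hps, hws, hw, hq]
    field_simp
    linear_combination (A 1 0 * star (A 1 0)) * hlm
  have n1 : ‖A 0 0 + w‖ = 1 := S.norm_eq_one_of_mul_star (by
    rw [star_add]; linear_combination e1 + e2)
  have n2 : ‖A 0 0 - w‖ = 1 := S.norm_eq_one_of_mul_star (by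
    rw [star_sub]; linear_combination -e1 + e2)
  have np : ‖A 0 0‖ ≤ 1 := by
    have h4 : 2 * A 0 0 = (A 0 0 + w) + (A 0 0 - w) := by ring
    rw [← one_mul ‖A 0 0‖, ← S.norm_two', ← norm_mul, h4]
    exact (IsUltrametricDist.norm_add_le_max _ _).trans (by rw [n1, n2, max_self, S.norm_two'])
  have nw : ‖w‖ ≤ 1 := by
    have h4 : 2 * w = (A 0 0 + w) + -(A 0 0 - w) := by ring
    rw [← one_mul ‖w‖, ← S.norm_two', ← norm_mul, h4]
    exact (IsUltrametricDist.norm_add_le_max _ _).trans (by rw [norm_neg, n1, n2, max_self, S.norm_two'])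
  have nr : ‖A 1 0‖ ≤ ‖m / b‖ := by
    have h4 : A 1 0 = w * ζ * algebraMap F E (m / b) := by
      rw [hw, map_div₀]
      field_simp
    rw [h4, norm_mul, norm_mul, S.norm_zeta, mul_one, norm_algebraMap']
    exact mul_le_of_le_one_left (norm_nonneg _) nw
  have nq : ‖A 0 1‖ ≤ ‖l / b‖ := by
    have h4 : A 0 1 = w * ζ * algebraMap F E (l / b) := by
      rw [hq, hw, map_div₀]
      field_simp
    rw [h4, norm_mul, norm_mul, S.norm_zeta, mul_one, norm_algebraMap']
    exact mul_le_of_le_one_left (norm_nonneg _) nw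
  have b00 : ‖A 0 0‖ ≤ C := np.trans (le_max_left _ _)
  have b01 : ‖A 0 1‖ ≤ C := nq.trans ((le_max_right _ _).trans (le_max_right _ _))
  have b10 : ‖A 1 0‖ ≤ C := nr.trans ((le_max_left _ _).trans (le_max_right _ _))
  have b11 : ‖A 1 1‖ ≤ C := by rwa [hps]
  refine ⟨fun i j => ?_, fun i j => ?_⟩
  · fin_cases i <;> fin_cases j <;> assumption
  · rw [HermForm.coe_inv, V2_adj]
    fin_cases i <;> fin_cases j <;> simp [S.norm_star] <;> assumption

lemma upper_inv_smul_herm (x : F) (t : ℤ) (a l m : F) :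
    (S.upper x t)⁻¹ • S.herm a 0 l m =
      S.herm a (-(x * m)) (ϖ ^ (-(2 * t)) * (l - x ^ 2 * m)) (ϖ ^ (2 * t) * m) := by
  have h0 := S.unif.1
  have hdet : ϖ ^ (-t) * ϖ ^ t - -(x * ϖ ^ (-t)) * 0 = 1 := by
    rw [← zpow_add₀ h0]; simp
  have e : (S.upper x t)⁻¹ = S.sl2 (ϖ ^ (-t)) (-(x * ϖ ^ (-t))) 0 (ϖ ^ t) hdet := by
    apply Subtype.ext
    apply Units.ext
    have : ((((S.upper x t)⁻¹ : S.U2) : GL (Fin 2) E) : Matrix (Fin 2) (Fin 2) E) =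
      (((S.upper x t : GL (Fin 2) E)⁻¹ : GL (Fin 2) E) : Matrix (Fin 2) (Fin 2) E) := rfl
    rw [this, upper, coe_sl2_inv, coe_sl2]
    simp
  have e1 : ϖ ^ (-t) * ϖ ^ t = 1 := by rw [← zpow_add₀ h0]; simp
  have e2 : ϖ ^ (2 * t) = (ϖ ^ t) ^ 2 := by rw [two_mul, zpow_add₀ h0, sq]
  have e3 : ϖ ^ (-(2 * t)) = (ϖ ^ (-t)) ^ 2 := by rw [sq, ← zpow_add₀ h0]; congr 1; ring
  rw [e, S.sl2_smul_herm, e2, e3]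
  congr 1
  · linear_combination (-x * m) * e1
  · ring
  · ring

/-- The elements `g` of `U(V₂)` such that `g⁻¹ δ g` is divisible by `ϖ ^ k`. -/
def divisibleSet (ϖ : F) {ι : Type*} [Fintype ι] [DecidableEq ι] {H : HermForm E ι}
    (δ : H.Herm) (k : ℤ) : Set H.U :=
  {g | ∀ i j, ‖(g⁻¹ • δ).1 i j‖ ≤ ‖ϖ‖ ^ k}

include S in
lemma measurableSet_divisibleSet {ι : Type*} [Fintype ι] [DecidableEq ι] {H : HermForm E ι}
    (δ : H.Herm) (k : ℤ) : MeasurableSet (divisibleSet ϖ δ k) := by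
  have : divisibleSet ϖ δ k = ⋂ i, ⋂ j, {g : H.U | ‖(g⁻¹ • δ).1 i j‖ ≤ ‖ϖ‖ ^ k} := by
    ext g
    simp [divisibleSet]
  rw [this]
  refine (isClosed_iInter fun i => isClosed_iInter fun j => ?_).measurableSet
  exact isClosed_le
    (continuous_norm.comp ((S.continuous_smul_apply δ i j).comp continuous_inv)) continuous_const

include S in
-- Multiplied by ζ², the quantity (l − x²m)m becomes b² − ζ²(xm)² = (b + ζxm)(b − ζxm). Both factors
-- have norm max(‖b‖, ‖xm‖), so there is no cancellation between l and x²m.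
lemma norm_sub_sq_mul {l m b x : F}
    (hlm : algebraMap F E (l * m) * (ζ : E) ^ 2 = algebraMap F E (b ^ 2)) :
    ‖l - x ^ 2 * m‖ * ‖m‖ = max ‖b‖ ‖x * m‖ ^ 2 := by
  have h1 : algebraMap F E ((l - x ^ 2 * m) * m) * (ζ : E) ^ 2 =
      (algebraMap F E b + ζ * algebraMap F E (x * m)) *
        (algebraMap F E b + ζ * algebraMap F E (-(x * m))) := by
    rw [map_pow] at hlm
    simp only [map_mul, map_sub, map_pow, map_neg] at hlm ⊢
    linear_combination hlm
  have h2 := congrArg norm h1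
  rw [norm_mul, norm_mul, S.norm_add_zeta, S.norm_add_zeta, norm_algebraMap', norm_pow,
    S.norm_zeta, one_pow, mul_one, norm_mul, norm_neg] at h2
  rw [h2, sq]

/-- Put j = 2t + e − k, the valuation of the lower left entry after division by ϖ^k. The lower left
entry gives j ≥ 0, the upper right one gives j ≤ 2(B − k) and the bound on x; the condition on the
diagonal then follows. -/
lemma upper_mem_divisibleSet_iff {a l m b : F} {e B k : ℤ} (hm : ‖m‖ = ‖ϖ‖ ^ e)
    (hB : ‖b‖ = ‖ϖ‖ ^ B)
    (hlm : algebraMap F E (l * m) * (ζ : E) ^ 2 = algebraMap F E (b ^ 2))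
    (ha : ‖a‖ ≤ ‖ϖ‖ ^ k) (x : F) (t : ℤ) :
    S.upper x t ∈ divisibleSet ϖ (S.herm a 0 l m) k ↔
      (0 ≤ 2 * t + e - k ∧ 2 * t + e - k ≤ 2 * (B - k)) ∧
        ‖x‖ ≤ ‖ϖ‖ ^ (2 * t - (2 * t + e - k) / 2) := by
  have hp := S.unif_pos
  have hm0 : m ≠ 0 := norm_pos_iff.1 (by rw [hm]; positivity)
  have hmem : S.upper x t ∈ divisibleSet ϖ (S.herm a 0 l m) k ↔
      ∀ i j, ‖((S.upper x t)⁻¹ • S.herm a 0 l m).1 i j‖ ≤ ‖ϖ‖ ^ k := Iff.rfl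
  rw [hmem, upper_inv_smul_herm, forall_norm_herm_le_iff, norm_neg, norm_mul (ϖ ^ _),
    norm_mul (ϖ ^ _), norm_zpow, norm_zpow, hm, ← zpow_add₀ hp.ne', S.zpow_le_zpow]
  have h1 : ‖ϖ‖ ^ (-(2 * t)) * ‖l - x ^ 2 * m‖ ≤ ‖ϖ‖ ^ k ↔
      max ‖b‖ ‖x * m‖ ^ 2 ≤ ‖ϖ‖ ^ (k + 2 * t + e) := by
    rw [mul_comm, S.norm_le_mul_zpow_neg_iff, ← zpow_add₀ hp.ne', ← S.norm_sub_sq_mul hlm, hm,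
      zpow_add₀ hp.ne' _ e, mul_le_mul_iff_left₀ (zpow_pos hp e)]
  have h2 : max ‖b‖ ‖x * m‖ ^ 2 ≤ ‖ϖ‖ ^ (k + 2 * t + e) ↔
      k + 2 * t + e ≤ 2 * B ∧ ‖x * m‖ ^ 2 ≤ ‖ϖ‖ ^ (k + 2 * t + e) := by
    have h3 : k + 2 * t + e ≤ 2 * B ↔ ‖b‖ ^ 2 ≤ ‖ϖ‖ ^ (k + 2 * t + e) := by
      rw [hB, ← zpow_natCast, ← zpow_mul, S.zpow_le_zpow]
      push_cast
      rw [mul_comm B 2]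
    rw [h3]
    rcases le_total ‖b‖ ‖x * m‖ with h | h
    · rw [max_eq_right h]
      exact ⟨fun h' => ⟨(pow_le_pow_left₀ (norm_nonneg _) h 2).trans h', h'⟩, fun h' => h'.2⟩
    · rw [max_eq_left h]
      exact ⟨fun h' => ⟨h', (pow_le_pow_left₀ (norm_nonneg _) h 2).trans h'⟩, fun h' => h'.1⟩
  rw [h1, h2]
  rcases eq_or_ne x 0 with rfl | hx
  · simp only [zero_mul, norm_zero, ne_eq, OfNat.ofNat_ne_zero, not_false_eq_true, zero_pow]
    have h4 : ∀ n : ℤ, (0 : ℝ) ≤ ‖ϖ‖ ^ n := fun n => by positivity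
    simp only [h4, ha, and_true, true_and]
    lia
  · obtain ⟨v, hv⟩ := S.exists_zpow hx
    rw [norm_mul, hv, hm, ← zpow_add₀ hp.ne', ← zpow_natCast, ← zpow_mul, S.zpow_le_zpow,
      S.zpow_le_zpow, S.zpow_le_zpow]
    simp only [ha, true_and]
    push_cast
    lia

lemma mul_mem_divisibleSet [IsUltrametricDist E] {ι : Type*} [Fintype ι] [DecidableEq ι]
    {H : HermForm E ι} {δ : H.Herm} {k : ℤ} {g h : H.U} (hg : g ∈ divisibleSet ϖ δ k)
    (hh : h ∈ ULattice H) : g * h ∈ divisibleSet ϖ δ k := by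
  have e : (g * h)⁻¹ • δ = h⁻¹ • g⁻¹ • δ := by rw [mul_inv_rev, mul_smul]
  have hk : h⁻¹ ∈ latticeStabilizer H := Subgroup.inv_mem _ hh
  have := forall_norm_smul_le hk (g⁻¹ • δ) (zpow_nonneg (norm_nonneg ϖ) k) hg
  rwa [← e] at this

/-- The value of t with j = 2t + e − k contributes q^⌊j/2⌋. As j has the fixed parity of e − k, the
exponent i = ⌊j/2⌋ runs up to B − k if j is even and up to B − k − 1 if j is odd. This parity effect
is the source of the difference between the two rational classes. -/
lemma measure_divisibleSet (ν : Measure S.U2) [ν.IsHaarMeasure]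
    (hν : ν (ULattice (V2 ζ S.star_zeta)) = 1) {a l m b : F} {e B k : ℤ} (hm : ‖m‖ = ‖ϖ‖ ^ e)
    (hB : ‖b‖ = ‖ϖ‖ ^ B)
    (hlm : algebraMap F E (l * m) * (ζ : E) ^ 2 = algebraMap F E (b ^ 2))
    (ha : ‖a‖ ≤ ‖ϖ‖ ^ k) : ν (divisibleSet ϖ (S.herm a 0 l m) k) =
      ∑ i ∈ Finset.range (B - k + 1 - (e - k) % 2).toNat, (resCard F : ℝ≥0∞) ^ i := by
  have := S.isUltrametricDist
  have hI : ∀ t : ℤ, t ∈ Finset.Icc ((k - e + 1) / 2) ((2 * B - k - e) / 2) ↔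
      (0 ≤ 2 * t + e - k ∧ 2 * t + e - k ≤ 2 * (B - k)) := by
    intro t
    rw [Finset.mem_Icc]
    lia
  rw [S.measure_eq_sum ν hν (fun g hg k hk => mul_mem_divisibleSet hg hk) (Finset.Icc ((k - e + 1) / 2) ((2 * B - k - e) / 2))
    (fun t => ((2 * t + e - k) / 2).toNat)]
  · refine Finset.sum_bij' (fun t _ => ((2 * t + e - k) / 2).toNat)
      -- Inverse to i = ⌊(2t + e − k)/2⌋ = t + ⌊(e − k)/2⌋.
      (fun i _ => (i : ℤ) - (e - k) / 2) ?_ ?_ ?_ ?_ ?_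
    · intro t ht
      rw [hI] at ht
      rw [Finset.mem_range]
      lia
    · intro i hi
      rw [Finset.mem_range] at hi
      rw [hI]
      lia
    · intro t ht
      rw [hI] at ht
      lia
    · intro i hi
      lia
    · intro t _
      rfl
  · intro x t
    rw [S.upper_mem_divisibleSet_iff hm hB hlm ha, hI]
    refine and_congr_right fun ht => ?_
    rw [Int.toNat_of_nonneg (by lia)]

/-- Conjugation by the upper triangular representatives fixes the scalar part a, so no conjugate is
divisible by ϖ^k unless a is. -/
lemma divisibleSet_eq_empty {a l m : F} {k : ℤ} (ha : ¬ ‖a‖ ≤ ‖ϖ‖ ^ k) :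
    divisibleSet ϖ (S.herm a 0 l m) k = ∅ := by
  have := S.isUltrametricDist
  rw [Set.eq_empty_iff_forall_notMem]
  intro g hg
  obtain ⟨x, t, hx⟩ := S.exists_upper_inv_mul_mem g
  have h1 : ((S.upper x t)⁻¹ * g)⁻¹ ∈ latticeStabilizer (V2 ζ S.star_zeta) :=
    Subgroup.inv_mem _ hx
  have h2 := mul_mem_divisibleSet hg h1
  have h3 : g * ((S.upper x t)⁻¹ * g)⁻¹ = S.upper x t := by group
  rw [h3] at h2
  have h4 : ∀ i j, ‖((S.upper x t)⁻¹ • S.herm a 0 l m).1 i j‖ ≤ ‖ϖ‖ ^ k := h2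
  rw [upper_inv_smul_herm, forall_norm_herm_le_iff] at h4
  exact ha h4.1

end

end UnramifiedPair

end RelEndo

/-! ### The orbital integrals and their difference -/

namespace RelEndo

namespace UnramifiedPair

variable {F E : Type*} [NontriviallyNormedField F] [IsUltrametricDist F] [LocallyCompactSpace F]
    [NormedField E] [NormedAlgebra F E] [StarRing E] {ϖ : F} {ζ : Eˣ}

section
variable (S : UnramifiedPair (E := E) ϖ ζ)

lemma herm_scalar_smul (g : S.U2) (a : F) : g • S.herm a 0 0 0 = S.herm a 0 0 0 := by
  have e : (S.herm a 0 0 0).1 = algebraMap F E a • (1 : Matrix (Fin 2) (Fin 2) E) := by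
    rw [coe_herm]
    ext i j
    fin_cases i <;> fin_cases j <;> simp
  apply Subtype.ext
  rw [HermForm.coe_smul, e, mul_smul_comm, smul_mul_assoc, mul_one, Units.mul_inv]

/-- The formula for Φ excludes scalar elements; a conjugate of a nonscalar element is never scalar,
so the formula holds along the whole orbit. -/
lemma exists_smul_eq_herm_regular (g : S.U2) {a l m : F} (hm : m ≠ 0) :
    ∃ a' y' l' m', g • S.herm a 0 l m = S.herm a' y' l' m' ∧ (y' ≠ 0 ∨ l' ≠ 0 ∨ m' ≠ 0) := by
  obtain ⟨a', y', l', m', e⟩ := S.exists_eq_herm (g • S.herm a 0 l m)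
  refine ⟨a', y', l', m', e, ?_⟩
  by_contra! h
  obtain ⟨rfl, rfl, rfl⟩ := h
  rw [smul_eq_iff_eq_inv_smul, herm_scalar_smul] at e
  have h1 := congrArg (fun δ : (V2 ζ S.star_zeta).Herm => δ.1 1 0) e
  simp [coe_herm] at h1
  exact hm h1

open Classical in
lemma Phi_inv_smul (ν : Measure S.U2) [ν.IsHaarMeasure]
    (hν : ν (ULattice (V2 ζ S.star_zeta)) = 1) {a l m : F} (hm : m ≠ 0) {N : ℕ}
    (hN : ‖ϖ‖ ^ (2 * N) < ‖(S.herm a 0 l m).1.det‖) (g : S.U2) :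
    Phi ν (g⁻¹ • S.herm a 0 l m) =
      if ∃ z : E, z * star z = (S.herm a 0 l m).1.det then
        ∑ k ∈ Finset.range N,
          (divisibleSet ϖ (S.herm a 0 l m) k).indicator (fun _ => (resCard F : ℂ) ^ k) g
      else 0 := by
  obtain ⟨a', y', l', m', e, h⟩ := S.exists_smul_eq_herm_regular g⁻¹ (a := a) (l := l) hm
  have hd := det_smul g⁻¹ (S.herm a 0 l m)
  rw [e, S.Phi_herm ν hν h (N := N) (by rwa [← e, hd]), ← e, phiValue, hd]
  congr 1
  refine Finset.sum_congr rfl fun k _ => ?_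
  simp only [Set.indicator, divisibleSet, Set.mem_ofPred_eq, zpow_natCast]

lemma measurable_Phi_inv_smul (ν : Measure S.U2) [ν.IsHaarMeasure]
    (hν : ν (ULattice (V2 ζ S.star_zeta)) = 1) {a l m : F} (hm : m ≠ 0)
    (hdet : (S.herm a 0 l m).1.det ≠ 0) :
    Measurable fun g : S.U2 => Phi ν (g⁻¹ • S.herm a 0 l m) := by
  classical
  obtain ⟨N, hN⟩ := exists_pow_lt_of_lt_one (norm_pos_iff.2 hdet) S.unif_lt
  have hN' : ‖ϖ‖ ^ (2 * N) < ‖(S.herm a 0 l m).1.det‖ :=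
    (pow_le_pow_of_le_one S.unif_pos.le S.unif_lt.le (by lia)).trans_lt hN
  simp only [S.Phi_inv_smul ν hν hm hN']
  split_ifs
  · exact Finset.measurable_fun_sum _ fun k _ =>
      measurable_const.indicator (S.measurableSet_divisibleSet _ _)
  · exact measurable_const

lemma toReal_measure_divisibleSet (ν : Measure S.U2) [ν.IsHaarMeasure]
    (hν : ν (ULattice (V2 ζ S.star_zeta)) = 1) {a l m b : F} {e B k : ℤ} (hm : ‖m‖ = ‖ϖ‖ ^ e)
    (hB : ‖b‖ = ‖ϖ‖ ^ B)
    (hlm : algebraMap F E (l * m) * (ζ : E) ^ 2 = algebraMap F E (b ^ 2))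
    [Decidable (‖a‖ ≤ ‖ϖ‖ ^ k)] : ν (divisibleSet ϖ (S.herm a 0 l m) k) ≠ ⊤ ∧
      ((ν (divisibleSet ϖ (S.herm a 0 l m) k)).toReal : ℂ) = if ‖a‖ ≤ ‖ϖ‖ ^ k then
      ∑ i ∈ Finset.range (B - k + 1 - (e - k) % 2).toNat, (resCard F : ℂ) ^ i else 0 := by
  split_ifs with ha
  · rw [S.measure_divisibleSet ν hν hm hB hlm ha, ENNReal.toReal_sum (by simp)]
    simp
  · rw [S.divisibleSet_eq_empty ha]
    simp

open Classical in
lemma Orb_Phi (ν : Measure S.U2) [ν.IsHaarMeasure]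
    (hν : ν (ULattice (V2 ζ S.star_zeta)) = 1) {a l m b : F} {e B : ℤ} (hm : ‖m‖ = ‖ϖ‖ ^ e)
    (hB : ‖b‖ = ‖ϖ‖ ^ B)
    (hlm : algebraMap F E (l * m) * (ζ : E) ^ 2 = algebraMap F E (b ^ 2)) {N : ℕ}
    (hN : ‖ϖ‖ ^ (2 * N) < ‖(S.herm a 0 l m).1.det‖) :
    Orb ν (S.herm a 0 l m) (Phi ν) =
      if ∃ z : E, z * star z = (S.herm a 0 l m).1.det then
        ∑ k ∈ Finset.range N, (if ‖a‖ ≤ ‖ϖ‖ ^ k then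
          ∑ i ∈ Finset.range (B - k + 1 - (e - k) % 2).toNat, (resCard F : ℂ) ^ i else 0) *
            (resCard F : ℂ) ^ k
      else 0 := by
  have hp := S.unif_pos
  have hb0 : b ≠ 0 := norm_pos_iff.1 (by rw [hB]; positivity)
  have hm0 : m ≠ 0 := norm_pos_iff.1 (by rw [hm]; positivity)
  have hdet0 : (S.herm a 0 l m).1.det ≠ 0 := norm_pos_iff.1 ((by positivity : (0 : ℝ) < _).trans hN)
  have := S.secondCountableTopology_U (V2 ζ S.star_zeta)
  have := S.sigmaFinite_haar (V2 ζ S.star_zeta) ν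
  rw [Orb_eq_integral ν (S.isCompact_stabilizer_herm hb0 hlm)
    (S.measurable_Phi_inv_smul ν hν hm0 hdet0)]
  simp only [S.Phi_inv_smul ν hν hm0 hN]
  split_ifs
  · rw [integral_finsetSum]
    · refine Finset.sum_congr rfl fun k _ => ?_
      rw [integral_indicator_const _ (S.measurableSet_divisibleSet _ _)]
      have := (S.toReal_measure_divisibleSet ν hν (k := k) (a := a) hm hB hlm).2
      rw [zpow_natCast] at this
      rw [← this, Measure.real]
      simp
    · intro k _
      refine (integrable_indicator_iff (S.measurableSet_divisibleSet _ _)).2 ?_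
      exact integrableOn_const (S.toReal_measure_divisibleSet ν hν hm hB hlm).1
  · simp

end

end UnramifiedPair

/-- The two geometric sums differ by one term, q^(B−k), and the parity of k decides which of them is
longer. The factor q^k makes the result independent of k up to sign. -/
lemma sum_range_sub_sum_range_alternating (q : ℂ) (B : ℤ) (k : ℕ) {e : ℤ}
    (he : Even e) :
    (∑ i ∈ Finset.range (B - k + 1 - (e - k) % 2).toNat, q ^ i) * q ^ k -
      (∑ i ∈ Finset.range (B - k + 1 - (e + 1 - k) % 2).toNat, q ^ i) * q ^ k =
      if (k : ℤ) ≤ B then (-1) ^ k * q ^ B else 0 := by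
  have hqk : k ≤ B → q ^ (B - k).toNat * q ^ k = q ^ B := by
    intro h
    rw [← pow_add, ← zpow_natCast]
    congr 1
    lia
  rw [← sub_mul]
  rcases Nat.even_or_odd k with hk | hk
  · have h1 : (e - k) % 2 = 0 := by obtain ⟨x, rfl⟩ := he; obtain ⟨y, rfl⟩ := hk; lia
    have h2 : (e + 1 - k) % 2 = 1 := by obtain ⟨x, rfl⟩ := he; obtain ⟨y, rfl⟩ := hk; lia
    rw [h1, h2, hk.neg_one_pow, one_mul]
    split_ifs with h
    · have h3 : (B - k + 1 - 0).toNat = (B - k).toNat + 1 := by lia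
      have h4 : (B - k + 1 - 1).toNat = (B - k).toNat := by lia
      rw [h3, h4, Finset.sum_range_succ, add_sub_cancel_left, hqk h]
    · have h3 : (B - k + 1 - 0).toNat = 0 := by lia
      have h4 : (B - k + 1 - 1).toNat = 0 := by lia
      rw [h3, h4]
      simp
  · have h1 : (e - k) % 2 = 1 := by obtain ⟨x, rfl⟩ := he; obtain ⟨y, rfl⟩ := hk; lia
    have h2 : (e + 1 - k) % 2 = 0 := by obtain ⟨x, rfl⟩ := he; obtain ⟨y, rfl⟩ := hk; lia
    rw [h1, h2, hk.neg_one_pow]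
    split_ifs with h
    · have h3 : (B - k + 1 - 0).toNat = (B - k).toNat + 1 := by lia
      have h4 : (B - k + 1 - 1).toNat = (B - k).toNat := by lia
      rw [h3, h4, Finset.sum_range_succ, ← hqk h]
      ring
    · have h3 : (B - k + 1 - 0).toNat = 0 := by lia
      have h4 : (B - k + 1 - 1).toNat = 0 := by lia
      rw [h3, h4]
      simp

lemma sum_range_neg_one_pow_toNat (M : ℤ) :
    ∑ k ∈ Finset.range (M + 1).toNat, (-1 : ℂ) ^ k = if 0 ≤ M ∧ Even M then 1 else 0 := by
  rcases lt_or_ge M 0 with h | h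
  · rw [if_neg (by lia)]
    have : (M + 1).toNat = 0 := by lia
    simp [this]
  · lift M to ℕ using h
    have : ((M : ℤ) + 1).toNat = M + 1 := by lia
    rw [this, neg_one_geom_sum]
    simp only [Nat.cast_nonneg, true_and, Int.even_coe_nat, Nat.even_add_one, ite_not]

namespace UnramifiedPair

variable {F E : Type*} [NontriviallyNormedField F] [IsUltrametricDist F] [LocallyCompactSpace F]
    [NormedField E] [NormedAlgebra F E] [StarRing E] {ϖ : F} {ζ : Eˣ}

section
variable (S : UnramifiedPair (E := E) ϖ ζ)

lemma det_herm_zero {a l m b : F}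
    (hlm : algebraMap F E (l * m) * (ζ : E) ^ 2 = algebraMap F E (b ^ 2)) :
    (S.herm a 0 l m).1.det = algebraMap F E ((a + b) * (a - b)) := by
  rw [det_herm]
  simp only [map_mul, map_pow, map_add, map_sub] at hlm ⊢
  simp only [map_zero]
  linear_combination -hlm

/-- The `κ`-orbital integral of `r_! 1_{End(Λ)}`: the difference of the orbital integrals over the
two rational classes. -/
lemma Orb_Phi_sub_Orb_Phi (ν : Measure S.U2) [ν.IsHaarMeasure]
    (hν : ν (ULattice (V2 ζ S.star_zeta)) = 1) {a l m b : F} {e B u v : ℤ} (hm : ‖m‖ = ‖ϖ‖ ^ e)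
    (he : Even e) (hB : ‖b‖ = ‖ϖ‖ ^ B)
    (hlm : algebraMap F E (l * m) * (ζ : E) ^ 2 = algebraMap F E (b ^ 2))
    (hu : ‖a + b‖ = ‖ϖ‖ ^ u) (hv : ‖a - b‖ = ‖ϖ‖ ^ v)
    [Decidable ((0 ≤ u ∧ Even u) ∧ 0 ≤ v ∧ Even v)] :
    Orb ν (S.herm a 0 l m) (Phi ν) - Orb ν (S.herm a 0 (l / ϖ) (m * ϖ)) (Phi ν) =
      if (0 ≤ u ∧ Even u) ∧ 0 ≤ v ∧ Even v then (resCard F : ℂ) ^ B else 0 := by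
  classical
  have hp := S.unif_pos
  have h0 := S.unif.1
  have hm' : ‖m * ϖ‖ = ‖ϖ‖ ^ (e + 1) := by rw [norm_mul, hm, zpow_add₀ hp.ne', zpow_one]
  have hlm' : algebraMap F E (l / ϖ * (m * ϖ)) * (ζ : E) ^ 2 = algebraMap F E (b ^ 2) := by
    rw [← hlm]
    congr 2
    field_simp
  have hdn : ‖(a + b) * (a - b)‖ = ‖ϖ‖ ^ (u + v) := by rw [norm_mul, hu, hv, zpow_add₀ hp.ne']
  -- N exceeds (u + v)/2, as needed for the formula for Φ, and min(u, v), so that the alternating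
  -- sum is complete.
  set N : ℕ := (max (u + v) (max u v)).toNat + 1 with hNdef
  have hN1 : ‖ϖ‖ ^ (2 * N) < ‖algebraMap F E ((a + b) * (a - b))‖ := by
    rw [norm_algebraMap', hdn, ← zpow_natCast, ← not_le, S.zpow_le_zpow]
    push_cast
    lia
  have hd := S.det_herm_zero (a := a) hlm
  have hd' := S.det_herm_zero (a := a) hlm'
  rw [S.Orb_Phi ν hν hm hB hlm (N := N) (by rwa [hd]),
    S.Orb_Phi ν hν hm' hB hlm' (N := N) (by rwa [hd']), hd, hd']
  by_cases hn : ∃ z : E, z * star z = algebraMap F E ((a + b) * (a - b))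
  · have hev := (S.exists_norm_eq_iff hdn).1 hn
    rw [if_pos hn, if_pos hn, ← Finset.sum_sub_distrib]
    -- As 2 is a unit, a, b and a + b, a − b generate the same fractional ideal.
    have hmin : max ‖a‖ ‖b‖ = ‖ϖ‖ ^ (min u v) := by
      have h1 : max ‖a + b‖ ‖a - b‖ = ‖ϖ‖ ^ (min u v) := by
        rw [hu, hv]
        rcases le_total u v with h | h
        · rw [min_eq_left h, max_eq_left (S.zpow_le_zpow.2 h)]
        · rw [min_eq_right h, max_eq_right (S.zpow_le_zpow.2 h)]
      rw [← h1]
      apply le_antisymm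
      · refine max_le ?_ ?_
        · have h2 : ‖2 * a‖ ≤ max ‖a + b‖ ‖a - b‖ := by
            have : 2 * a = (a + b) + (a - b) := by ring
            rw [this]
            exact IsUltrametricDist.norm_add_le_max _ _
          rwa [norm_mul, S.norm_two, one_mul] at h2
        · have h2 : ‖2 * b‖ ≤ max ‖a + b‖ ‖a - b‖ := by
            have : 2 * b = (a + b) + -(a - b) := by ring
            rw [this, ← norm_neg (a - b)]
            exact IsUltrametricDist.norm_add_le_max _ _
          rwa [norm_mul, S.norm_two, one_mul] at h2
      · refine max_le (IsUltrametricDist.norm_add_le_max _ _) ?_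
        rw [sub_eq_add_neg, ← norm_neg b]
        exact IsUltrametricDist.norm_add_le_max _ _
    have hterm : ∀ k ∈ Finset.range N,
        ((if ‖a‖ ≤ ‖ϖ‖ ^ k then
          ∑ i ∈ Finset.range (B - k + 1 - (e - k) % 2).toNat, (resCard F : ℂ) ^ i else 0) *
            (resCard F : ℂ) ^ k -
        (if ‖a‖ ≤ ‖ϖ‖ ^ k then
          ∑ i ∈ Finset.range (B - k + 1 - (e + 1 - k) % 2).toNat, (resCard F : ℂ) ^ i else 0) *
            (resCard F : ℂ) ^ k) =
        if max ‖a‖ ‖b‖ ≤ ‖ϖ‖ ^ k then (-1) ^ k * (resCard F : ℂ) ^ B else 0 := by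
      intro k _
      have hbk : ‖b‖ ≤ ‖ϖ‖ ^ k ↔ (k : ℤ) ≤ B := by rw [hB, ← zpow_natCast, S.zpow_le_zpow]
      simp only [max_le_iff, hbk]
      by_cases ha : ‖a‖ ≤ ‖ϖ‖ ^ k
      · simp only [ha, if_true, true_and]
        exact sum_range_sub_sum_range_alternating _ B k he
      · simp [ha]
    rw [Finset.sum_congr rfl hterm, S.sum_range_ite_norm_le hmin (by lia), ← Finset.sum_mul,
      sum_range_neg_one_pow_toNat, ite_mul, one_mul, zero_mul]
    refine if_congr ?_ rfl rfl
    -- Since det δ is a norm, u and v have the same parity, so the condition on min(u, v) is a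
    -- condition on both.
    rw [Int.even_add] at hev
    rcases le_total u v with h | h
    · rw [min_eq_left h]
      constructor
      · rintro ⟨h1, h2⟩
        exact ⟨⟨h1, h2⟩, h1.trans h, hev.1 h2⟩
      · exact fun h1 => h1.1
    · rw [min_eq_right h]
      constructor
      · rintro ⟨h1, h2⟩
        exact ⟨⟨h1.trans h, hev.2 h2⟩, h1, h2⟩
      · exact fun h1 => h1.2
  · rw [if_neg hn, if_neg hn, if_neg, sub_zero]
    rintro ⟨⟨-, h1⟩, -, h2⟩
    exact hn ((S.exists_norm_eq_iff hdn).2 (h1.add h2))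

end

end UnramifiedPair

end RelEndo

namespace RelEndo

/-! ### The endoscopic character -/

section Kappa

variable {E : Type*} [Field E] [StarRing E] {ι : Type*} [Fintype ι] [DecidableEq ι]

/-- The Hermitian form as a function of two vectors. -/
def HermForm.form (H : HermForm E ι) (u v : ι → E) : E :=
  star u ⬝ᵥ ((H.gram : Matrix ι ι E) *ᵥ v)

lemma HermForm.form_smul_left (H : HermForm E ι) (c : E) (u v : ι → E) :
    H.form (c • u) v = star c * H.form u v := by
  simp [HermForm.form]

lemma HermForm.form_smul_right (H : HermForm E ι) (c : E) (u v : ι → E) :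
    H.form u (c • v) = c * H.form u v := by
  simp [HermForm.form, Matrix.mulVec_smul]

lemma HermForm.form_mulVec (H H' : HermForm E ι) (g h : GL ι E)
    (hgh : star g * H'.gram * h = H.gram) (u v : ι → E) :
    H'.form ((g : Matrix ι ι E) *ᵥ u) ((h : Matrix ι ι E) *ᵥ v) = H.form u v := by
  have e := congrArg Units.val hgh
  simp only [Units.val_mul, Units.coe_star, Matrix.star_eq_conjTranspose] at e
  rw [HermForm.form, HermForm.form, Matrix.star_mulVec, ← Matrix.dotProduct_mulVec,
    Matrix.mulVec_mulVec, Matrix.mulVec_mulVec, ← e]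

/-- `gal` is the contragredient with respect to the forms. Through this identity the cohomological
invariant becomes a comparison of lengths of vectors. -/
lemma HermForm.form_mulVec_gal (H H' : HermForm E ι) (g : GL ι E) (u v : ι → E) :
    H'.form ((g : Matrix ι ι E) *ᵥ u) ((gal H H' g : GL ι E).1 *ᵥ v) = H.form u v := by
  refine HermForm.form_mulVec H H' g _ ?_ u v
  rw [gal]
  group

lemma Intertwines.mulVec {H H' : HermForm E ι} {δ : H.Herm} {δ' : H'.Herm} {g : GL ι E}
    (hg : Intertwines δ δ' g) {x : E} {v : ι → E} (hv : δ.1 *ᵥ v = x • v) :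
    δ'.1 *ᵥ ((g : Matrix ι ι E) *ᵥ v) = x • ((g : Matrix ι ι E) *ᵥ v) := by
  rw [Matrix.mulVec_mulVec, ← hg, ← Matrix.mulVec_mulVec, hv, Matrix.mulVec_smul]

variable {H : HermForm E ι} {δ : H.Herm} {x : E} {v : ι → E}

/-- On a one-dimensional eigenspace spanned by a vector of nonzero length, an element acting by c
has Galois conjugate acting by (star c)⁻¹, since together they preserve the length. -/
lemma exists_gal_eigenvalue (hv : δ.1 *ᵥ v = x • v)
    (hspan : ∀ w, δ.1 *ᵥ w = x • w → ∃ c : E, w = c • v) (hvv : H.form v v ≠ 0)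
    {s : GL ι E} (hs : Intertwines δ δ s) :
    ∃ c : E, c ≠ 0 ∧ (s : Matrix ι ι E) *ᵥ v = c • v ∧
      (gal H H s : GL ι E).1 *ᵥ v = (star c)⁻¹ • v := by
  obtain ⟨c, hc⟩ := hspan _ (hs.mulVec hv)
  obtain ⟨c', hc'⟩ := hspan _ (hs.gal.mulVec hv)
  have h1 := HermForm.form_mulVec_gal H H s v v
  rw [hc, hc', H.form_smul_left, H.form_smul_right, ← mul_assoc, mul_eq_right₀ hvv] at h1
  refine ⟨c, ?_, hc, ?_⟩
  · rintro rfl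
    simp at h1
  · rw [hc', eq_inv_of_mul_eq_one_right h1]

/-- `t` acts on the eigenvectors of `δ` with eigenvalue `x` by a norm. -/
def ActsByNorm (δ : H.Herm) (x : E) (t : GL ι E) : Prop :=
  ∃ z : E, ∀ v : ι → E, δ.1 *ᵥ v = x • v → (t : Matrix ι ι E) *ᵥ v = (z * star z) • v

lemma actsByNorm_iff (hv : δ.1 *ᵥ v = x • v)
    (hspan : ∀ w, δ.1 *ᵥ w = x • w → ∃ c : E, w = c • v) (hv0 : v ≠ 0) {t : GL ι E} {r : E}
    (ht : (t : Matrix ι ι E) *ᵥ v = r • v) :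
    ActsByNorm δ x t ↔ ∃ z : E, z * star z = r := by
  constructor
  · rintro ⟨z, hz⟩
    refine ⟨z, ?_⟩
    have := hz v hv
    rw [ht] at this
    exact (smul_left_injective E hv0 this).symm
  · rintro ⟨z, rfl⟩
    refine ⟨z, fun w hw => ?_⟩
    obtain ⟨c, rfl⟩ := hspan w hw
    rw [Matrix.mulVec_smul, ht, smul_comm]

/-- A coboundary changes the eigenvalue by the inverse of c · star c, a norm. Hence acting by a norm
is a property of the cohomology class. -/
lemma actsByNorm_congr (hv : δ.1 *ᵥ v = x • v)
    (hspan : ∀ w, δ.1 *ᵥ w = x • w → ∃ c : E, w = c • v) (hvv : H.form v v ≠ 0)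
    {s t : GL ι E} (hs : Intertwines δ δ s) (ht : Intertwines δ δ t) :
    ActsByNorm δ x (s⁻¹ * t * gal H H s) ↔ ActsByNorm δ x t := by
  have hv0 : v ≠ 0 := by
    rintro rfl
    simp [HermForm.form] at hvv
  obtain ⟨c, hc0, hc, hc'⟩ := exists_gal_eigenvalue hv hspan hvv hs
  obtain ⟨r, hr⟩ := hspan _ (ht.mulVec hv)
  have hcs : star c ≠ 0 := star_ne_zero.2 hc0
  have hsinv : ((s⁻¹ : GL ι E) : Matrix ι ι E) *ᵥ v = c⁻¹ • v := by
    have h1 : ((s⁻¹ : GL ι E) : Matrix ι ι E) *ᵥ ((s : Matrix ι ι E) *ᵥ v) = v := by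
      rw [Matrix.mulVec_mulVec, Units.inv_mul, Matrix.one_mulVec]
    rw [hc, Matrix.mulVec_smul] at h1
    rw [← h1, smul_smul, h1, inv_mul_cancel₀ hc0, one_smul]
  rw [actsByNorm_iff hv hspan hv0 hr, actsByNorm_iff hv hspan hv0 (r := (star c)⁻¹ * r * c⁻¹)]
  · constructor
    · rintro ⟨z, hz⟩
      refine ⟨z * c, ?_⟩
      rw [star_mul']
      calc z * c * (star z * star c) = (z * star z) * c * star c := by ring
        _ = r := by rw [hz]; field_simp
    · rintro ⟨z, rfl⟩
      refine ⟨z * c⁻¹, ?_⟩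
      rw [star_mul', star_inv₀]
      ring
  · rw [Units.val_mul, Units.val_mul, ← Matrix.mulVec_mulVec, ← Matrix.mulVec_mulVec, hc',
      Matrix.mulVec_smul, hr, Matrix.mulVec_smul, Matrix.mulVec_smul, hsinv, smul_smul, smul_smul]

open Classical in
lemma kappa_mk (hv : δ.1 *ᵥ v = x • v)
    (hspan : ∀ w, δ.1 *ᵥ w = x • w → ∃ c : E, w = c • v) (hvv : H.form v v ≠ 0)
    (t : Cocycle δ) :
    kappa δ x (Quot.mk _ t) = if ActsByNorm δ x t.1 then 1 else -1 := by
  let f : H1 δ → Prop := Quot.lift (fun t : Cocycle δ => ActsByNorm δ x t.1) (by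
    rintro t t' ⟨s, hs, e⟩
    rw [e]
    exact propext (actsByNorm_congr hv hspan hvv hs t.2.1).symm)
  unfold kappa
  refine if_congr ⟨?_, fun h => ⟨t, rfl, h⟩⟩ rfl rfl
  rintro ⟨t', ht', h⟩
  have h1 : f (Quot.mk _ t') := h
  rw [ht'] at h1
  exact h1

open Classical in
/-- The value of `κ` on `inv(δ, δ')` compares the lengths of the eigenvectors of `δ` and `δ'`. -/
lemma kappa_inv (hv : δ.1 *ᵥ v = x • v)
    (hspan : ∀ w, δ.1 *ᵥ w = x • w → ∃ c : E, w = c • v) (hvv : H.form v v ≠ 0)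
    {H' : HermForm E ι} {δ' : H'.Herm} (h : IsTransfer δ δ') :
    kappa δ x (inv δ δ' h) =
      if ∃ z : E, z * star z * H'.form ((h.choose : Matrix ι ι E) *ᵥ v)
        ((h.choose : Matrix ι ι E) *ᵥ v) = H.form v v then 1 else -1 := by
  have hv0 : v ≠ 0 := by
    rintro rfl
    simp [HermForm.form] at hvv
  rw [inv, kappa_mk hv hspan hvv]
  set g : GL ι E := h.choose
  have hg : Intertwines δ δ' g := h.choose_spec
  obtain ⟨r, hr⟩ := hspan _ ((invCocycle δ δ' g hg).2.1.mulVec hv)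
  -- If g⁻¹σ(g) acts on v by r, then σ(g)v = r gv, and pairing with gv gives ⟨v, v⟩ = r⟨gv, gv⟩.
  have h1 : (gal H H' g : GL ι E).1 *ᵥ v = r • ((g : Matrix ι ι E) *ᵥ v) := by
    have h2 : (gal H H' g : GL ι E).1 = (g : Matrix ι ι E) * (invCocycle δ δ' g hg).1.1 := by
      rw [← Units.val_mul]
      congr 1
      simp [invCocycle]
    rw [h2, ← Matrix.mulVec_mulVec, hr, Matrix.mulVec_smul]
  have h3 := HermForm.form_mulVec_gal H H' g v v
  rw [h1, HermForm.form_smul_right] at h3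
  refine if_congr ?_ rfl rfl
  rw [actsByNorm_iff hv hspan hv0 hr]
  have hne : H'.form ((g : Matrix ι ι E) *ᵥ v) ((g : Matrix ι ι E) *ᵥ v) ≠ 0 := by
    intro h0
    rw [h0, mul_zero] at h3
    exact hvv h3.symm
  refine exists_congr fun z => ?_
  rw [← h3, mul_left_inj' hne]

end Kappa

/-! ### The invariant in coordinates, through lengths of eigenvectors -/

namespace UnramifiedPair

variable {F E : Type*} [NontriviallyNormedField F] [IsUltrametricDist F] [LocallyCompactSpace F]
    [NormedField E] [NormedAlgebra F E] [StarRing E] {ϖ : F} {ζ : Eˣ}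

section
variable (S : UnramifiedPair (E := E) ϖ ζ)

include S in
lemma sub_zeta_ne_zero {b y : F} (hb : b ≠ 0) :
    algebraMap F E b - ζ * algebraMap F E y ≠ 0 := by
  have e : algebraMap F E b - ζ * algebraMap F E y =
      algebraMap F E b + ζ * algebraMap F E (-y) := by rw [map_neg]; ring
  rw [e, ← norm_ne_zero_iff, S.norm_add_zeta]
  exact ((norm_pos_iff.2 hb).trans_le (le_max_left _ _)).ne'

/-- An eigenvector of `a + ζ (y, l; m, -y)` with eigenvalue `a - b`. -/
def eigenvector (ζ : Eˣ) (b y m : F) : Fin 2 → E :=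
  ![algebraMap F E b - ζ * algebraMap F E y, -(ζ * algebraMap F E m)]

lemma herm_mulVec_eigenvector {a y l m b : F}
    (h : algebraMap F E (y ^ 2 + l * m) * (ζ : E) ^ 2 = algebraMap F E (b ^ 2)) :
    (S.herm a y l m).1 *ᵥ eigenvector ζ b y m =
      algebraMap F E (a - b) • eigenvector ζ b y m := by
  simp only [map_add, map_mul, map_pow] at h
  rw [coe_herm, eigenvector, map_sub]
  ext i
  fin_cases i <;> simp
  · linear_combination -h
  · ring

lemma exists_eq_smul_eigenvector {a y l m b : F} (hb : b ≠ 0) {w : Fin 2 → E}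
    (hw : (S.herm a y l m).1 *ᵥ w = algebraMap F E (a - b) • w) :
    ∃ c : E, w = c • eigenvector ζ b y m := by
  have h0 := S.sub_zeta_ne_zero (y := y) hb
  have h1 := congrFun hw 1
  simp [coe_herm, Matrix.mulVec, dotProduct, Fin.sum_univ_two] at h1
  refine ⟨w 0 / (algebraMap F E b - ζ * algebraMap F E y), ?_⟩
  ext i
  fin_cases i <;> simp [eigenvector]
  · field_simp
  · field_simp
    linear_combination h1

/-- The length is 2bm up to the norm ζ · star ζ, and y does not enter. Thus only m varies within the
stable class. -/
lemma form_eigenvector (b y m : F) : (V2 ζ S.star_zeta).form (eigenvector ζ b y m)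
    (eigenvector ζ b y m) = ζ * star (ζ : E) * algebraMap F E (2 * b * m) := by
  simp [HermForm.form, eigenvector, V2_gram, dotProduct, Fin.sum_univ_two, S.star_coe, S.star_zeta, map_ofNat]
  ring

lemma form_eigenvector_ne_zero {b y m : F} (hb : b ≠ 0) (hm : m ≠ 0) :
    (V2 ζ S.star_zeta).form (eigenvector ζ b y m) (eigenvector ζ b y m) ≠ 0 := by
  rw [S.form_eigenvector, S.star_zeta]
  have h2 := S.two_ne_zero
  have hz : (ζ : E) ≠ 0 := ζ.ne_zero
  refine mul_ne_zero (mul_ne_zero hz (neg_ne_zero.2 hz)) ?_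
  simp [h2, hb, hm]

include S in
lemma exists_norm_mul_iff {c r s : E} (hc : c ≠ 0) (hr : r ≠ 0) :
    (∃ z : E, z * star z * (c * star c * r) = s) ↔ ∃ z : E, z * star z = s / r := by
  have hcs : star c ≠ 0 := star_ne_zero.2 hc
  constructor
  · rintro ⟨z, rfl⟩
    refine ⟨z * c, ?_⟩
    rw [star_mul']
    field_simp
  · rintro ⟨z, hz⟩
    refine ⟨z / c, ?_⟩
    rw [star_div₀]
    have : s = z * star z * r := by rw [hz]; field_simp
    rw [this]
    field_simp

/-- `κ(inv(δ, δ'))` for two elements of `Herm(V₂)`. -/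
lemma kappa_inv_herm {a y l m y' l' m' b : F} (hb : b ≠ 0) (hm : m ≠ 0) (hm' : m' ≠ 0)
    (h : algebraMap F E (y ^ 2 + l * m) * (ζ : E) ^ 2 = algebraMap F E (b ^ 2))
    (ht : IsTransfer (S.herm a y l m) (S.herm a y' l' m')) :
    kappa (S.herm a y l m) (algebraMap F E (a - b)) (inv _ _ ht) =
      omega (algebraMap F E (m / m')) := by
  classical
  have hz : (ζ : E) ≠ 0 := ζ.ne_zero
  have hzs : star (ζ : E) ≠ 0 := star_ne_zero.2 hz
  have h2 := S.two_ne_zero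
  have hv := S.herm_mulVec_eigenvector (a := a) h
  have hvv := S.form_eigenvector_ne_zero (y := y) hb hm
  rw [kappa_inv hv (fun w hw => S.exists_eq_smul_eigenvector hb hw) hvv, omega]
  obtain ⟨c, hc⟩ := S.exists_eq_smul_eigenvector hb (ht.choose_spec.mulVec hv)
  have hc0 : c ≠ 0 := by
    rintro rfl
    rw [zero_smul] at hc
    have h3 := congrArg (fun w => ((ht.choose⁻¹ : GL (Fin 2) E) : Matrix (Fin 2) (Fin 2) E) *ᵥ w) hc
    simp only [Matrix.mulVec_mulVec, Units.inv_mul, Matrix.one_mulVec, Matrix.mulVec_zero] at h3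
    rw [h3] at hvv
    simp [HermForm.form] at hvv
  have hr : algebraMap F E (2 * b * m') ≠ 0 := by simp [h2, hb, hm']
  rw [hc, HermForm.form_smul_left, HermForm.form_smul_right, S.form_eigenvector, S.form_eigenvector]
  have e1 : star c * (c * (ζ * star (ζ : E) * algebraMap F E (2 * b * m'))) =
      c * star c * (ζ * star (ζ : E) * algebraMap F E (2 * b * m')) := by ring
  have e2 : ζ * star (ζ : E) * algebraMap F E (2 * b * m) /
      (ζ * star (ζ : E) * algebraMap F E (2 * b * m')) = algebraMap F E (m / m') := by
    rw [mul_div_mul_left _ _ (mul_ne_zero hz hzs), ← map_div₀]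
    congr 1
    field_simp
  refine if_congr ?_ rfl rfl
  rw [e1, S.exists_norm_mul_iff hc0 (mul_ne_zero (mul_ne_zero hz hzs) hr), e2]

/-- The pair `(a + b, a - b)`. -/
def hermPair (a b : F) : (V1 E).Herm × (V1 E).Herm :=
  (herm1 (algebraMap F E (a + b)) (S.star_coe _), herm1 (algebraMap F E (a - b)) (S.star_coe _))

lemma coe_directSum_hermPair (a b : F) : (directSum (S.hermPair a b)).1 =
    !![algebraMap F E (a + b), 0; 0, algebraMap F E (a - b)] := by
  ext i j
  fin_cases i <;> fin_cases j <;> simp [directSum, hermPair, herm1]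

lemma eigenvector_directSum {a b : F} (hb : b ≠ 0) {w : Fin 2 → E}
    (hw : (directSum (S.hermPair a b)).1 *ᵥ w = algebraMap F E (a - b) • w) :
    (V11 E).form w w = w 1 * star (w 1) := by
  have h2 := S.two_ne_zero'
  have hb' : algebraMap F E b ≠ 0 := by simpa
  have h0 : w 0 = 0 := by
    have h1 := congrFun hw 0
    simp [-mul_eq_mul_right_iff, coe_directSum_hermPair, Matrix.mulVec, dotProduct, Fin.sum_univ_two] at h1
    have h3 : 2 * algebraMap F E b * w 0 = 0 := by linear_combination h1
    exact (mul_eq_zero.1 h3).resolve_left (mul_ne_zero h2 hb')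
  simp [HermForm.form, unitForm, dotProduct, Fin.sum_univ_two, h0, mul_comm]

/-- `κ(inv(δ, δ'))` for `δ' = (a + b) ⊕ (a - b)`. -/
lemma kappa_inv_directSum {a l m b : F} (hb : b ≠ 0) (hm : m ≠ 0)
    (h : algebraMap F E (l * m) * (ζ : E) ^ 2 = algebraMap F E (b ^ 2))
    (ht : IsTransfer (S.herm a 0 l m) (directSum (S.hermPair a b))) :
    kappa (S.herm a 0 l m) (algebraMap F E (a - b)) (inv _ _ ht) =
      omega (algebraMap F E (2 * b * m)) := by
  classical
  have hz : (ζ : E) ≠ 0 := ζ.ne_zero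
  have hzs : star (ζ : E) ≠ 0 := star_ne_zero.2 hz
  have hv := S.herm_mulVec_eigenvector (a := a) (y := 0) (l := l) (m := m) (b := b) (by simpa using h)
  have hvv := S.form_eigenvector_ne_zero (y := 0) hb hm
  rw [kappa_inv hv (fun w hw => S.exists_eq_smul_eigenvector hb hw) hvv, omega]
  have hw := S.eigenvector_directSum hb (ht.choose_spec.mulVec hv)
  have h4 := HermForm.form_mulVec_gal (V2 ζ S.star_zeta) (V11 E) ht.choose
    (eigenvector ζ b 0 m) (eigenvector ζ b 0 m)
  set w := (ht.choose : Matrix (Fin 2) (Fin 2) E) *ᵥ eigenvector ζ b 0 m with hwdef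
  have hc0 : w 1 ≠ 0 := by
    intro h0
    have hw0 : w = 0 := by
      have h2 := S.two_ne_zero'
      have hb' : algebraMap F E b ≠ 0 := by simpa
      have h1 := congrFun (ht.choose_spec.mulVec hv) 0
      rw [← hwdef] at h1
      simp [-mul_eq_mul_right_iff, coe_directSum_hermPair, Matrix.mulVec, dotProduct, Fin.sum_univ_two] at h1
      have h3 : 2 * algebraMap F E b * w 0 = 0 := by linear_combination h1
      ext i
      fin_cases i
      · exact (mul_eq_zero.1 h3).resolve_left (mul_ne_zero h2 hb')
      · exact h0
    rw [hw0] at h4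
    rw [← h4] at hvv
    simp [HermForm.form] at hvv
  refine if_congr ?_ rfl rfl
  have e : ∀ z : E, z * star z * (w 1 * star (w 1)) = ζ * star (ζ : E) * algebraMap F E (2 * b * m) ↔
      z * star z * (w 1 / ζ * star (w 1 / ζ) * 1) = algebraMap F E (2 * b * m) := by
    intro z
    rw [star_div₀]
    constructor
    · intro h5
      field_simp
      linear_combination h5
    · intro h5
      rw [← h5]
      field_simp
  rw [hw, S.form_eigenvector]
  simp only [e]
  rw [S.exists_norm_mul_iff (div_ne_zero hc0 hz) one_ne_zero, div_one]

/-- A matrix that diagonalizes `a + ζ (0, l; m, 0)`. -/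
lemma exists_diagonalize {a l m b : F} (hb : b ≠ 0) (hm : m ≠ 0)
    (h : algebraMap F E (l * m) * (ζ : E) ^ 2 = algebraMap F E (b ^ 2)) {α β : E} (hα : α ≠ 0)
    (hβ : β ≠ 0) : ∃ g : GL (Fin 2) E,
    (g : Matrix (Fin 2) (Fin 2) E) = !![α * ζ * algebraMap F E m, α * algebraMap F E b;
      -(β * ζ * algebraMap F E m), β * algebraMap F E b] ∧
    Intertwines (S.herm a 0 l m) (directSum (S.hermPair a b)) g := by
  have h2 := S.two_ne_zero'
  have hz : (ζ : E) ≠ 0 := ζ.ne_zero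
  have hb' : algebraMap F E b ≠ 0 := by simpa
  have hm' : algebraMap F E m ≠ 0 := by simpa
  refine ⟨Matrix.GeneralLinearGroup.mkOfDetNeZero !![α * ζ * algebraMap F E m, α * algebraMap F E b;
      -(β * ζ * algebraMap F E m), β * algebraMap F E b] ?_, rfl, ?_⟩
  · have : (!![α * ζ * algebraMap F E m, α * algebraMap F E b;
      -(β * ζ * algebraMap F E m), β * algebraMap F E b]).det =
        2 * α * β * ζ * algebraMap F E m * algebraMap F E b := by
      rw [Matrix.det_fin_two_of]; ring
    rw [this]
    positivity
  · simp only [map_mul, map_pow] at h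
    change !![α * ζ * algebraMap F E m, α * algebraMap F E b;
      -(β * ζ * algebraMap F E m), β * algebraMap F E b] * (S.herm a 0 l m).1 =
      (directSum (S.hermPair a b)).1 * !![α * ζ * algebraMap F E m, α * algebraMap F E b;
      -(β * ζ * algebraMap F E m), β * algebraMap F E b]
    rw [coe_herm, coe_directSum_hermPair, Matrix.mul_fin_two, Matrix.mul_fin_two]
    ext i j
    fin_cases i <;> fin_cases j <;> simp
    · ring
    · linear_combination α * h
    · ring
    · linear_combination (-β) * h

/-- An isometry carries the eigenvector for a − b to a vector on the second coordinate line, whose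
length is a norm; so 2bm must be a norm. Conversely, if val(bm) is even, then −2bm is a norm too,
and both eigenvectors can be rescaled to length one. -/
lemma isNiceMatch_iff {a l m b : F} (hb : b ≠ 0) (hm : m ≠ 0)
    (h : algebraMap F E (l * m) * (ζ : E) ^ 2 = algebraMap F E (b ^ 2)) {n : ℤ}
    (hn : ‖b * m‖ = ‖ϖ‖ ^ n) :
    IsNiceMatch (S.hermPair a b) (S.herm a 0 l m) ↔ Even n := by
  have hp := S.unif_pos
  have h2 := S.two_ne_zero
  have hz : (ζ : E) ≠ 0 := ζ.ne_zero
  have hn2 : ‖2 * b * m‖ = ‖ϖ‖ ^ n := by rw [mul_assoc, norm_mul, S.norm_two, one_mul, hn]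
  constructor
  · rintro ⟨g, hg, hgi⟩
    have hv := S.herm_mulVec_eigenvector (a := a) (y := 0) (l := l) (m := m) (b := b) (by simpa using h)
    have hw := S.eigenvector_directSum hb (hgi.mulVec hv)
    rw [HermForm.form_mulVec _ _ g g hg, S.form_eigenvector] at hw
    set c := ((g : Matrix (Fin 2) (Fin 2) E) *ᵥ eigenvector ζ b 0 m) 1
    rw [← S.exists_norm_eq_iff hn2]
    refine ⟨c / ζ, ?_⟩
    have hzs : star (ζ : E) ≠ 0 := star_ne_zero.2 hz
    rw [star_div₀, div_mul_div_comm, ← hw]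
    field_simp
  · intro hev
    have hev' : Even (-n) := hev.neg
    -- The rows of g are scaled by α and β, whose norms are −1/(2bm) and 1/(2bm). Their sum vanishes
    -- and their difference is fixed, which is exactly the condition that g transports the unit form
    -- to J.
    obtain ⟨β, hβ⟩ := (S.exists_norm_eq_iff (x := (2 * b * m)⁻¹) (by
      rw [norm_inv, hn2, zpow_neg])).2 hev'
    obtain ⟨α, hα⟩ := (S.exists_norm_eq_iff (x := -(2 * b * m)⁻¹) (by
      rw [norm_neg, norm_inv, hn2, zpow_neg])).2 hev'
    have hr : algebraMap F E (2 * b * m)⁻¹ ≠ 0 := by simp [h2, hb, hm]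
    have hα0 : α ≠ 0 := by
      rintro rfl
      rw [zero_mul, map_neg] at hα
      exact neg_ne_zero.2 hr hα.symm
    have hβ0 : β ≠ 0 := by
      rintro rfl
      rw [zero_mul] at hβ
      exact hr hβ.symm
    obtain ⟨g, hg, hgi⟩ := S.exists_diagonalize (a := a) hb hm h hα0 hβ0
    refine ⟨g, ?_, hgi⟩
    apply Units.ext
    have h2' := S.two_ne_zero'
    have hb' : algebraMap F E b ≠ 0 := by simpa
    have hm' : algebraMap F E m ≠ 0 := by simpa
    have hgram : ((V11 E).gram : Matrix (Fin 2) (Fin 2) E) = 1 := rfl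
    have hgs : (g : Matrix (Fin 2) (Fin 2) E)ᴴ =
        !![-(star α * ζ * algebraMap F E m), star β * ζ * algebraMap F E m;
          star α * algebraMap F E b, star β * algebraMap F E b] := by
      rw [hg]
      ext i j
      fin_cases i <;> fin_cases j <;> simp [S.star_coe, S.star_zeta]
    rw [Units.val_mul, Units.val_mul, Units.coe_star, Matrix.star_eq_conjTranspose, hgram, mul_one,
      hgs, hg, V2_gram, Matrix.mul_fin_two]
    simp only [map_neg, map_inv₀, map_mul, map_ofNat] at hα hβ
    have hs : α * star α + β * star β = 0 := by rw [hα, hβ]; ring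
    have hd : (β * star β - α * star α) * algebraMap F E b * algebraMap F E m = 1 := by
      rw [hα, hβ]; field_simp; ring
    ext i j
    fin_cases i <;> fin_cases j <;> simp
    · linear_combination (-(ζ : E) ^ 2 * algebraMap F E m ^ 2) * hs
    · linear_combination (ζ : E) * hd
    · linear_combination (-(ζ : E)) * hd
    · linear_combination (algebraMap F E b ^ 2) * hs

end

end UnramifiedPair

end RelEndo

namespace RelEndo

/-! ### Rational classes in a stable class -/

lemma intertwines_smul {E : Type*} [Field E] [StarRing E] {ι : Type*} [Fintype ι]
    [DecidableEq ι] {H : HermForm E ι} (δ : H.Herm) (g : H.U) :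
    Intertwines δ (g • δ) (g : GL ι E) := by
  rw [Intertwines, HermForm.coe_smul, mul_assoc, Units.inv_mul, mul_one]

namespace UnramifiedPair

variable {F E : Type*} [NontriviallyNormedField F] [IsUltrametricDist F] [LocallyCompactSpace F]
    [NormedField E] [NormedAlgebra F E] [StarRing E] {ϖ : F} {ζ : Eˣ}

section
variable (S : UnramifiedPair (E := E) ϖ ζ)

/-- The diagonal element `(z, star z⁻¹)` of the unitary group. -/
def diagonal (z : Eˣ) : S.U2 :=
  mkU ζ S.star_zeta (z : E) 0 0 (star (z : E))⁻¹ (by simp)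
    (by simp [star_ne_zero.2 z.ne_zero]) (by simp)

lemma diagonal_smul_herm {z : Eˣ} {r : F} (hz : (z : E) * star (z : E) = algebraMap F E r)
    (a l m : F) : S.diagonal z • S.herm a 0 l m = S.herm a 0 (l * r) (m / r) := by
  have hz0 : (z : E) ≠ 0 := z.ne_zero
  have hzs : star (z : E) ≠ 0 := star_ne_zero.2 hz0
  apply Subtype.ext
  rw [HermForm.coe_smul, diagonal, coe_mkU, coe_mkU_inv, coe_herm, coe_herm, Matrix.mul_fin_two,
    Matrix.mul_fin_two]
  simp only [map_mul, map_div₀, ← hz]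
  ext i j
  fin_cases i <;> fin_cases j <;> simp <;> field_simp

include S in
lemma ne_zero_of_mul_zeta_sq {y l m b : F} (hb : b ≠ 0)
    (h : algebraMap F E (y ^ 2 + l * m) * (ζ : E) ^ 2 = algebraMap F E (b ^ 2)) : m ≠ 0 := by
  rintro rfl
  have h1 := S.sub_zeta_ne_zero (y := y) hb
  have h2 := S.sub_zeta_ne_zero (y := -y) hb
  refine mul_ne_zero h1 h2 ?_
  simp only [map_add, map_mul, map_pow, map_zero, map_neg] at h ⊢
  linear_combination -h

/-- A stable conjugate has the same characteristic polynomial. -/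
lemma exists_eq_herm_of_isTransfer {a l m : F} {δ : (V2 ζ S.star_zeta).Herm}
    (h : IsTransfer (S.herm a 0 l m) δ) :
    ∃ y' l' m', δ = S.herm a y' l' m' ∧ y' ^ 2 + l' * m' = l * m := by
  obtain ⟨g, hg⟩ := h
  obtain ⟨a', y', l', m', rfl⟩ := S.exists_eq_herm δ
  have e : (S.herm a' y' l' m').1 = (g : Matrix (Fin 2) (Fin 2) E) * (S.herm a 0 l m).1 *
      ((g⁻¹ : GL (Fin 2) E) : Matrix (Fin 2) (Fin 2) E) := by
    rw [hg, mul_assoc, Units.mul_inv, mul_one]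
  have ht := congrArg Matrix.trace e
  have hd := congrArg Matrix.det e
  rw [mul_assoc, Matrix.trace_mul_comm, mul_assoc, Units.inv_mul, mul_one] at ht
  rw [mul_assoc, Matrix.det_mul_comm, mul_assoc, Units.inv_mul, mul_one, det_herm, det_herm] at hd
  have ha : a' = a := by
    rw [coe_herm, coe_herm, Matrix.trace_fin_two_of, Matrix.trace_fin_two_of] at ht
    have : (2 : E) * algebraMap F E a' = 2 * algebraMap F E a := by linear_combination ht
    exact (algebraMap F E).injective (mul_left_cancel₀ S.two_ne_zero' this)
  subst ha
  refine ⟨y', l', m', rfl, (algebraMap F E).injective ?_⟩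
  have hz : (ζ : E) ^ 2 ≠ 0 := pow_ne_zero _ ζ.ne_zero
  refine mul_left_cancel₀ hz ?_
  have e0 : (0 : F) ^ 2 + l * m = l * m := by ring
  rw [e0] at hd
  linear_combination -hd

/-- A unipotent element removes y', after which y'² + l'm' = lm determines the upper right entry. A
diagonal element changes m' by any norm. -/
lemma exists_smul_herm_eq {a l m y' l' m' : F} (hm : m ≠ 0) (hm' : m' ≠ 0)
    (h : y' ^ 2 + l' * m' = l * m) (hz : ∃ z : E, z * star z = algebraMap F E (m' / m)) :
    ∃ g : S.U2, g • S.herm a y' l' m' = S.herm a 0 l m := by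
  obtain ⟨z, hz⟩ := hz
  have hz0 : z ≠ 0 := by
    rintro rfl
    rw [zero_mul, eq_comm, map_eq_zero] at hz
    exact div_ne_zero hm' hm hz
  refine ⟨S.diagonal (Units.mk0 z hz0) * S.sl2 1 (-y' / m') 0 1 (by ring), ?_⟩
  rw [mul_smul, sl2_smul_herm]
  have e : S.herm a ((1 * 1 + -y' / m' * 0) * y' + -y' / m' * 1 * m' - 1 * 0 * l')
      (1 ^ 2 * l' - 2 * 1 * (-y' / m') * y' - (-y' / m') ^ 2 * m')
      (2 * 0 * 1 * y' + 1 ^ 2 * m' - 0 ^ 2 * l') = S.herm a 0 (l * m / m') m' := by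
    congr 1
    · field_simp; ring
    · rw [← h]; field_simp; ring
    · ring
  rw [e, S.diagonal_smul_herm (r := m' / m) hz]
  congr 1
  · field_simp
  · field_simp

lemma exists_norm_of_smul_herm_eq {a l m l' m' b : F} (hb : b ≠ 0) (hm' : m' ≠ 0)
    (h : algebraMap F E (l * m) * (ζ : E) ^ 2 = algebraMap F E (b ^ 2)) {g : S.U2}
    (hg : g • S.herm a 0 l m = S.herm a 0 l' m') :
    ∃ z : E, z * star z = algebraMap F E (m / m') := by
  have hz : (ζ : E) ≠ 0 := ζ.ne_zero
  have hzs : star (ζ : E) ≠ 0 := star_ne_zero.2 hz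
  have hb' : algebraMap F E b ≠ 0 := by simpa
  have h2 := S.two_ne_zero'
  have hm0 : algebraMap F E m' ≠ 0 := by simpa
  have hv := S.herm_mulVec_eigenvector (a := a) (y := 0) (l := l) (m := m) (b := b)
    (by simpa using h)
  have hgi := intertwines_smul (S.herm a 0 l m) g
  rw [hg] at hgi
  obtain ⟨c, hc⟩ := S.exists_eq_smul_eigenvector hb (hgi.mulVec hv)
  have e := HermForm.form_mulVec (V2 ζ S.star_zeta) (V2 ζ S.star_zeta) g g g.2
    (eigenvector ζ b 0 m) (eigenvector ζ b 0 m)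
  rw [hc, HermForm.form_smul_left, HermForm.form_smul_right, S.form_eigenvector,
    S.form_eigenvector] at e
  refine ⟨c, ?_⟩
  simp only [map_mul, map_ofNat] at e
  rw [map_div₀, eq_div_iff hm0]
  have hne : (ζ : E) * star (ζ : E) * (2 * algebraMap F E b) ≠ 0 :=
    mul_ne_zero (mul_ne_zero hz hzs) (mul_ne_zero h2 hb')
  refine mul_left_cancel₀ hne ?_
  linear_combination e

lemma isTransfer_herm_unif (a l m : F) :
    IsTransfer (S.herm a 0 l m) (S.herm a 0 (l / ϖ) (m * ϖ)) := by
  have hp : algebraMap F E ϖ ≠ 0 := by simpa using S.unif.1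
  refine ⟨Matrix.GeneralLinearGroup.mkOfDetNeZero !![1, 0; 0, algebraMap F E ϖ] (by
    rw [Matrix.det_fin_two_of]; simpa using S.unif.1), ?_⟩
  change !![1, 0; 0, algebraMap F E ϖ] * (S.herm a 0 l m).1 =
    (S.herm a 0 (l / ϖ) (m * ϖ)).1 * !![1, 0; 0, algebraMap F E ϖ]
  rw [coe_herm, coe_herm, Matrix.mul_fin_two, Matrix.mul_fin_two]
  simp only [map_mul, map_div₀]
  ext i j
  fin_cases i <;> fin_cases j <;> simp
  · field_simp
  · ring
  · ring

lemma isTransfer_of_smul_eq {δ δ' δ'' : (V2 ζ S.star_zeta).Herm} (h : IsTransfer δ δ')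
    (g : S.U2) (hg : g • δ'' = δ') : IsTransfer δ δ'' := by
  obtain ⟨x, hx⟩ := h
  have h1 := intertwines_smul δ'' g
  rw [hg] at h1
  exact ⟨_, h1.inv.mul hx⟩

/-- The stable class of `δ` consists of two rational classes, on which `κ` is `1` and `-1`. -/
theorem OrbKappa_eq (ν : Measure S.U2) [ν.IsHaarMeasure]
    (hν : ν (ULattice (V2 ζ S.star_zeta)) = 1) {a l m b : F} (hb : b ≠ 0)
    (hlm : algebraMap F E (l * m) * (ζ : E) ^ 2 = algebraMap F E (b ^ 2))
    (hab : (a + b) * (a - b) ≠ 0) :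
    OrbKappa ν (algebraMap F E (a - b)) (S.herm a 0 l m) (Phi ν) =
      Orb ν (S.herm a 0 l m) (Phi ν) - Orb ν (S.herm a 0 (l / ϖ) (m * ϖ)) (Phi ν) := by
  classical
  have := S.locallyCompactSpace_U (V2 ζ S.star_zeta)
  have := S.secondCountableTopology_U (V2 ζ S.star_zeta)
  have := S.sigmaFinite_haar (V2 ζ S.star_zeta) ν
  have hϖ := S.unif.1
  have hp := S.unif_pos
  have hlm0 : algebraMap F E ((0 : F) ^ 2 + l * m) * (ζ : E) ^ 2 = algebraMap F E (b ^ 2) := by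
    simpa using hlm
  have hm : m ≠ 0 := S.ne_zero_of_mul_zeta_sq hb hlm0
  have hm2 : m * ϖ ≠ 0 := mul_ne_zero hm hϖ
  have hlm2' : l / ϖ * (m * ϖ) = l * m := by field_simp
  have hlm2 : algebraMap F E (l / ϖ * (m * ϖ)) * (ζ : E) ^ 2 = algebraMap F E (b ^ 2) := by
    rw [hlm2', hlm]
  set δ := S.herm a 0 l m with hδ
  set δ₂ := S.herm a 0 (l / ϖ) (m * ϖ) with hδ₂
  -- Orbital integrals do not depend on the representative of a rational class, which justifies
  -- replacing `Quotient.out` by the normal forms δ and δ₂.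
  have horb : ∀ {l m : F}, algebraMap F E (l * m) * (ζ : E) ^ 2 = algebraMap F E (b ^ 2) →
      m ≠ 0 → ∀ g : S.U2, Orb ν (g • S.herm a 0 l m) (Phi ν) = Orb ν (S.herm a 0 l m) (Phi ν) := by
    intro l m hlm hm g
    refine Orb_smul ν (S.isCompact_stabilizer_herm hb hlm)
      (S.measurable_Phi_inv_smul ν hν hm ?_) g
    rw [S.det_herm_zero hlm]
    exact (map_ne_zero _).2 hab
  have hmk : ∀ (x : (V2 ζ S.star_zeta).Herm)
      (c : MulAction.orbitRel.Quotient S.U2 (V2 ζ S.star_zeta).Herm),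
      (Quotient.mk _ x = c) ↔ ∃ g : S.U2, g • Quotient.out c = x := by
    intro x c
    conv_lhs => rw [← Quotient.out_eq c, Quotient.eq]
    exact MulAction.orbitRel_apply
  let c₁ : MulAction.orbitRel.Quotient S.U2 (V2 ζ S.star_zeta).Herm := Quotient.mk _ δ
  let c₂ : MulAction.orbitRel.Quotient S.U2 (V2 ζ S.star_zeta).Herm := Quotient.mk _ δ₂
  obtain ⟨g₁, hg₁⟩ := (hmk δ c₁).1 rfl
  obtain ⟨g₂, hg₂⟩ := (hmk δ₂ c₂).1 rfl
  have hnp : ∀ {r : F} (n : ℤ), ‖r‖ = ‖ϖ‖ ^ n →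
      ((∃ z : E, z * star z = algebraMap F E r) ↔ Even n) := fun n h => S.exists_norm_eq_iff h
  -- A conjugation between the representatives would make 1/ϖ a norm.
  have hcne : c₁ ≠ c₂ := by
    intro h
    obtain ⟨g, hg⟩ := MulAction.orbitRel_apply.1 (Quotient.eq.1 h.symm)
    have := S.exists_norm_of_smul_herm_eq hb hm2 hlm hg
    rw [hnp (-1)] at this
    · exact absurd this (by decide)
    · rw [norm_div, norm_mul, zpow_neg_one]
      have : ‖m‖ ≠ 0 := norm_ne_zero_iff.2 hm
      field_simp
  have ht₁ : IsTransfer δ (Quotient.out c₁) :=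
    S.isTransfer_of_smul_eq ⟨1, by rw [Intertwines]; simp⟩ g₁ hg₁
  have ht₂ : IsTransfer δ (Quotient.out c₂) :=
    S.isTransfer_of_smul_eq (S.isTransfer_herm_unif a l m) g₂ hg₂
  have key : ∀ (c : MulAction.orbitRel.Quotient S.U2 (V2 ζ S.star_zeta).Herm)
      (h : IsTransfer δ (Quotient.out c)),
      (c = c₁ ∧ kappa δ (algebraMap F E (a - b)) (inv δ (Quotient.out c) h) *
        Orb ν (Quotient.out c) (Phi ν) = Orb ν δ (Phi ν)) ∨
      (c = c₂ ∧ kappa δ (algebraMap F E (a - b)) (inv δ (Quotient.out c) h) *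
        Orb ν (Quotient.out c) (Phi ν) = -Orb ν δ₂ (Phi ν)) := by
    intro c h
    obtain ⟨y', l', m', e, he⟩ := S.exists_eq_herm_of_isTransfer h
    have he' : y' ^ 2 + l' * m' = l / ϖ * (m * ϖ) := by rw [he, hlm2']
    have hm' : m' ≠ 0 := S.ne_zero_of_mul_zeta_sq hb (by rw [he, hlm])
    have hk : ∀ (x : (V2 ζ S.star_zeta).Herm) (hx : IsTransfer δ x), x = S.herm a y' l' m' →
        kappa δ (algebraMap F E (a - b)) (inv δ x hx) = omega (algebraMap F E (m / m')) := by
      rintro x hx rfl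
      exact S.kappa_inv_herm hb hm hm' hlm0 hx
    rw [hk _ h e]
    obtain ⟨n, hn⟩ := S.exists_zpow (div_ne_zero hm' hm)
    have hn' : ‖m / m'‖ = ‖ϖ‖ ^ (-n) := by rw [zpow_neg, ← hn, ← norm_inv, inv_div]
    rw [S.omega_coe hn']
    -- The parity of n = val(m'/m) decides both the rational class and the sign κ: even gives the
    -- class of δ, odd that of δ₂.
    rcases Int.even_or_odd n with hev | hodd
    · left
      obtain ⟨g, hg⟩ := S.exists_smul_herm_eq (a := a) hm hm' he ((hnp n hn).2 hev)
      rw [← e] at hg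
      refine ⟨((hmk _ c).2 ⟨g, hg⟩).symm, ?_⟩
      rw [hev.neg.neg_one_zpow, one_mul, ← inv_smul_eq_iff.2 hg.symm, horb hlm hm]
    · right
      have hn2 : ‖m' / (m * ϖ)‖ = ‖ϖ‖ ^ (n - 1) := by
        rw [← div_div, norm_div, hn, zpow_sub_one₀ hp.ne', div_eq_mul_inv]
      obtain ⟨g, hg⟩ := S.exists_smul_herm_eq (a := a) hm2 hm' he'
        ((hnp _ hn2).2 (hodd.sub_odd odd_one))
      rw [← e] at hg
      refine ⟨((hmk _ c).2 ⟨g, hg⟩).symm, ?_⟩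
      rw [hodd.neg.neg_one_zpow, ← inv_smul_eq_iff.2 hg.symm, horb hlm2 hm2, neg_one_mul]
  rw [OrbKappa, finsum_eq_sum_of_support_subset (s := {c₁, c₂}), Finset.sum_pair hcne,
    finsum_eq_dif, finsum_eq_dif, dif_pos ht₁, dif_pos ht₂,
    ((key c₁ ht₁).resolve_right fun h => hcne h.1).2,
    ((key c₂ ht₂).resolve_left fun h => hcne h.1.symm).2, sub_eq_add_neg]
  · intro c hc
    rw [Function.mem_support, finsum_eq_dif] at hc
    have ht : IsTransfer δ (Quotient.out c) := by
      by_contra h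
      exact hc (dif_neg h)
    rcases key c ht with h | h <;> simp [h.1]

end

end UnramifiedPair

end RelEndo

namespace RelEndo

/-! ### The endoscopic side -/

section RankOne

variable {E : Type*} [Field E] [StarRing E]

lemma V1_adj (X : Matrix (Fin 1) (Fin 1) E) : (V1 E).adj X = Xᴴ := by
  simp [HermForm.adj, unitForm]

lemma V1_mul_adj_apply (X : Matrix (Fin 1) (Fin 1) E) :
    (X * (V1 E).adj X) 0 0 = X 0 0 * star (X 0 0) := by
  rw [V1_adj, Matrix.mul_apply, Fin.sum_univ_one, Matrix.conjTranspose_apply]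

lemma V1_star_apply (δ : (V1 E).Herm) : star (δ.1 0 0) = δ.1 0 0 := by
  have h := congrFun (congrFun δ.2 0) 0
  rwa [V1_adj, Matrix.conjTranspose_apply] at h

lemma V1_U_apply (g : (V1 E).U) : (g : GL (Fin 1) E).1 0 0 * star ((g : GL (Fin 1) E).1 0 0) = 1 := by
  have h := HermForm.mem_U_iff.1 g.2
  rw [mul_eq_one_comm] at h
  rw [← V1_mul_adj_apply, h, Matrix.one_apply_eq]

lemma V1_mul_comm (X Y : Matrix (Fin 1) (Fin 1) E) : X * Y = Y * X := by
  ext i j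
  fin_cases i
  fin_cases j
  simp [Matrix.mul_apply, mul_comm]

lemma V1_smul (g : (V1 E).U) (δ : (V1 E).Herm) : g • δ = δ := by
  apply Subtype.ext
  rw [HermForm.coe_smul, V1_mul_comm _ δ.1, mul_assoc, Units.mul_inv, mul_one]

lemma V1_eq_of_isTransfer {δ δ' : (V1 E).Herm} (h : IsTransfer δ δ') : δ' = δ := by
  obtain ⟨g, hg⟩ := h
  apply Subtype.ext
  rw [Intertwines, V1_mul_comm] at hg
  have := congrArg (fun X => X * ((g⁻¹ : GL (Fin 1) E) : Matrix (Fin 1) (Fin 1) E)) hg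
  simpa only [mul_assoc, Units.mul_inv, mul_one] using this.symm

lemma isTransfer_refl {ι : Type*} [Fintype ι] [DecidableEq ι] {H : HermForm E ι} (δ : H.Herm) :
    IsTransfer δ δ := ⟨1, by rw [Intertwines]; simp⟩

end RankOne

namespace UnramifiedPair

variable {F E : Type*} [NontriviallyNormedField F] [IsUltrametricDist F] [LocallyCompactSpace F]
    [NormedField E] [NormedAlgebra F E] [StarRing E] {ϖ : F} {ζ : Eˣ}

section
variable (S : UnramifiedPair (E := E) ϖ ζ)

include S in
lemma norm_V1_U_apply (g : (V1 E).U) : ‖(g : GL (Fin 1) E).1 0 0‖ = 1 := by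
  have h := congrArg norm (V1_U_apply g)
  rw [norm_mul, S.norm_star, norm_one] at h
  nlinarith [norm_nonneg ((g : GL (Fin 1) E).1 0 0)]

include S in
lemma isIntegral_V1_U (g : (V1 E).U) : IsIntegral ((g : GL (Fin 1) E) : Matrix (Fin 1) (Fin 1) E) := by
  intro i j
  fin_cases i
  fin_cases j
  exact (S.norm_V1_U_apply g).le

include S in
lemma ULattice_V1 : ULattice (V1 E) = Set.univ :=
  Set.eq_univ_of_forall fun g => ⟨S.isIntegral_V1_U g, S.isIntegral_V1_U g⁻¹⟩

include S in
lemma compactSpace_V1_U : CompactSpace (V1 E).U := by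
  refine ⟨?_⟩
  have h := S.isCompact_bounded_U (V1 E) 1
  have e : {g : (V1 E).U | (∀ i j, ‖((g : GL (Fin 1) E) : Matrix (Fin 1) (Fin 1) E) i j‖ ≤ 1) ∧
      ∀ i j, ‖(((g : GL (Fin 1) E)⁻¹ : GL (Fin 1) E) : Matrix (Fin 1) (Fin 1) E) i j‖ ≤ 1} =
      Set.univ := S.ULattice_V1
  rwa [e] at h

include S in
-- In rank one conjugation is trivial, so stable class, rational class and point coincide. The
-- stabilizer is the whole compact group, of volume one.
lemma SO_eq (ν : Measure (V1 E).U) [ν.IsHaarMeasure] (hν : ν (ULattice (V1 E)) = 1)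
    (p : (V1 E).Herm × (V1 E).Herm) (f : (V1 E).Herm × (V1 E).Herm → ℂ) :
    SO (ν.prod ν) p f = f p := by
  classical
  have := S.compactSpace_V1_U
  have := S.secondCountableTopology_U (V1 E)
  have : IsProbabilityMeasure ν := ⟨by rw [← S.ULattice_V1, hν]⟩
  have hsmul : ∀ (g : (V1 E).U × (V1 E).U) (x : (V1 E).Herm × (V1 E).Herm), g • x = x :=
    fun g x => Prod.ext (V1_smul g.1 x.1) (V1_smul g.2 x.2)
  have horb : Orb (ν.prod ν) p f = f p := by
    have hc : IsCompact (MulAction.stabilizer ((V1 E).U × (V1 E).U) p :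
        Set ((V1 E).U × (V1 E).U)) := by
      have : (MulAction.stabilizer ((V1 E).U × (V1 E).U) p : Set ((V1 E).U × (V1 E).U)) =
          Set.univ := Set.eq_univ_of_forall fun g => hsmul g p
      rw [this]
      exact isCompact_univ
    rw [Orb_eq_integral _ hc]
    · simp only [hsmul, integral_const, probReal_univ, one_smul]
    · simp only [hsmul, measurable_const]
  have hout : ∀ c : MulAction.orbitRel.Quotient ((V1 E).U × (V1 E).U)
      ((V1 E).Herm × (V1 E).Herm), IsTransfer p.1 (Quotient.out c).1 ∧
        IsTransfer p.2 (Quotient.out c).2 → Quotient.out c = p :=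
    fun c h => Prod.ext (V1_eq_of_isTransfer h.1) (V1_eq_of_isTransfer h.2)
  have hp : Quotient.out (Quotient.mk _ p : MulAction.orbitRel.Quotient ((V1 E).U × (V1 E).U)
      ((V1 E).Herm × (V1 E).Herm)) = p := by
    obtain ⟨g, hg⟩ := MulAction.orbitRel_apply.1 (Quotient.mk_out (s := MulAction.orbitRel
      ((V1 E).U × (V1 E).U) ((V1 E).Herm × (V1 E).Herm)) p)
    exact (hg.symm.trans (hsmul g p))
  rw [SO, finsum_eq_single _ (Quotient.mk _ p)]
  · have ht : IsTransfer p.1 (Quotient.out (Quotient.mk _ p : MulAction.orbitRel.Quotient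
        ((V1 E).U × (V1 E).U) ((V1 E).Herm × (V1 E).Herm))).1 ∧
        IsTransfer p.2 (Quotient.out (Quotient.mk _ p : MulAction.orbitRel.Quotient
        ((V1 E).U × (V1 E).U) ((V1 E).Herm × (V1 E).Herm))).2 := by
      rw [hp]
      exact ⟨isTransfer_refl _, isTransfer_refl _⟩
    rw [finsum_eq_if, if_pos ht, hp, horb]
  · intro c hc
    rw [finsum_eq_if, if_neg]
    intro h
    refine hc ?_
    rw [← Quotient.out_eq c, hout c h]

include S in
lemma even_val_iff (δ : (V1 E).Herm) (hδ : δ.1 0 0 ≠ 0) :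
    (∃ X : GL (Fin 1) E, (X : Matrix (Fin 1) (Fin 1) E) * (V1 E).adj X = δ.1) ↔
      Even (val ϖ (δ.1 0 0)) := by
  obtain ⟨x, hx⟩ := (S.star_eq_iff _).1 (V1_star_apply δ)
  have hn := S.norm_eq_val hδ
  rw [← hx, norm_algebraMap', hx] at hn
  rw [← S.exists_norm_eq_iff hn, hx]
  constructor
  · rintro ⟨X, hX⟩
    exact ⟨X.1 0 0, by rw [← V1_mul_adj_apply, hX]⟩
  · rintro ⟨z, hz⟩
    have hz0 : z ≠ 0 := by
      rintro rfl
      rw [zero_mul] at hz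
      exact hδ hz.symm
    refine ⟨Matrix.GeneralLinearGroup.mkOfDetNeZero !![z] (by simpa), ?_⟩
    ext i j
    fin_cases i
    fin_cases j
    refine (V1_mul_adj_apply _).trans ?_
    exact hz

open Classical in
include S in
-- Elements of U(V₁) have norm 1, so the integrand of the pushforward is constant and depends only
-- on whether ‖X‖² = ‖δ‖ is at most 1.
lemma charEnd_mul_U {X : Matrix (Fin 1) (Fin 1) E} {δ : (V1 E).Herm} (hδ : δ.1 0 0 ≠ 0)
    (hX : X * (V1 E).adj X = δ.1) (g : (V1 E).U) :
    charEnd (X * ((g : GL (Fin 1) E) : Matrix (Fin 1) (Fin 1) E)) =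
      if 0 ≤ val ϖ (δ.1 0 0) then 1 else 0 := by
  have hn := S.norm_eq_val hδ
  have hXn : ‖δ.1 0 0‖ = ‖X 0 0‖ * ‖X 0 0‖ := by
    rw [← hX, V1_mul_adj_apply, norm_mul, S.norm_star]
  rw [hXn] at hn
  have e : IsIntegral (X * ((g : GL (Fin 1) E) : Matrix (Fin 1) (Fin 1) E)) ↔ ‖X 0 0‖ ≤ 1 := by
    have : ‖(X * ((g : GL (Fin 1) E) : Matrix (Fin 1) (Fin 1) E)) 0 0‖ = ‖X 0 0‖ := by
      rw [Matrix.mul_apply, Fin.sum_univ_one, norm_mul, S.norm_V1_U_apply, mul_one]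
    rw [← this]
    refine ⟨fun h => h 0 0, fun h i j => ?_⟩
    fin_cases i
    fin_cases j
    exact h
  rw [charEnd]
  refine if_congr ?_ rfl rfl
  have h0 : (1 : ℝ) = ‖ϖ‖ ^ (0 : ℤ) := (zpow_zero _).symm
  rw [e, ← S.zpow_le_zpow, ← hn, ← h0]
  constructor
  · intro h
    exact mul_le_one₀ h (norm_nonneg _) h
  · intro h
    nlinarith [norm_nonneg (X 0 0)]

include S in
theorem PhiKappa_eq_pushforwardProd (ν : Measure (V1 E).U) [ν.IsHaarMeasure]
    (hν : ν (ULattice (V1 E)) = 1) (p : (V1 E).Herm × (V1 E).Herm) (h₁ : p.1.1 0 0 ≠ 0)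
    (h₂ : p.2.1 0 0 ≠ 0) : PhiKappa ϖ p = pushforwardProd (ν.prod ν) basicFun p := by
  classical
  have : IsProbabilityMeasure ν := ⟨by rw [← S.ULattice_V1, hν]⟩
  have he₁ := S.even_val_iff p.1 h₁
  have he₂ := S.even_val_iff p.2 h₂
  rw [PhiKappa, pushforwardProd]
  split_ifs with hk hex hex
  · simp only [basicFun, S.charEnd_mul_U h₁ hex.choose_spec.1,
      S.charEnd_mul_U h₂ hex.choose_spec.2, if_pos hk.1.1, if_pos hk.2.1, integral_const,
      probReal_univ, one_smul, mul_one]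
  · obtain ⟨X, hX⟩ := he₁.2 hk.1.2
    obtain ⟨Y, hY⟩ := he₂.2 hk.2.2
    exact absurd ⟨(X, Y), hX, hY⟩ hex
  · simp only [basicFun, S.charEnd_mul_U h₁ hex.choose_spec.1,
      S.charEnd_mul_U h₂ hex.choose_spec.2]
    obtain ⟨X, hX, hY⟩ := hex
    have e₁ := he₁.1 ⟨_, hX⟩
    have e₂ := he₂.1 ⟨_, hY⟩
    have h0 : ((if 0 ≤ val ϖ (p.1.1 0 0) then 1 else 0) *
        if 0 ≤ val ϖ (p.2.1 0 0) then 1 else 0 : ℂ) = 0 := by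
      rw [mul_ite, mul_one, mul_zero, ite_eq_right_iff]
      exact fun h => if_neg fun h' => hk ⟨⟨h', e₁⟩, h, e₂⟩
    simp only [h0, integral_zero]
  · rfl

lemma hermMat_eq (a l m : F) (ha hl hm) :
    hermMat ζ S.star_zeta (algebraMap F E a) (algebraMap F E l) (algebraMap F E m) ha hl hm =
      S.herm a 0 l m := by
  apply Subtype.ext
  rw [coe_herm, hermMat]
  simp [mul_comm]

include S in
lemma val_coe_eq {x : F} {n : ℤ} (hx : ‖x‖ = ‖ϖ‖ ^ n) : val ϖ (algebraMap F E x) = n :=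
  S.val_eq (by rw [norm_algebraMap', hx])

/-- The value of the transfer factor. -/
theorem transferFactor_eq {a l m b : F} (hb : b ≠ 0)
    (h : algebraMap F E (l * m) * (ζ : E) ^ 2 = algebraMap F E (b ^ 2)) {e B : ℤ}
    (hm : ‖m‖ = ‖ϖ‖ ^ e) (he : Even e) (hB : ‖b‖ = ‖ϖ‖ ^ B) :
    transferFactor ϖ (S.hermPair a b) (S.herm a 0 l m) = (resCard F : ℂ) ^ (-B) := by
  have hm0 : m ≠ 0 := by
    rintro rfl
    rw [norm_zero] at hm
    exact (zpow_pos S.unif_pos e).ne hm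
  obtain ⟨g, -, hg⟩ := S.exists_diagonalize (a := a) hb hm0 h one_ne_zero one_ne_zero
  have ht : IsTransfer (S.herm a 0 l m) (directSum (S.hermPair a b)) := ⟨g, hg⟩
  have e₁ : (S.hermPair a b).1.1 0 0 = algebraMap F E (a + b) := rfl
  have e₂ : (S.hermPair a b).2.1 0 0 = algebraMap F E (a - b) := rfl
  have hn2 : ‖2 * b‖ = ‖ϖ‖ ^ B := by rw [norm_mul, S.norm_two, one_mul, hB]
  have hn3 : ‖2 * b * m‖ = ‖ϖ‖ ^ (B + e) := by
    rw [norm_mul, hn2, hm, zpow_add₀ S.unif_pos.ne']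
  have e₃ : a + b - (a - b) = 2 * b := by ring
  -- κ(inv) = ω(2bm) contributes (−1)^(B+e) = (−1)^B and ω(2b) contributes (−1)^B, so the signs
  -- cancel and only the absolute value of 2b remains.
  rw [transferFactor, dif_pos ht, e₁, e₂, ← map_sub, e₃, S.kappa_inv_directSum hb hm0 h,
    S.omega_coe hn2, S.omega_coe hn3, absF, S.val_coe_eq hn2, zpow_add₀ (by norm_num),
    he.neg_one_zpow, mul_one, ← mul_zpow]
  norm_num

end

end UnramifiedPair

end RelEndo

/-! ### The fundamental lemma for Φ and the transfer factor -/

theorem mainTheorem5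
    {F E : Type*} [NontriviallyNormedField F] [IsUltrametricDist F] [LocallyCompactSpace F]
    [NormedField E] [NormedAlgebra F E] [StarRing E]
    -- `E/F` is an unramified quadratic extension, `star` its nontrivial automorphism
    (hdeg : Module.finrank F E = 2)
    (hstar : ∀ x : E, star x = x ↔ x ∈ Set.range (algebraMap F E))
    (hunr : ∀ y : E, ∃ x : F, ‖y‖ = ‖x‖)
    -- the residue characteristic is odd
    (h2 : ‖(2 : F)‖ = 1)
    (ϖ : F) (hϖ : RelEndo.IsUniformizer ϖ)
    (ζ : Eˣ) (hζ : star (ζ : E) = -(ζ : E)) (hζ1 : ‖(ζ : E)‖ = 1)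
    -- Haar measures giving the hyperspecial maximal compact subgroups volume one
    (ν₂ : MeasureTheory.Measure (RelEndo.V2 ζ hζ).U) [ν₂.IsHaarMeasure]
    (hν₂ : ν₂ (RelEndo.ULattice (RelEndo.V2 ζ hζ)) = 1)
    (ν₁ : MeasureTheory.Measure (RelEndo.V1 E).U) [ν₁.IsHaarMeasure]
    (hν₁ : ν₁ (RelEndo.ULattice (RelEndo.V1 E)) = 1) :
    -- `Φ^κ` is the pushforward of the basic function
    (∀ p : (RelEndo.V1 E).Herm × (RelEndo.V1 E).Herm, p.1.1 0 0 ≠ 0 → p.2.1 0 0 ≠ 0 →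
      RelEndo.PhiKappa ϖ p = RelEndo.pushforwardProd (ν₁.prod ν₁) RelEndo.basicFun p) ∧
    ∀ (a b lam mu : F), b ≠ 0 → a + b ≠ 0 → a - b ≠ 0 →
      algebraMap F E (lam * mu) * (ζ : E) ^ 2 = algebraMap F E (b ^ 2) →
      RelEndo.omega (algebraMap F E mu) = 1 →
      ∀ (δ : (RelEndo.V2 ζ hζ).Herm) (p : (RelEndo.V1 E).Herm × (RelEndo.V1 E).Herm),
      -- `δ = δ_+` and `p = (a + b, a - b)`
      δ = RelEndo.hermMat ζ hζ (algebraMap F E a) (algebraMap F E lam) (algebraMap F E mu)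
        ((hstar _).2 ⟨_, rfl⟩) ((hstar _).2 ⟨_, rfl⟩) ((hstar _).2 ⟨_, rfl⟩) →
      p = (RelEndo.herm1 (algebraMap F E (a + b)) ((hstar _).2 ⟨_, rfl⟩),
        RelEndo.herm1 (algebraMap F E (a - b)) ((hstar _).2 ⟨_, rfl⟩)) →
      RelEndo.SO (ν₁.prod ν₁) p (RelEndo.PhiKappa ϖ) =
          RelEndo.transferFactor ϖ p δ *
            RelEndo.OrbKappa ν₂ (algebraMap F E (a - b)) δ (RelEndo.Phi ν₂) ∧
        -- the value of the transfer factor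
        (RelEndo.IsNiceMatch p δ ↔ Even (RelEndo.val ϖ b)) ∧
        (RelEndo.IsNiceMatch p δ →
          RelEndo.transferFactor ϖ p δ = (-(RelEndo.resCard F : ℂ)) ^ (-RelEndo.val ϖ b)) ∧
        (¬ RelEndo.IsNiceMatch p δ →
          RelEndo.transferFactor ϖ p δ = -(-(RelEndo.resCard F : ℂ)) ^ (-RelEndo.val ϖ b)) := by
  have S : RelEndo.UnramifiedPair (E := E) ϖ ζ :=
    ⟨FiniteDimensional.of_finrank_pos (by omega), hstar, h2, hϖ, hζ, hζ1⟩
  refine ⟨S.PhiKappa_eq_pushforwardProd ν₁ hν₁, ?_⟩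
  rintro a b l m hb hab hab' hlm hω δ p rfl rfl
  rw [S.hermMat_eq]
  change RelEndo.SO (ν₁.prod ν₁) (S.hermPair a b) (RelEndo.PhiKappa ϖ) =
      RelEndo.transferFactor ϖ (S.hermPair a b) _ * _ ∧
    (RelEndo.IsNiceMatch (S.hermPair a b) _ ↔ _) ∧
    (RelEndo.IsNiceMatch (S.hermPair a b) _ →
      RelEndo.transferFactor ϖ (S.hermPair a b) _ = _) ∧
    (¬ RelEndo.IsNiceMatch (S.hermPair a b) _ →
      RelEndo.transferFactor ϖ (S.hermPair a b) _ = _)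
  classical
  have hm0 : m ≠ 0 := by
    rintro rfl
    rw [mul_zero, map_zero, zero_mul, eq_comm, map_eq_zero] at hlm
    exact pow_ne_zero 2 hb hlm
  obtain ⟨e, he⟩ := S.exists_zpow hm0
  obtain ⟨B, hB⟩ := S.exists_zpow hb
  obtain ⟨u, hu⟩ := S.exists_zpow hab
  obtain ⟨v, hv⟩ := S.exists_zpow hab'
  have hev : Even e := by
    rw [S.omega_coe he] at hω
    by_contra h
    rw [(Int.not_even_iff_odd.1 h).neg_one_zpow] at hω
    norm_num at hω
  -- Here the valuation is that of b as an element of F, not of its image in E.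
  have hval : RelEndo.val ϖ b = B := by
    rw [RelEndo.val, hB, Real.logb, Real.log_zpow, mul_div_assoc,
      div_self (Real.log_neg S.unif_pos S.unif_lt).ne, mul_one, Int.floor_intCast]
  have hq : (RelEndo.resCard F : ℂ) ≠ 0 := Nat.cast_ne_zero.2 S.resCard_pos.ne'
  have hnice : RelEndo.IsNiceMatch (S.hermPair a b) (S.herm a 0 l m) ↔ Even B := by
    rw [S.isNiceMatch_iff hb hm0 hlm (n := B + e), Int.even_add, iff_true_right hev]
    rw [norm_mul, hB, he, zpow_add₀ S.unif_pos.ne']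
  rw [S.transferFactor_eq hb hlm he hev hB, hval, hnice,
    S.OrbKappa_eq ν₂ hν₂ hb hlm (mul_ne_zero hab hab'),
    S.Orb_Phi_sub_Orb_Phi ν₂ hν₂ he hev hB hlm hu hv, S.SO_eq ν₁ hν₁]
  refine ⟨?_, Iff.rfl, fun h => ?_, fun h => ?_⟩
  · have e₁ : RelEndo.val ϖ ((S.hermPair a b).1.1 0 0) = u := S.val_coe_eq hu
    have e₂ : RelEndo.val ϖ ((S.hermPair a b).2.1 0 0) = v := S.val_coe_eq hv
    -- The factor q^(−B) of Δ cancels the q^B of Orb^κ.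
    rw [RelEndo.PhiKappa, e₁, e₂, mul_ite, mul_zero, ← zpow_add₀ hq, neg_add_cancel, zpow_zero]
  -- In both cases Δ = q^(−B); the parity of B only decides whether q^(−B) equals (−q)^(−B) or its
  -- negative.
  · rw [h.neg.neg_zpow]
  · rw [(Int.not_even_iff_odd.1 h).neg.neg_zpow, neg_neg]
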